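/- Fix $\beta>0$ and $m>0$. For $k,k'\ge 0$ and $t\in[-1,1]$ put $R=\sqrt{k^2+k'^2-2kk't}$ and let $$\mathcal B_\beta(k,k')=\sqrt\beta\,e^{\beta\frac{k+k'}2}\int_{-1}^{1}\frac{1+t^2}{R}\,\exp\Big(-\beta\,\frac{\Delta^2+\frac{m^2w^4}{4}}{2mw^2}\Big)dt,\qquad w=\frac{R}{m},\quad \Delta=k'-k .$$ For $\theta\in(0,1)$, $\delta_*>0$ and $\rho>0$ let $D(\theta,\delta_*,\rho)$ be the set of all $(k,k')\in[0,\infty)^2$ such that $|k-k'|\le\rho\sqrt{kk'(k+k')}$ if $(k,k')\in[0,\delta_*]^2$, and $\theta k\le k'\le\theta^{-1}k$ if $(k,k')\notin[0,\delta_*]^2$. Put $\rho_*=\rho_*(\theta,\delta_*)=\frac{1-\theta}{\sqrt{\theta(1+\theta)\delta_*}}$ (the value for which the two parts of the boundary match) and $D=D(\theta,\delta_*,\rho_*)$. A cut-off with parameters $\theta,\delta_*$ is a symmetric function $\Phi:[0,\infty)^2\to[0,1]$, continuous on $[0,\infty)^2\setminus\{(0,0)\}$, with $\operatorname{supp}\Phi=D$,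 and such that $\Phi=1$ on $D_1\setminus\{(0,0)\}$ for some $D_1=D(\theta_1,\delta_*,\rho_1)\subset D$ with $\theta_1\in(\theta,1)$ and $\rho_1>0$. Let $\mathscr M_+=\mathscr M_+([0,\infty))$ be the finite nonnegative Borel measures on $[0,\infty)$ with the narrow topology, $M_0(v)=v([0,\infty))$ and $X_\eta(v)=\int_{[0,\infty)}e^{\eta k}v(dk)$. **Theorem.** There is a constant $C_*>0$, depending only on $\beta$ and $m$, with $$\mathcal B_\beta(k,k')\le \frac{C_*\,e^{\beta (k+k')/2}}{k+k'}\qquad\text{for all }k,k'>0 \tag{1}$$ (for $\beta=1$ it is the least constant with this property), such that the following holds for all $\theta\in(0,1)$, all $\delta_*>0$ and every cut-off $\Phi$ with parameters $\theta,\delta_*$. Given any $\eta\in\left(\frac{1-\theta}2,\frac12\right)$ and any $v_0\in\mathscr M_+$ with $X_\eta(v_0)<\infty$, there is $v\in C([0,\infty),\mathscr M_+)$ that is a weak solution, with initial datum $v_0$, of $$\frac{\partial v}{\partial t}(t,k)=\int_{[0,\infty)}q_\beta(v,v')\,\frac{\mathcal B_\beta(k,k')\Phi(k,k')}{kk'}\,dk',\qquad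 q_\beta(v,v')=v'(k^2+v)e^{-\beta k}-v(k'^2+v')e^{-\beta k'},$$ that is: (i) for all $\varphi\in C_b([0,\infty))$ the map $t\mapsto\int\varphi\,dv(t)$ is continuous on $[0,\infty)$, and $\int\varphi\,dv(0)=\int\varphi\,dv_0$; (ii) for all $\varphi\in C^1_b([0,\infty))$ (that is, $\varphi$ and $\varphi'$ are bounded and continuous) with $\varphi'(0)=0$, the map $t\mapsto\int\varphi\,dv(t)$ belongs to $W^{1,\infty}_{loc}([0,\infty))$, and for almost every $t>0$, writing $v=v(t)$ and $b=\frac{\Phi\mathcal B_\beta}{kk'}$, $$\frac{d}{dt}\int_{[0,\infty)}\varphi\,dv(t)=\frac12\iint_{[0,\infty)^2} b\; q_\beta(v,v')\,(\varphi(k)-\varphi(k'))\,dk\,dk',$$ where the right-hand side stands for $$\frac12\Big[\iint b\,(e^{-\beta k}-e^{-\beta k'})(\varphi(k)-\varphi(k'))\,v(dk)v(dk')+\iint b\,k^2e^{-\beta k}(\varphi(k)-\varphi(k'))\,dk\,v(dk')-\iint b\,k'^2e^{-\beta k'}(\varphi(k)-\varphi(k'))\,v(dk)\,dk'\Big],$$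 the integrands being $0$ where $kk'=0$, and the three integrals converge absolutely. Moreover, for all $t\ge0$, $$M_0(v(t))=M_0(v_0),\qquad X_\eta(v(t))\le e^{C_\eta t}X_\eta(v_0),\qquad C_\eta=\frac{C_*}{2\theta^2}\,\frac{1-\theta}{1+\theta}\,\frac{\eta}{\frac12-\eta}.$$ -/

import Mathlib

open Set MeasureTheory
open scoped NNReal ENNReal ContDiff

noncomputable section

/-- The Euclidean distance `|𝐤' - 𝐤|` of two vectors of `ℝ³` of lengths `k` and `k'` whose angle
has cosine `t`. -/
def vecDist (k k' t : ℝ) : ℝ := Real.sqrt (k ^ 2 + k' ^ 2 - 2 * k * k' * t)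

/-- The redistribution function `𝓑_β(k, k')` of Compton scattering on electrons of mass `m`,
in the Thomson approximation; the integration variable `t` is the cosine of the scattering angle,
`v = |𝐤' - 𝐤| / m` and `Δ = k' - k`. -/
def comptonKernel (β m k k' : ℝ) : ℝ :=
  Real.sqrt β * Real.exp (β * ((k' + k) / 2)) *
    ∫ t in (-1 : ℝ)..1, (1 + t ^ 2) / vecDist k k' t *
      Real.exp (-β * (((k' - k) ^ 2 + m ^ 2 * (vecDist k k' t / m) ^ 4 / 4) /
        (2 * m * (vecDist k k' t / m) ^ 2)))

/-- The set of the constants `C` with `𝓑_β(k, k') ≤ C e^{β(k+k')/2} / (k + k')`. -/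
def kernelBounds (β m : ℝ) : Set ℝ :=
  {C | ∀ k k' : ℝ, 0 < k → 0 < k' →
    comptonKernel β m k k' ≤ C * Real.exp (β * ((k + k') / 2)) / (k + k')}

/-- The region around the diagonal of `[0, ∞)²` bounded by the curves `|k - k'| = ρ √(kk'(k+k'))`
inside the square `[0, δ]²` and by a cone of opening `θ` outside of it. -/
def cutoffRegion (θ δ ρ : ℝ) : Set (ℝ≥0 × ℝ≥0) :=
  {p | ((p.1 : ℝ) ≤ δ ∧ (p.2 : ℝ) ≤ δ ∧
          |(p.1 : ℝ) - p.2| ≤ ρ * Real.sqrt ((p.1 : ℝ) * p.2 * ((p.1 : ℝ) + p.2))) ∨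
       (¬ ((p.1 : ℝ) ≤ δ ∧ (p.2 : ℝ) ≤ δ) ∧
          θ * (p.1 : ℝ) ≤ p.2 ∧ (p.2 : ℝ) ≤ θ⁻¹ * p.1)}

/-- The value `ρ_*(θ, δ)` for which the two parts of the boundary of `cutoffRegion θ δ ρ` match,
that is, for which `(δ, θ δ)` lies on the curve `|k - k'| = ρ √(kk'(k+k'))`. -/
def rhoStar (θ δ : ℝ) : ℝ := (1 - θ) / Real.sqrt (θ * (1 + θ) * δ)

/-- The cut-off functions `Φ` with parameters `θ` and `δ`. Nothing is asked of the value of `Φ` at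
the origin, beyond lying in `[0, 1]`. -/
structure IsCutoff (θ δ : ℝ) (Φ : ℝ≥0 × ℝ≥0 → ℝ) : Prop where
  nonneg : ∀ p, 0 ≤ Φ p
  le_one : ∀ p, Φ p ≤ 1
  symm : ∀ k k' : ℝ≥0, Φ (k, k') = Φ (k', k)
  continuousOn : ContinuousOn Φ {(0, 0)}ᶜ
  support_eq : tsupport Φ = cutoffRegion θ δ (rhoStar θ δ)
  eq_one : ∃ θ₁ ρ₁ : ℝ, θ < θ₁ ∧ θ₁ < 1 ∧ 0 < ρ₁ ∧
    cutoffRegion θ₁ δ ρ₁ ⊆ cutoffRegion θ δ (rhoStar θ δ) ∧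
    ∀ p ∈ cutoffRegion θ₁ δ ρ₁, p ≠ (0, 0) → Φ p = 1

/-- The kernel `Φ 𝓑_β / (k k')`. On the axes, away from the origin, `Φ` vanishes, so the convention
for division by zero gives the right value there. At the origin every integrand below has the
factor `φ(k) - φ(k') = 0`. -/
def truncKernel (β m : ℝ) (Φ : ℝ≥0 × ℝ≥0 → ℝ) (p : ℝ≥0 × ℝ≥0) : ℝ :=
  Φ p * comptonKernel β m p.1 p.2 / ((p.1 : ℝ) * p.2)

/-- Integrand of the part of `(Φ 𝓑_β / kk') q_β(v, v') (φ - φ') dk dk'` that is quadratic in `v`;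
it is integrated against `v(dk) v(dk')`. -/
def quadraticIntegrand (β m : ℝ) (Φ : ℝ≥0 × ℝ≥0 → ℝ) (φ : ℝ → ℝ) (p : ℝ≥0 × ℝ≥0) : ℝ :=
  truncKernel β m Φ p * (Real.exp (-β * p.1) - Real.exp (-β * p.2)) * (φ p.1 - φ p.2)

/-- Integrand of the term with `v' k² e^{-βk}`; it is integrated against `dk v(dk')`. -/
def gainIntegrand (β m : ℝ) (Φ : ℝ≥0 × ℝ≥0 → ℝ) (φ : ℝ → ℝ) (p : ℝ≥0 × ℝ≥0) : ℝ :=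
  truncKernel β m Φ p * ((p.1 : ℝ) ^ 2 * Real.exp (-β * p.1)) * (φ p.1 - φ p.2)

/-- Integrand of the term with `v k'² e^{-βk'}`; it is integrated against `v(dk) dk'`. -/
def lossIntegrand (β m : ℝ) (Φ : ℝ≥0 × ℝ≥0 → ℝ) (φ : ℝ → ℝ) (p : ℝ≥0 × ℝ≥0) : ℝ :=
  truncKernel β m Φ p * ((p.2 : ℝ) ^ 2 * Real.exp (-β * p.2)) * (φ p.1 - φ p.2)

/-- The Lebesgue measure `dk` on `[0, ∞)`. -/
def lebesgueHalfLine : Measure ℝ≥0 :=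
  Measure.map Real.toNNReal ((volume : Measure ℝ).restrict (Ici 0))

/-- The three integrals that make up the weak collision term converge absolutely. -/
def CollisionIntegrable (β m : ℝ) (Φ : ℝ≥0 × ℝ≥0 → ℝ) (φ : ℝ → ℝ) (v : Measure ℝ≥0) : Prop :=
  Integrable (quadraticIntegrand β m Φ φ) (v.prod v) ∧
  Integrable (gainIntegrand β m Φ φ) (lebesgueHalfLine.prod v) ∧
  Integrable (lossIntegrand β m Φ φ) (v.prod lebesgueHalfLine)

/-- `½ ∬ (Φ 𝓑_β / kk') q_β(v, v') (φ - φ') dk dk'` for a measure `v`, where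
`q_β(v, v') = v' (k² + v) e^{-βk} - v (k'² + v') e^{-βk'}`. -/
def weakCollision (β m : ℝ) (Φ : ℝ≥0 × ℝ≥0 → ℝ) (φ : ℝ → ℝ) (v : Measure ℝ≥0) : ℝ :=
  1 / 2 * ((∫ p, quadraticIntegrand β m Φ φ p ∂(v.prod v)) +
    (∫ p, gainIntegrand β m Φ φ p ∂(lebesgueHalfLine.prod v)) -
    ∫ p, lossIntegrand β m Φ φ p ∂(v.prod lebesgueHalfLine))

/-- The functions `φ ∈ C¹_b([0, ∞))` with `φ'(0) = 0` (only the values on `[0, ∞)` matter). -/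
structure IsTestFunction (φ : ℝ → ℝ) : Prop where
  contDiffOn : ContDiffOn ℝ 1 φ (Ici 0)
  bounded : ∃ M : ℝ, ∀ k ∈ Ici (0 : ℝ), |φ k| ≤ M
  deriv_bounded : ∃ M : ℝ, ∀ k ∈ Ici (0 : ℝ), |derivWithin φ (Ici 0) k| ≤ M
  deriv_zero : derivWithin φ (Ici 0) 0 = 0

/-- `f ∈ W^{1,∞}_loc([0, ∞))`: `f` and its weak derivative `g` on `(0, ∞)` are essentially bounded
on `(0, T)` for every `T`. -/
def MemW1InftyLoc (f : ℝ → ℝ) : Prop :=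
  ∃ g : ℝ → ℝ,
    (∀ T : ℝ, 0 < T → MemLp f ∞ (volume.restrict (Ioo 0 T)) ∧
      MemLp g ∞ (volume.restrict (Ioo 0 T))) ∧
    ∀ ψ : ℝ → ℝ, ContDiff ℝ ∞ ψ → HasCompactSupport ψ → tsupport ψ ⊆ Ioi 0 →
      ∫ t in Ioi (0 : ℝ), f t * deriv ψ t = -∫ t in Ioi (0 : ℝ), g t * ψ t

/-- Weak solutions `v : [0, ∞) → 𝓜₊([0, ∞))` of `∂v/∂t = ∫ q_β(v, v') Φ 𝓑_β / (kk') dk'` with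
initial datum `v₀` (only the times `t ≥ 0` matter). -/
structure IsWeakSolution (β m : ℝ) (Φ : ℝ≥0 × ℝ≥0 → ℝ) (v₀ : FiniteMeasure ℝ≥0)
    (v : ℝ → FiniteMeasure ℝ≥0) : Prop where
  continuousOn : ∀ φ : BoundedContinuousFunction ℝ≥0 ℝ,
    ContinuousOn (fun t : ℝ => ∫ k, φ k ∂(v t : Measure ℝ≥0)) (Ici 0)
  initial : ∀ φ : BoundedContinuousFunction ℝ≥0 ℝ,
    ∫ k, φ k ∂(v 0 : Measure ℝ≥0) = ∫ k, φ k ∂(v₀ : Measure ℝ≥0)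
  memW1InftyLoc : ∀ φ : ℝ → ℝ, IsTestFunction φ →
    MemW1InftyLoc (fun t : ℝ => ∫ k : ℝ≥0, φ k ∂(v t : Measure ℝ≥0))
  equation : ∀ φ : ℝ → ℝ, IsTestFunction φ →
    ∀ᵐ t ∂(volume.restrict (Ioi (0 : ℝ))),
      CollisionIntegrable β m Φ φ (v t) ∧
      HasDerivAt (fun s : ℝ => ∫ k : ℝ≥0, φ k ∂(v s : Measure ℝ≥0))
        (weakCollision β m Φ φ (v t)) t

/-- The exponential moment `X_η(v) = ∫ e^{ηk} v(dk)`. -/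
def expMoment (η : ℝ) (v : FiniteMeasure ℝ≥0) : ℝ≥0∞ :=
  ∫⁻ k : ℝ≥0, ENNReal.ofReal (Real.exp (η * k)) ∂(v : Measure ℝ≥0)

/-- The rate `C_η`. -/
def expRate (Cstar θ η : ℝ) : ℝ :=
  Cstar / (2 * θ ^ 2) * ((1 - θ) / (1 + θ)) * (η / (1 / 2 - η))

end

/-! Mass is conserved, so `v = M p` with `p` a probability measure. Exchanging `k` and `k'` turns
the loss term into minus the gain term, and the equation for `p` is that of a mean-field jump
process: a linear part, where mass jumps from `k'` to `k` with density `g = b k² e^{-βk}`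
(`gainRate`), and a quadratic part with the antisymmetric rate `A = b (e^{-βk} - e^{-βk'})`
(`exchangeRate`).

Since `R ≥ (k + k') √((1 - t)/2)` and the exponential in the kernel contains a Gaussian in `k - k'`,
one has `𝓑_β e^{-βk} ≤ K e^{-|k - k'|} / (k + k')`. As `Φ` lives in a cone, the total jump rate out
of any `k'` is then at most `K / θ` (`lintegral_gainRate_le`). The rate `A` is only bounded by `Kβ
|k - k'| / (kk'(k + k'))`, which is singular at the origin, but `(k - k')² ≤ kk'(k + k') / (θδ)` on
the support of `Φ`. Hence `A (φ(k) - φ(k'))` is bounded for Lipschitz `φ`, and it is continuous at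
the origin when `φ'(0) = 0` (`continuous_quadraticIntegrand`). The weak operator is therefore
narrowly continuous even if mass concentrates at `0` (`continuous_profileOperator`).

Approximate solutions come from restricting the rates to momenta at least `r`, where they are
bounded; explicit Euler steps of small length then preserve probability measures
(`exists_euler_step`). For increasing `φ` one has `A (φ(k) - φ(k')) ≤ 0`, so only upward linear
jumps can increase an exponential moment, and the decay `e^{-(k - k')/2}` of their rate beats
`e^{η(k - k')}` because `η < 1/2` (`integral_cutRate_truncExp_le`). This gives tightness. The
operator tested with a fixed `φ` is bounded independently of `r`, which gives equicontinuity in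
time, so a subsequence converges at all times (`exists_subseq_tendsto_curve`). The error of the
restriction tends to `0` uniformly in `p` (`exists_abs_cutOperator_sub_le`), and the integrated
equation passes to the limit. -/

/-! ### Pointwise bounds for the Compton kernel -/

/-- The integrand in the definition of `comptonKernel`. -/
noncomputable def comptonIntegrand (β m k k' t : ℝ) : ℝ :=
  (1 + t ^ 2) / vecDist k k' t *
    Real.exp (-β * (((k' - k) ^ 2 + m ^ 2 * (vecDist k k' t / m) ^ 4 / 4) /
      (2 * m * (vecDist k k' t / m) ^ 2)))

lemma comptonKernel_eq (β m k k' : ℝ) : comptonKernel β m k k' =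
    Real.sqrt β * Real.exp (β * ((k' + k) / 2)) *
      ∫ t in (-1 : ℝ)..1, comptonIntegrand β m k k' t := rfl

lemma vecDist_nonneg (k k' t : ℝ) : 0 ≤ vecDist k k' t := Real.sqrt_nonneg _

lemma vecDist_comm (k k' t : ℝ) : vecDist k k' t = vecDist k' k t := by
  unfold vecDist; ring_nf

lemma comptonIntegrand_comm (β m k k' t : ℝ) :
    comptonIntegrand β m k k' t = comptonIntegrand β m k' k t := by
  unfold comptonIntegrand
  rw [vecDist_comm k k' t, ← neg_sub k' k, neg_sq]

lemma comptonKernel_comm (β m k k' : ℝ) : comptonKernel β m k k' = comptonKernel β m k' k := by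
  simp_rw [comptonKernel_eq, comptonIntegrand_comm β m k k', add_comm k' k]

/-- The difference of the squares is `(k - k')² (1 + t) / 2`. So `1 / R` has at worst an integrable
singularity at `t = 1`, uniformly once `k + k'` is factored out. -/
lemma vecDist_lower (k k' : ℝ) {t : ℝ} (ht : t ∈ Icc (-1 : ℝ) 1) :
    (k + k') * ((1 - t) / 2) ^ (1 / 2 : ℝ) ≤ vecDist k k' t := by
  have h1 : 0 ≤ (1 - t) / 2 := by linarith [ht.2]
  rw [← Real.sqrt_eq_rpow, vecDist]
  apply Real.le_sqrt_of_sq_le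
  rw [mul_pow, Real.sq_sqrt h1]
  nlinarith [mul_nonneg (sq_nonneg (k - k')) (by linarith [ht.1] : 0 ≤ 1 + t)]

lemma sub_sq_le_vecDist_sq {k k' t : ℝ} (hk : 0 ≤ k) (hk' : 0 ≤ k') (ht : t ≤ 1) :
    (k' - k) ^ 2 ≤ vecDist k k' t ^ 2 := by
  have h : (k' - k) ^ 2 ≤ k ^ 2 + k' ^ 2 - 2 * k * k' * t := by
    nlinarith [mul_nonneg (mul_nonneg hk hk') (sub_nonneg.2 ht)]
  rw [vecDist, Real.sq_sqrt (le_trans (sq_nonneg _) h)]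
  exact h

lemma comptonIntegrand_nonneg (β m k k' t : ℝ) : 0 ≤ comptonIntegrand β m k k' t :=
  mul_nonneg (div_nonneg (by positivity) (vecDist_nonneg _ _ _)) (Real.exp_nonneg _)

lemma comptonKernel_nonneg (β m k k' : ℝ) : 0 ≤ comptonKernel β m k k' := by
  rw [comptonKernel_eq]
  refine mul_nonneg (by positivity) (intervalIntegral.integral_nonneg (by norm_num) ?_)
  exact fun t _ => comptonIntegrand_nonneg _ _ _ _ _

lemma vecDist_pos {k k' t : ℝ} (hs : 0 < k + k')
    (ht : t ∈ Ico (-1 : ℝ) 1) : 0 < vecDist k k' t :=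
  lt_of_lt_of_le (mul_pos hs (Real.rpow_pos_of_pos (by linarith [ht.2]) _))
    (vecDist_lower k k' (Ico_subset_Icc_self ht))

/-- With `R` the distance, the exponent without `-β` is `m (k' - k)² / (2R²) + R² / (8m)`. Dropping
the first term and using `R ≥ |k' - k|` leaves a Gaussian independent of `t`. -/
lemma comptonIntegrand_le {β m k k' t : ℝ} (hβ : 0 < β) (hm : 0 < m) (hk : 0 ≤ k) (hk' : 0 ≤ k')
    (hs : 0 < k + k') (ht : t ∈ Ico (-1 : ℝ) 1) :
    comptonIntegrand β m k k' t ≤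
      2 / (k + k') * Real.exp (-β * ((k' - k) ^ 2 / (8 * m))) * ((1 - t) / 2) ^ (-(1 / 2) : ℝ) := by
  have hR := vecDist_lower k k' (Ico_subset_Icc_self ht)
  have hx : 0 < (1 - t) / 2 := by linarith [ht.2]
  have hpos := vecDist_pos hs ht
  have h1 : (1 + t ^ 2) / vecDist k k' t ≤ 2 / (k + k') * ((1 - t) / 2) ^ (-(1 / 2) : ℝ) := by
    rw [Real.rpow_neg hx.le]
    calc (1 + t ^ 2) / vecDist k k' t ≤ 2 / ((k + k') * ((1 - t) / 2) ^ (1 / 2 : ℝ)) := by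
          gcongr
          nlinarith [ht.1, ht.2]
      _ = _ := by field_simp
  have h2 : (k' - k) ^ 2 / (8 * m) ≤ ((k' - k) ^ 2 + m ^ 2 * (vecDist k k' t / m) ^ 4 / 4) /
      (2 * m * (vecDist k k' t / m) ^ 2) := by
    have h3 := sub_sq_le_vecDist_sq hk hk' ht.2.le
    have h4 : ((k' - k) ^ 2 + m ^ 2 * (vecDist k k' t / m) ^ 4 / 4) /
      (2 * m * (vecDist k k' t / m) ^ 2) =
        m * (k' - k) ^ 2 / (2 * vecDist k k' t ^ 2) + vecDist k k' t ^ 2 / (8 * m) := by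
      field_simp
      ring
    rw [h4]
    calc (k' - k) ^ 2 / (8 * m) ≤ vecDist k k' t ^ 2 / (8 * m) := by gcongr
      _ ≤ _ := le_add_of_nonneg_left (by positivity)
  calc comptonIntegrand β m k k' t ≤ 2 / (k + k') * ((1 - t) / 2) ^ (-(1 / 2) : ℝ) *
        Real.exp (-β * ((k' - k) ^ 2 / (8 * m))) := by
        refine mul_le_mul h1 (Real.exp_le_exp.2 ?_) (Real.exp_nonneg _) (by positivity)
        nlinarith
    _ = _ := by ring

lemma intervalIntegrable_half_one_sub_rpow :
    IntervalIntegrable (fun t : ℝ => ((1 - t) / 2) ^ (-(1 / 2) : ℝ)) volume (-1) 1 := by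
  have h : IntervalIntegrable (fun x : ℝ => x ^ (-(1 / 2) : ℝ)) volume 0 1 :=
    intervalIntegral.intervalIntegrable_rpow' (by norm_num)
  have h2 := (h.comp_mul_left (c := (-1 / 2 : ℝ))).comp_sub_right 1
  norm_num at h2
  refine h2.symm.congr ?_
  intro t _
  show (-(1 / 2 * (t - 1))) ^ (-(1 / 2) : ℝ) = ((1 - t) / 2) ^ (-(1 / 2) : ℝ)
  congr 1
  ring

lemma integral_half_one_sub_rpow :
    ∫ t in (-1 : ℝ)..1, ((1 - t) / 2) ^ (-(1 / 2) : ℝ) = 4 := by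
  have h : ∀ t : ℝ, ((1 - t) / 2) = 1 / 2 - t / 2 := fun t => by ring
  simp_rw [h]
  rw [intervalIntegral.integral_comp_sub_div (fun x => x ^ (-(1 / 2) : ℝ)) two_ne_zero]
  norm_num
  rw [integral_rpow (by norm_num)]
  norm_num

lemma measurable_comptonIntegrand (β m k k' : ℝ) : Measurable (comptonIntegrand β m k k') := by
  unfold comptonIntegrand vecDist
  fun_prop

lemma ae_Ico_of_uIoc : ∀ᵐ t : ℝ, t ∈ uIoc (-1 : ℝ) 1 → t ∈ Ico (-1 : ℝ) 1 := by
  have : ∀ᵐ t : ℝ, t ≠ 1 := by simp [ae_iff]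
  filter_upwards [this] with t ht h
  rw [uIoc_of_le (by norm_num)] at h
  exact ⟨h.1.le, lt_of_le_of_ne h.2 ht⟩

lemma intervalIntegrable_comptonIntegrand {β m k k' : ℝ} (hβ : 0 < β) (hm : 0 < m) (hk : 0 ≤ k)
    (hk' : 0 ≤ k') (hs : 0 < k + k') :
    IntervalIntegrable (comptonIntegrand β m k k') volume (-1) 1 := by
  refine (intervalIntegrable_half_one_sub_rpow.const_mul
    (2 / (k + k') * Real.exp (-β * ((k' - k) ^ 2 / (8 * m))))).mono_fun'
    (measurable_comptonIntegrand β m k k').aestronglyMeasurable ?_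
  rw [Filter.EventuallyLE, ae_restrict_iff' measurableSet_uIoc]
  filter_upwards [ae_Ico_of_uIoc] with t ht h
  rw [Real.norm_of_nonneg (comptonIntegrand_nonneg _ _ _ _ _)]
  exact comptonIntegrand_le hβ hm hk hk' hs (ht h)

/-- The factor `8` is `2`, from `1 + t² ≤ 2`, times the integral `4` of the singular factor. -/
lemma comptonKernel_le {β m k k' : ℝ} (hβ : 0 < β) (hm : 0 < m) (hk : 0 ≤ k) (hk' : 0 ≤ k')
    (hs : 0 < k + k') :
    comptonKernel β m k k' ≤ 8 * Real.sqrt β * Real.exp (β * ((k + k') / 2)) *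
      Real.exp (-β * ((k' - k) ^ 2 / (8 * m))) / (k + k') := by
  have h : ∫ t in (-1 : ℝ)..1, comptonIntegrand β m k k' t ≤
      ∫ t in (-1 : ℝ)..1, 2 / (k + k') * Real.exp (-β * ((k' - k) ^ 2 / (8 * m))) *
        ((1 - t) / 2) ^ (-(1 / 2) : ℝ) := by
    refine intervalIntegral.integral_mono_ae_restrict (by norm_num)
      (intervalIntegrable_comptonIntegrand hβ hm hk hk' hs)
      (intervalIntegrable_half_one_sub_rpow.const_mul _) ?_
    rw [Filter.EventuallyLE, ae_restrict_iff' measurableSet_Icc]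
    have : ∀ᵐ t : ℝ, t ≠ 1 := by simp [ae_iff]
    filter_upwards [this] with t ht h
    exact comptonIntegrand_le hβ hm hk hk' hs ⟨h.1, lt_of_le_of_ne h.2 ht⟩
  rw [intervalIntegral.integral_const_mul, integral_half_one_sub_rpow] at h
  rw [comptonKernel_eq, add_comm k' k]
  refine (mul_le_mul_of_nonneg_left h (by positivity)).trans_eq ?_
  ring

lemma continuousAt_comptonKernel {β m : ℝ} (hβ : 0 < β) (hm : 0 < m) {a b : ℝ} (ha : 0 < a)
    (hb : 0 < b) : ContinuousAt (fun p : ℝ × ℝ => comptonKernel β m p.1 p.2) (a, b) := by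
  simp_rw [comptonKernel_eq]
  refine ContinuousAt.mul (by fun_prop) ?_
  refine intervalIntegral.continuousAt_of_dominated_interval
    (bound := fun t => 2 / ((a + b) / 2) * ((1 - t) / 2) ^ (-(1 / 2) : ℝ))
    (Filter.Eventually.of_forall fun p =>
      (measurable_comptonIntegrand β m p.1 p.2).aestronglyMeasurable) ?_
    (intervalIntegrable_half_one_sub_rpow.const_mul _) ?_
  · have h1 : ∀ᶠ p : ℝ × ℝ in nhds (a, b), 0 < p.1 :=
      continuous_fst.continuousAt.eventually_const_lt ha
    have h2 : ∀ᶠ p : ℝ × ℝ in nhds (a, b), 0 < p.2 :=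
      continuous_snd.continuousAt.eventually_const_lt hb
    have h3 : ∀ᶠ p : ℝ × ℝ in nhds (a, b), (a + b) / 2 < p.1 + p.2 :=
      (continuous_fst.add continuous_snd).continuousAt.eventually_const_lt
        (by show (a + b) / 2 < a + b; linarith)
    filter_upwards [h1, h2, h3] with p hp1 hp2 hp3
    filter_upwards [ae_Ico_of_uIoc] with t ht h
    rw [Real.norm_of_nonneg (comptonIntegrand_nonneg _ _ _ _ _)]
    refine (comptonIntegrand_le hβ hm hp1.le hp2.le (by linarith) (ht h)).trans ?_
    have hx : 0 ≤ (1 - t) / 2 := by linarith [(ht h).2]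
    gcongr
    calc 2 / (p.1 + p.2) * Real.exp (-β * ((p.2 - p.1) ^ 2 / (8 * m)))
        ≤ 2 / (p.1 + p.2) * 1 := by
          gcongr
          rw [Real.exp_le_one_iff, neg_mul]
          exact neg_nonpos.2 (by positivity)
      _ ≤ _ := by
          rw [mul_one]
          gcongr
  · filter_upwards [ae_Ico_of_uIoc] with t ht h
    have hpos := vecDist_pos (add_pos ha hb) (ht h)
    have hc : ContinuousAt (fun p : ℝ × ℝ => vecDist p.1 p.2 t) (a, b) := by
      unfold vecDist
      fun_prop
    unfold comptonIntegrand
    refine ContinuousAt.mul (continuousAt_const.div hc hpos.ne') ?_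
    refine Real.continuous_exp.continuousAt.comp (continuousAt_const.mul ?_)
    refine ContinuousAt.div (by fun_prop) (by fun_prop) ?_
    have : 0 < vecDist a b t / m := by positivity
    show 2 * m * (vecDist a b t / m) ^ 2 ≠ 0
    positivity

/-- The Gaussian factor beats every exponential in `|k - k'|`. -/
lemma comptonKernel_mul_exp_le {β m k k' : ℝ} (hβ : 0 < β) (hm : 0 < m) (hk : 0 ≤ k)
    (hk' : 0 ≤ k') (hs : 0 < k + k') :
    comptonKernel β m k k' * Real.exp (-β * k) ≤
      8 * Real.sqrt β * Real.exp ((β / 2 + 1) ^ 2 * (2 * m / β)) *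
        Real.exp (-|k - k'|) / (k + k') := by
  refine (mul_le_mul_of_nonneg_right (comptonKernel_le hβ hm hk hk' hs)
    (Real.exp_nonneg _)).trans ?_
  have h : Real.exp (β * ((k + k') / 2)) * Real.exp (-β * ((k' - k) ^ 2 / (8 * m))) *
      Real.exp (-β * k) ≤ Real.exp ((β / 2 + 1) ^ 2 * (2 * m / β)) * Real.exp (-|k - k'|) := by
    rw [← Real.exp_add, ← Real.exp_add, ← Real.exp_add, Real.exp_le_exp]
    have h1 : k' - k ≤ |k - k'| := by rw [abs_sub_comm]; exact le_abs_self _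
    have h2 : (k' - k) ^ 2 = |k - k'| ^ 2 := by rw [sq_abs]; ring
    rw [h2]
    set s := |k - k'|
    -- Completing the square: the right side is the maximum over `s`, attained at `s = 4m(β/2 +
    -- 1)/β`. In `β/2 + 1`, the `β/2` pays for the growth of `e^{β(k' - k)/2}` and the `1` buys the
    -- decay `e^{-s}`.
    have h3 : (β / 2 + 1) * s - β * (s ^ 2 / (8 * m)) ≤ (β / 2 + 1) ^ 2 * (2 * m / β) := by
      have h4 : (β / 2 + 1) ^ 2 * (2 * m / β) - ((β / 2 + 1) * s - β * (s ^ 2 / (8 * m))) =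
          (β * s - (β / 2 + 1) * (4 * m)) ^ 2 / (8 * m * β) := by
        field_simp
        ring
      have h5 : 0 ≤ (β * s - (β / 2 + 1) * (4 * m)) ^ 2 / (8 * m * β) := by positivity
      linarith
    nlinarith [mul_le_mul_of_nonneg_left h1 hβ.le]
  calc _ = 8 * Real.sqrt β * (Real.exp (β * ((k + k') / 2)) *
        Real.exp (-β * ((k' - k) ^ 2 / (8 * m))) * Real.exp (-β * k)) / (k + k') := by ring
    _ ≤ 8 * Real.sqrt β * (Real.exp ((β / 2 + 1) ^ 2 * (2 * m / β)) * Real.exp (-|k - k'|)) /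
        (k + k') := by gcongr
    _ = _ := by ring

lemma comptonKernel_pos {β m k k' : ℝ} (hβ : 0 < β) (hm : 0 < m) (hk : 0 < k) (hk' : 0 < k') :
    0 < comptonKernel β m k k' := by
  rw [comptonKernel_eq]
  refine mul_pos (by positivity) (intervalIntegral.intervalIntegral_pos_of_pos_on
    (intervalIntegrable_comptonIntegrand hβ hm hk.le hk'.le (by linarith)) ?_ (by norm_num))
  intro t ht
  have := vecDist_pos (add_pos hk hk') (Ioo_subset_Ico_self ht)
  unfold comptonIntegrand
  positivity

lemma mem_kernelBounds_of_le {β m : ℝ} (hβ : 0 < β) (hm : 0 < m) {C : ℝ}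
    (hC : 8 * Real.sqrt β ≤ C) : C ∈ kernelBounds β m := by
  intro k k' hk hk'
  refine (comptonKernel_le hβ hm hk.le hk'.le (by linarith)).trans ?_
  refine div_le_div_of_nonneg_right ?_ (by linarith)
  have h : Real.exp (-β * ((k' - k) ^ 2 / (8 * m))) ≤ 1 := by
    rw [Real.exp_le_one_iff, neg_mul]
    exact neg_nonpos.2 (by positivity)
  refine (mul_le_of_le_one_right (by positivity) h).trans ?_
  gcongr

lemma pos_of_mem_kernelBounds {β m : ℝ} (hβ : 0 < β) (hm : 0 < m) {C : ℝ}
    (hC : C ∈ kernelBounds β m) : 0 < C := by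
  have h1 := (comptonKernel_pos hβ hm one_pos one_pos).trans_le (hC 1 1 one_pos one_pos)
  by_contra! h
  have h2 : C * Real.exp (β * ((1 + 1) / 2)) / (1 + 1) ≤ 0 :=
    div_nonpos_of_nonpos_of_nonneg
      (mul_nonpos_of_nonpos_of_nonneg h (Real.exp_nonneg _)) (by norm_num)
  linarith

/-- Each pair `(k, k')` imposes a closed lower bound on `C`, so the infimum is itself admissible. -/
lemma exists_isLeast_kernelBounds {β m : ℝ} (hβ : 0 < β) (hm : 0 < m) :
    ∃ C, IsLeast (kernelBounds β m) C := by
  have hne : (kernelBounds β m).Nonempty := ⟨_, mem_kernelBounds_of_le hβ hm le_rfl⟩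
  have hbd : BddBelow (kernelBounds β m) := ⟨0, fun C hC => (pos_of_mem_kernelBounds hβ hm hC).le⟩
  refine ⟨sInf (kernelBounds β m), ?_, fun C hC => csInf_le hbd hC⟩
  intro k k' hk hk'
  have hd : 0 < Real.exp (β * ((k + k') / 2)) / (k + k') := by positivity
  rw [mul_div_assoc, ← div_le_iff₀ hd]
  refine le_csInf hne fun C hC => ?_
  rw [div_le_iff₀ hd, ← mul_div_assoc]
  exact hC k k' hk hk'

/-- The constant for which the exponential moments are controlled: for `β = 1` the decay
`e^{-(k - k') / 2}` comes from the prefactors, otherwise from the Gaussian factor. -/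
lemma exists_kernel_constant {β m : ℝ} (hβ : 0 < β) (hm : 0 < m) :
    ∃ C : ℝ, 0 < C ∧ C ∈ kernelBounds β m ∧ (β = 1 → IsLeast (kernelBounds β m) C) ∧
      ∀ k k' : ℝ, 0 < k' → k' ≤ k →
        comptonKernel β m k k' * Real.exp (-β * k) ≤
          C * Real.exp (-((k - k') / 2)) / (k + k') := by
  by_cases h : β = 1
  · obtain ⟨C, hC⟩ := exists_isLeast_kernelBounds hβ hm
    refine ⟨C, pos_of_mem_kernelBounds hβ hm hC.1, hC.1, fun _ => hC, fun k k' hk' hkk => ?_⟩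
    refine (mul_le_mul_of_nonneg_right (hC.1 k k' (by linarith) hk') (Real.exp_nonneg _)).trans_eq ?_
    subst h
    rw [div_mul_eq_mul_div, mul_assoc, ← Real.exp_add]
    ring_nf
  · have h1 : 1 ≤ Real.exp ((β / 2 + 1) ^ 2 * (2 * m / β)) := Real.one_le_exp (by positivity)
    have h2 : 8 * Real.sqrt β ≤ 8 * Real.sqrt β * Real.exp ((β / 2 + 1) ^ 2 * (2 * m / β)) :=
      le_mul_of_one_le_right (by positivity) h1
    have h3 := mem_kernelBounds_of_le hβ hm h2
    refine ⟨_, pos_of_mem_kernelBounds hβ hm h3, h3, fun h' => absurd h' h, fun k k' hk' hkk => ?_⟩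
    refine (comptonKernel_mul_exp_le hβ hm (by linarith) hk'.le (by linarith)).trans ?_
    have : 0 < k + k' := by linarith
    gcongr
    rw [abs_of_nonneg (by linarith)]
    linarith

/-! ### Geometry of the cut-off region -/

lemma sq_sub_le_of_mem_cutoffRegion {θ δ : ℝ} (h0 : 0 < θ) (hδ : 0 < δ)
    {p : ℝ≥0 × ℝ≥0} (hp : p ∈ cutoffRegion θ δ (rhoStar θ δ)) (h : (p.1 : ℝ) ≤ δ ∧ (p.2 : ℝ) ≤ δ) :
    ((p.1 : ℝ) - p.2) ^ 2 ≤
      (1 - θ) ^ 2 / (θ * (1 + θ) * δ) * ((p.1 : ℝ) * p.2 * ((p.1 : ℝ) + p.2)) := by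
  rcases hp with hp | hp
  · have h2 := pow_le_pow_left₀ (abs_nonneg _) hp.2.2 2
    rwa [sq_abs, mul_pow, rhoStar, div_pow, Real.sq_sqrt (by positivity),
      Real.sq_sqrt (by positivity)] at h2
  · exact absurd h hp.1

/-- If `k' < θk`, the left side is at least `(1 - θ)² k²` and the right side is below `(1 - θ)² k²
(k / δ)`, which is no larger since `k ≤ δ`. The matching value `rhoStar` is what keeps the curve
inside the cone. -/
lemma mul_le_of_sq_sub_le {θ δ k k' : ℝ} (h0 : 0 < θ) (h1 : θ < 1) (hk : 0 ≤ k) (hk' : 0 ≤ k')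
    (hkδ : k ≤ δ) (hδ : 0 < δ)
    (h : (k - k') ^ 2 ≤ (1 - θ) ^ 2 / (θ * (1 + θ) * δ) * (k * k' * (k + k'))) : θ * k ≤ k' := by
  by_contra! hlt
  have hkpos : 0 < k := by
    rcases hk.eq_or_lt with h | h
    · subst h; linarith
    · exact h
  have e1 : (1 - θ) ^ 2 * k ^ 2 ≤ (k - k') ^ 2 := by
    rw [← mul_pow]
    refine pow_le_pow_left₀ (mul_nonneg (by linarith) hk) (by linarith) 2
  have e2 : k * k' * (k + k') < θ * (1 + θ) * k ^ 3 := by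
    have : k' * (k + k') < (θ * k) * (k + θ * k) := by nlinarith
    nlinarith
  have e3 : (1 - θ) ^ 2 / (θ * (1 + θ) * δ) * (k * k' * (k + k')) <
      (1 - θ) ^ 2 / (θ * (1 + θ) * δ) * (θ * (1 + θ) * k ^ 3) := by
    refine mul_lt_mul_of_pos_left e2 ?_
    have : 0 < 1 - θ := by linarith
    positivity
  have e4 : (1 - θ) ^ 2 / (θ * (1 + θ) * δ) * (θ * (1 + θ) * k ^ 3) =
      (1 - θ) ^ 2 * k ^ 2 * (k / δ) := by
    field_simp
  have e5 : (1 - θ) ^ 2 * k ^ 2 * (k / δ) ≤ (1 - θ) ^ 2 * k ^ 2 :=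
    mul_le_of_le_one_right (by positivity) ((div_le_one hδ).2 hkδ)
  linarith

lemma mul_le_of_mem_cutoffRegion {θ δ : ℝ} (h0 : 0 < θ) (h1 : θ < 1) (hδ : 0 < δ)
    {p : ℝ≥0 × ℝ≥0} (hp : p ∈ cutoffRegion θ δ (rhoStar θ δ)) :
    θ * p.1 ≤ p.2 ∧ θ * p.2 ≤ p.1 := by
  by_cases h : (p.1 : ℝ) ≤ δ ∧ (p.2 : ℝ) ≤ δ
  · have h2 := sq_sub_le_of_mem_cutoffRegion h0 hδ hp h
    refine ⟨mul_le_of_sq_sub_le h0 h1 p.1.2 p.2.2 h.1 hδ h2, mul_le_of_sq_sub_le h0 h1 p.2.2 p.1.2 h.2 hδ ?_⟩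
    calc _ = ((p.1 : ℝ) - p.2) ^ 2 := by ring
      _ ≤ _ := h2
      _ = _ := by ring
  · rcases hp with hp | hp
    · exact absurd ⟨hp.1, hp.2.1⟩ h
    · refine ⟨hp.2.1, ?_⟩
      rw [← div_eq_inv_mul, le_div_iff₀ h0] at hp
      linarith [hp.2.2]

/-- This inequality compensates the singularity of the kernel at the origin. Outside the square the
larger momentum `b` is at least `δ`, and the cone condition gives `(a - b)² θδ ≤ b² θb ≤ b² a ≤ ab(a
+ b)`. -/
lemma sq_sub_le_mul_of_mem_cutoffRegion {θ δ : ℝ} (h0 : 0 < θ) (h1 : θ < 1) (hδ : 0 < δ)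
    {p : ℝ≥0 × ℝ≥0} (hp : p ∈ cutoffRegion θ δ (rhoStar θ δ)) :
    ((p.1 : ℝ) - p.2) ^ 2 ≤ (1 / (θ * δ)) * ((p.1 : ℝ) * p.2 * ((p.1 : ℝ) + p.2)) := by
  have hc := mul_le_of_mem_cutoffRegion h0 h1 hδ hp
  have hk : (0 : ℝ) ≤ p.1 := p.1.2
  have hk' : (0 : ℝ) ≤ p.2 := p.2.2
  by_cases h : (p.1 : ℝ) ≤ δ ∧ (p.2 : ℝ) ≤ δ
  · refine (sq_sub_le_of_mem_cutoffRegion h0 hδ hp h).trans ?_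
    refine mul_le_mul_of_nonneg_right ?_ (by positivity)
    refine div_le_div₀ zero_le_one ?_ (by positivity) ?_
    · exact pow_le_one₀ (by linarith) (by linarith)
    · nlinarith [mul_pos h0 hδ]
  · clear hp
    generalize ((p.1 : ℝ≥0) : ℝ) = k at *
    generalize ((p.2 : ℝ≥0) : ℝ) = k' at *
    rw [one_div_mul_eq_div, le_div_iff₀ (by positivity)]
    have key : ∀ a b : ℝ, 0 ≤ a → 0 ≤ b → a ≤ b → θ * b ≤ a → δ ≤ b →
        (a - b) ^ 2 * (θ * δ) ≤ a * b * (a + b) := by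
      intro a b ha hb hab hba hd
      calc (a - b) ^ 2 * (θ * δ) ≤ b ^ 2 * (θ * b) := by
            refine mul_le_mul ?_ (by gcongr) (by positivity) (by positivity)
            nlinarith
        _ ≤ b ^ 2 * a := by gcongr
        _ ≤ a * b * (a + b) := by nlinarith [mul_nonneg (mul_nonneg ha hb) ha]
    rcases le_total k k' with hkk | hkk
    · refine key k k' hk hk' hkk hc.2 ?_
      by_contra! hlt
      exact h ⟨by linarith, hlt.le⟩
    · have := key k' k hk' hk hkk hc.1 (by
        by_contra! hlt
        exact h ⟨hlt.le, by linarith⟩)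
      linarith

namespace IsCutoff

variable {θ δ : ℝ} {Φ : ℝ≥0 × ℝ≥0 → ℝ}

lemma mem_region (hΦ : IsCutoff θ δ Φ) {p : ℝ≥0 × ℝ≥0} (hp : Φ p ≠ 0) :
    p ∈ cutoffRegion θ δ (rhoStar θ δ) := by
  rw [← hΦ.support_eq]
  exact subset_tsupport _ hp

lemma measurable (hΦ : IsCutoff θ δ Φ) : Measurable Φ :=
  measurable_of_continuousOn_compl_singleton (0, 0) hΦ.continuousOn

end IsCutoff

/-! ### The truncated kernel and the two jump rates -/

lemma truncKernel_eq_zero {β m : ℝ} {Φ : ℝ≥0 × ℝ≥0 → ℝ} {p : ℝ≥0 × ℝ≥0}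
    (h : p.1 = 0 ∨ p.2 = 0 ∨ Φ p = 0) : truncKernel β m Φ p = 0 := by
  rcases h with h | h | h <;> simp [truncKernel, h]

lemma truncKernel_nonneg {β m θ δ : ℝ} {Φ : ℝ≥0 × ℝ≥0 → ℝ} (hΦ : IsCutoff θ δ Φ)
    (p : ℝ≥0 × ℝ≥0) : 0 ≤ truncKernel β m Φ p :=
  div_nonneg (mul_nonneg (hΦ.nonneg p) (comptonKernel_nonneg _ _ _ _)) (by positivity)

lemma truncKernel_swap {β m θ δ : ℝ} {Φ : ℝ≥0 × ℝ≥0 → ℝ} (hΦ : IsCutoff θ δ Φ) (k k' : ℝ≥0) :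
    truncKernel β m Φ (k, k') = truncKernel β m Φ (k', k) := by
  simp only [truncKernel]
  rw [hΦ.symm k k', comptonKernel_comm, mul_comm (k : ℝ)]

/-- A point of an axis other than the origin has a neighbourhood outside the cone, where `Φ`
vanishes; so division by zero does no harm there. -/
lemma continuousOn_truncKernel {β m θ δ : ℝ} {Φ : ℝ≥0 × ℝ≥0 → ℝ} (hβ : 0 < β) (hm : 0 < m)
    (h0 : 0 < θ) (h1 : θ < 1) (hδ : 0 < δ) (hΦ : IsCutoff θ δ Φ) :
    ContinuousOn (truncKernel β m Φ) {(0, 0)}ᶜ := by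
  rintro ⟨k, k'⟩ hp
  have hp' : (k, k') ≠ (0, 0) := hp
  by_cases h : 0 < k ∧ 0 < k'
  · refine ContinuousAt.continuousWithinAt ?_
    have hΦc : ContinuousAt Φ (k, k') :=
      hΦ.continuousOn.continuousAt (isOpen_compl_singleton.mem_nhds hp)
    have hB : ContinuousAt (fun p : ℝ≥0 × ℝ≥0 => comptonKernel β m p.1 p.2) (k, k') := by
      refine ContinuousAt.comp (f := fun p : ℝ≥0 × ℝ≥0 => ((p.1 : ℝ), (p.2 : ℝ)))
        (g := fun p : ℝ × ℝ => comptonKernel β m p.1 p.2) (continuousAt_comptonKernel hβ hm ?_ ?_)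
        (by fun_prop)
      · exact_mod_cast h.1
      · exact_mod_cast h.2
    refine (hΦc.mul hB).div (by fun_prop) ?_
    have e1 : (0 : ℝ) < k := by exact_mod_cast h.1
    have e2 : (0 : ℝ) < k' := by exact_mod_cast h.2
    exact (mul_pos e1 e2).ne'
  · have hopen : IsOpen ({p : ℝ≥0 × ℝ≥0 | (p.2 : ℝ) < θ * p.1} ∪
        {p : ℝ≥0 × ℝ≥0 | (p.1 : ℝ) < θ * p.2}) :=
      (isOpen_lt (by fun_prop) (by fun_prop)).union (isOpen_lt (by fun_prop) (by fun_prop))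
    have hmem : (k, k') ∈ {p : ℝ≥0 × ℝ≥0 | (p.2 : ℝ) < θ * p.1} ∪
        {p : ℝ≥0 × ℝ≥0 | (p.1 : ℝ) < θ * p.2} := by
      rcases eq_or_ne k 0 with hk | hk
      · right
        have : 0 < k' := by
          rw [pos_iff_ne_zero]
          rintro rfl
          exact hp' (by rw [hk])
        have e2 : (0 : ℝ) < k' := by exact_mod_cast this
        show (k : ℝ) < θ * k'
        rw [hk, NNReal.coe_zero]
        positivity
      · left
        have hk0 := pos_iff_ne_zero.2 hk
        have : k' = 0 := by
          by_contra hne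
          exact h ⟨hk0, pos_iff_ne_zero.2 hne⟩
        have e2 : (0 : ℝ) < k := by exact_mod_cast hk0
        show (k' : ℝ) < θ * k
        rw [this, NNReal.coe_zero]
        positivity
    refine ContinuousAt.continuousWithinAt ?_
    refine (continuousAt_const (y := (0 : ℝ))).congr ?_
    filter_upwards [hopen.mem_nhds hmem] with p hpm
    refine (truncKernel_eq_zero (Or.inr (Or.inr ?_))).symm
    by_contra hne
    have := mul_le_of_mem_cutoffRegion h0 h1 hδ (hΦ.mem_region hne)
    rcases hpm with h | h
    · exact absurd this.1 (not_le.2 h)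
    · exact absurd this.2 (not_le.2 h)

lemma measurable_truncKernel {β m θ δ : ℝ} {Φ : ℝ≥0 × ℝ≥0 → ℝ} (hβ : 0 < β) (hm : 0 < m)
    (h0 : 0 < θ) (h1 : θ < 1) (hδ : 0 < δ) (hΦ : IsCutoff θ δ Φ) :
    Measurable (truncKernel β m Φ) :=
  measurable_of_continuousOn_compl_singleton (0, 0)
    (continuousOn_truncKernel hβ hm h0 h1 hδ hΦ)

/-- A constant `K` with `𝓑_β(k, k') e^{-βk} ≤ K / (k + k')`. -/
noncomputable def kernelConst (β m : ℝ) : ℝ :=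
  8 * Real.sqrt β * Real.exp ((β / 2 + 1) ^ 2 * (2 * m / β))

lemma kernelConst_pos {β : ℝ} (hβ : 0 < β) (m : ℝ) : 0 < kernelConst β m := by
  unfold kernelConst
  positivity

lemma comptonKernel_mul_exp_le_div {β m k k' : ℝ} (hβ : 0 < β) (hm : 0 < m) (hk : 0 ≤ k)
    (hk' : 0 ≤ k') (hs : 0 < k + k') :
    comptonKernel β m k k' * Real.exp (-β * k) ≤ kernelConst β m / (k + k') := by
  refine (comptonKernel_mul_exp_le hβ hm hk hk' hs).trans ?_
  refine div_le_div_of_nonneg_right ?_ hs.le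
  exact mul_le_of_le_one_right (kernelConst_pos hβ m).le
    (Real.exp_le_one_iff.2 (neg_nonpos.2 (abs_nonneg _)))

/-- The rate at which mass is transferred from `k'` to `k`, with respect to `dk`, by the part of
the equation that is linear in `v`. -/
noncomputable def gainRate (β m : ℝ) (Φ : ℝ≥0 × ℝ≥0 → ℝ) (p : ℝ≥0 × ℝ≥0) : ℝ :=
  truncKernel β m Φ p * ((p.1 : ℝ) ^ 2 * Real.exp (-β * p.1))

/-- The antisymmetric rate of the part of the equation that is quadratic in `v`. -/
noncomputable def exchangeRate (β m : ℝ) (Φ : ℝ≥0 × ℝ≥0 → ℝ) (p : ℝ≥0 × ℝ≥0) : ℝ :=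
  truncKernel β m Φ p * (Real.exp (-β * p.1) - Real.exp (-β * p.2))

section Rates

variable {β m θ δ : ℝ} {Φ : ℝ≥0 × ℝ≥0 → ℝ}

lemma gainRate_nonneg (hΦ : IsCutoff θ δ Φ) (p : ℝ≥0 × ℝ≥0) : 0 ≤ gainRate β m Φ p :=
  mul_nonneg (truncKernel_nonneg hΦ p) (by positivity)

/-- The weight `k²` cancels `1 / k` and leaves the ratio `k / k'`. On the axes both sides are `0`,
by the convention for division by zero. -/
lemma gainRate_eq (k k' : ℝ≥0) : gainRate β m Φ (k, k') =
    Φ (k, k') * (comptonKernel β m k k' * Real.exp (-β * k)) * k / k' := by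
  rcases eq_or_ne k 0 with h | h
  · simp [gainRate, h]
  rcases eq_or_ne k' 0 with h' | h'
  · simp [gainRate, truncKernel, h']
  · have : (k : ℝ) ≠ 0 := by exact_mod_cast h
    have : (k' : ℝ) ≠ 0 := by exact_mod_cast h'
    simp only [gainRate, truncKernel]
    field_simp

lemma cone_of_truncKernel_ne_zero (h0 : 0 < θ) (h1 : θ < 1) (hδ : 0 < δ) (hΦ : IsCutoff θ δ Φ)
    {p : ℝ≥0 × ℝ≥0} (hp : truncKernel β m Φ p ≠ 0) :
    0 < (p.1 : ℝ) ∧ 0 < (p.2 : ℝ) ∧ θ * p.1 ≤ p.2 ∧ θ * p.2 ≤ p.1 ∧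
      ((p.1 : ℝ) - p.2) ^ 2 ≤ (1 / (θ * δ)) * ((p.1 : ℝ) * p.2 * ((p.1 : ℝ) + p.2)) := by
  have hp1 : p.1 ≠ 0 := fun h => hp (truncKernel_eq_zero (Or.inl h))
  have hp2 : p.2 ≠ 0 := fun h => hp (truncKernel_eq_zero (Or.inr (Or.inl h)))
  have hp3 : Φ p ≠ 0 := fun h => hp (truncKernel_eq_zero (Or.inr (Or.inr h)))
  have hc := mul_le_of_mem_cutoffRegion h0 h1 hδ (hΦ.mem_region hp3)
  exact ⟨by exact_mod_cast pos_iff_ne_zero.2 hp1, by exact_mod_cast pos_iff_ne_zero.2 hp2,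
    hc.1, hc.2, sq_sub_le_mul_of_mem_cutoffRegion h0 h1 hδ (hΦ.mem_region hp3)⟩

/-- The factor `k / (k + k') ≤ 1` absorbs the numerator `k`; the cone supplies the indicator. -/
lemma gainRate_le (hβ : 0 < β) (hm : 0 < m) (h0 : 0 < θ) (h1 : θ < 1) (hδ : 0 < δ)
    (hΦ : IsCutoff θ δ Φ) (k k' : ℝ≥0) :
    gainRate β m Φ (k, k') ≤
      {x : ℝ≥0 | θ * x ≤ k'}.indicator (fun _ => kernelConst β m / k') k := by
  have hK := kernelConst_pos hβ m
  by_cases hT : truncKernel β m Φ (k, k') = 0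
  · rw [gainRate, hT, zero_mul]
    exact indicator_nonneg (fun _ _ => by positivity) _
  · obtain ⟨hk, hk', hc, -, -⟩ := cone_of_truncKernel_ne_zero h0 h1 hδ hΦ hT
    simp only at hk hk' hc
    rw [indicator_of_mem (by exact hc), gainRate_eq]
    refine div_le_div_of_nonneg_right ?_ hk'.le
    have e1 := comptonKernel_mul_exp_le_div hβ hm hk.le hk'.le (by linarith)
    have e2 : 0 ≤ comptonKernel β m k k' * Real.exp (-β * k) :=
      mul_nonneg (comptonKernel_nonneg _ _ _ _) (Real.exp_nonneg _)
    calc _ ≤ 1 * (kernelConst β m / (k + k')) * k := by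
          gcongr
          exact hΦ.le_one _
      _ = kernelConst β m * (k / (k + k')) := by ring
      _ ≤ _ := mul_le_of_le_one_right hK.le (by rw [div_le_one (by linarith)]; linarith)

lemma exchangeRate_swap (hΦ : IsCutoff θ δ Φ) (k k' : ℝ≥0) :
    exchangeRate β m Φ (k', k) = -exchangeRate β m Φ (k, k') := by
  simp only [exchangeRate]
  rw [truncKernel_swap hΦ k' k]
  ring

lemma abs_exp_sub_exp_le_of_le (hβ : 0 < β) {a b : ℝ} (hab : a ≤ b) :
    |Real.exp (-β * a) - Real.exp (-β * b)| ≤ Real.exp (-β * a) * (β * |a - b|) := by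
  have h2 : Real.exp (-β * b) = Real.exp (-β * a) * Real.exp (-(β * (b - a))) := by
    rw [← Real.exp_add]; ring_nf
  have h3 : Real.exp (-β * b) ≤ Real.exp (-β * a) := Real.exp_le_exp.2 (by nlinarith)
  rw [abs_of_nonneg (by linarith), abs_of_nonpos (by linarith), h2]
  have := Real.add_one_le_exp (-(β * (b - a)))
  nlinarith [Real.exp_pos (-β * a)]

/-- The exponential of the smaller momentum is factored out. The kernel times this factor is
controlled by the Gaussian, since `e^{β(k + k')/2} e^{-βk}` alone grows with `k' - k`. -/
lemma comptonKernel_mul_abs_exp_sub_le (hβ : 0 < β) (hm : 0 < m) {k k' : ℝ} (hk : 0 ≤ k)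
    (hk' : 0 ≤ k') (hs : 0 < k + k') :
    comptonKernel β m k k' * |Real.exp (-β * k) - Real.exp (-β * k')| ≤
      kernelConst β m * β * |k - k'| / (k + k') := by
  have key : ∀ a b : ℝ, 0 ≤ a → 0 ≤ b → 0 < a + b → a ≤ b →
      comptonKernel β m a b * |Real.exp (-β * a) - Real.exp (-β * b)| ≤
        kernelConst β m * β * |a - b| / (a + b) := by
    intro a b ha hb hs hab
    calc _ ≤ comptonKernel β m a b * (Real.exp (-β * a) * (β * |a - b|)) :=
          mul_le_mul_of_nonneg_left (abs_exp_sub_exp_le_of_le hβ hab) (comptonKernel_nonneg _ _ _ _)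
      _ = comptonKernel β m a b * Real.exp (-β * a) * (β * |a - b|) := by ring
      _ ≤ kernelConst β m / (a + b) * (β * |a - b|) := by
          gcongr
          exact comptonKernel_mul_exp_le_div hβ hm ha hb hs
      _ = _ := by ring
  rcases le_total k k' with h | h
  · exact key k k' hk hk' hs h
  · have := key k' k hk' hk (by linarith) h
    rwa [comptonKernel_comm, abs_sub_comm (Real.exp _), abs_sub_comm k', add_comm k'] at this

/-- The numerator keeps one of the two powers of `|k - k'|` needed to cancel the denominator; a
Lipschitz test function supplies the other. -/
lemma abs_exchangeRate_le (hβ : 0 < β) (hm : 0 < m) (h0 : 0 < θ) (h1 : θ < 1) (hδ : 0 < δ)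
    (hΦ : IsCutoff θ δ Φ) (p : ℝ≥0 × ℝ≥0) :
    |exchangeRate β m Φ p| ≤ kernelConst β m * β * |(p.1 : ℝ) - p.2| /
      ((p.1 : ℝ) * p.2 * ((p.1 : ℝ) + p.2)) := by
  have hK := kernelConst_pos hβ m
  by_cases hT : truncKernel β m Φ p = 0
  · rw [exchangeRate, hT, zero_mul, abs_zero]
    positivity
  · obtain ⟨hk, hk', -⟩ := cone_of_truncKernel_ne_zero h0 h1 hδ hΦ hT
    rw [exchangeRate, abs_mul, abs_of_nonneg (truncKernel_nonneg hΦ p), truncKernel]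
    have e := comptonKernel_mul_abs_exp_sub_le hβ hm hk.le hk'.le (by linarith)
    calc _ = Φ p * (comptonKernel β m p.1 p.2 *
          |Real.exp (-β * p.1) - Real.exp (-β * p.2)|) / (p.1 * p.2) := by ring
      _ ≤ 1 * (kernelConst β m * β * |(p.1 : ℝ) - p.2| / (p.1 + p.2)) / (p.1 * p.2) := by
          gcongr
          · exact mul_nonneg (comptonKernel_nonneg _ _ _ _) (abs_nonneg _)
          · exact hΦ.le_one _
      _ = _ := by field_simp

end Rates

/-! ### Lebesgue measure on the half-line and test functions -/

instance : SFinite lebesgueHalfLine := by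
  unfold lebesgueHalfLine
  infer_instance

lemma lebesgueHalfLine_Ioc (a b : ℝ≥0) :
    lebesgueHalfLine (Ioc a b) = ENNReal.ofReal ((b : ℝ) - a) := by
  rw [lebesgueHalfLine, Measure.map_apply (by fun_prop) measurableSet_Ioc,
    Measure.restrict_apply (by exact measurable_real_toNNReal measurableSet_Ioc), ← Real.volume_Ioc]
  congr 1
  ext x
  simp only [mem_inter_iff, mem_preimage, mem_Ioc, mem_Ici]
  constructor
  · rintro ⟨⟨h1, h2⟩, h3⟩
    rw [← NNReal.coe_lt_coe, Real.coe_toNNReal x h3] at h1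
    rw [← NNReal.coe_le_coe, Real.coe_toNNReal x h3] at h2
    exact ⟨h1, h2⟩
  · rintro ⟨h1, h2⟩
    have h3 : 0 ≤ x := a.2.trans h1.le
    rw [← NNReal.coe_lt_coe, ← NNReal.coe_le_coe, Real.coe_toNNReal x h3]
    exact ⟨⟨h1, h2⟩, h3⟩

lemma lebesgueHalfLine_singleton_zero : lebesgueHalfLine {0} = 0 := by
  rw [lebesgueHalfLine, Measure.map_apply (by fun_prop) (measurableSet_singleton _),
    Measure.restrict_apply (by exact measurable_real_toNNReal (measurableSet_singleton _))]
  refine measure_mono_null (t := {0}) ?_ (by simp)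
  rintro x ⟨h1, h2⟩
  have h1' : x.toNNReal = 0 := h1
  exact le_antisymm (Real.toNNReal_eq_zero.1 h1') h2

lemma lebesgueHalfLine_cone {θ : ℝ} (h0 : 0 < θ) (k' : ℝ≥0) :
    lebesgueHalfLine {x : ℝ≥0 | θ * x ≤ k'} ≤ ENNReal.ofReal (k' / θ) := by
  have hsub : {x : ℝ≥0 | θ * x ≤ k'} ⊆ {0} ∪ Ioc 0 (k' / θ.toNNReal) := by
    intro x hx
    rcases eq_or_ne x 0 with h | h
    · left; exact h
    · right
      refine ⟨pos_iff_ne_zero.2 h, ?_⟩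
      rw [← NNReal.coe_le_coe, NNReal.coe_div, Real.coe_toNNReal θ h0.le, le_div_iff₀ h0, mul_comm]
      exact hx
  refine (measure_mono hsub).trans ((measure_union_le _ _).trans ?_)
  rw [lebesgueHalfLine_singleton_zero, lebesgueHalfLine_Ioc, zero_add, NNReal.coe_div,
    Real.coe_toNNReal θ h0.le, NNReal.coe_zero, sub_zero]

namespace IsTestFunction

variable {φ : ℝ → ℝ}

lemma continuous_coe (hφ : IsTestFunction φ) : Continuous (fun k : ℝ≥0 => φ k) :=
  hφ.contDiffOn.continuousOn.comp_continuous NNReal.continuous_coe fun k => k.2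

lemma exists_bound (hφ : IsTestFunction φ) : ∃ M, 0 ≤ M ∧ ∀ k : ℝ≥0, |φ k| ≤ M := by
  obtain ⟨M, hM⟩ := hφ.bounded
  exact ⟨M, (abs_nonneg _).trans (hM 0 self_mem_Ici), fun k => hM k k.2⟩

lemma hasDerivWithinAt (hφ : IsTestFunction φ) {x : ℝ} (hx : 0 ≤ x) :
    HasDerivWithinAt φ (derivWithin φ (Ici 0) x) (Ici 0) x :=
  (hφ.contDiffOn.differentiableOn (by norm_num) x hx).hasDerivWithinAt

lemma exists_lipschitz (hφ : IsTestFunction φ) :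
    ∃ L, 0 ≤ L ∧ ∀ k k' : ℝ≥0, |φ k - φ k'| ≤ L * |(k : ℝ) - k'| := by
  obtain ⟨L, hL⟩ := hφ.deriv_bounded
  refine ⟨L, (abs_nonneg _).trans (hL 0 self_mem_Ici), fun k k' => ?_⟩
  exact (convex_Ici 0).norm_image_sub_le_of_norm_hasDerivWithin_le
    (fun x hx => hφ.hasDerivWithinAt hx) hL k'.2 k.2

/-- The derivative is continuous and vanishes at `0`, so the Lipschitz constant on `[0, r]` tends to
`0` with `r`. -/
lemma exists_small_slope (hφ : IsTestFunction φ) {ε : ℝ} (hε : 0 < ε) :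
    ∃ r : ℝ, 0 < r ∧ ∀ k k' : ℝ≥0, (k : ℝ) ≤ r → (k' : ℝ) ≤ r →
      |φ k - φ k'| ≤ ε * |(k : ℝ) - k'| := by
  have hc := hφ.contDiffOn.continuousOn_derivWithin (uniqueDiffOn_Ici 0) (by norm_num) 0
    self_mem_Ici
  have h0 : ∀ᶠ x in nhdsWithin (0 : ℝ) (Ici 0), |derivWithin φ (Ici 0) x| < ε := by
    have := hc.tendsto.abs
    rw [hφ.deriv_zero, abs_zero] at this
    exact this.eventually_lt_const hε
  obtain ⟨r, hr, hsub⟩ := mem_nhdsGE_iff_exists_Icc_subset.1 h0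
  refine ⟨r, hr, fun k k' hk hk' => ?_⟩
  exact (convex_Icc 0 r).norm_image_sub_le_of_norm_hasDerivWithin_le
    (fun x hx => (hφ.hasDerivWithinAt hx.1).mono Icc_subset_Ici_self)
    (fun x hx => (hsub hx).le) ⟨k'.2, hk'⟩ ⟨k.2, hk⟩

end IsTestFunction

/-! ### Boundedness and continuity of the weak collision operator -/

lemma quadraticIntegrand_eq (β m : ℝ) (Φ : ℝ≥0 × ℝ≥0 → ℝ) (φ : ℝ → ℝ) (p : ℝ≥0 × ℝ≥0) :
    quadraticIntegrand β m Φ φ p = exchangeRate β m Φ p * (φ p.1 - φ p.2) := rfl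

lemma gainIntegrand_eq (β m : ℝ) (Φ : ℝ≥0 × ℝ≥0 → ℝ) (φ : ℝ → ℝ) (p : ℝ≥0 × ℝ≥0) :
    gainIntegrand β m Φ φ p = gainRate β m Φ p * (φ p.1 - φ p.2) := rfl

/-- The kernel is symmetric and `φ(k) - φ(k')` is odd under exchange, so the loss term repeats the
gain term. -/
lemma lossIntegrand_swap {β m θ δ : ℝ} {Φ : ℝ≥0 × ℝ≥0 → ℝ} (hΦ : IsCutoff θ δ Φ) (φ : ℝ → ℝ)
    (p : ℝ≥0 × ℝ≥0) : lossIntegrand β m Φ φ p.swap = -gainIntegrand β m Φ φ p := by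
  obtain ⟨k, k'⟩ := p
  simp only [lossIntegrand, gainIntegrand, Prod.swap_prod_mk]
  rw [truncKernel_swap hΦ k' k]
  ring

section

variable {β m θ δ : ℝ} {Φ : ℝ≥0 × ℝ≥0 → ℝ} {φ : ℝ → ℝ}

lemma measurable_gainRate (hβ : 0 < β) (hm : 0 < m) (h0 : 0 < θ) (h1 : θ < 1) (hδ : 0 < δ)
    (hΦ : IsCutoff θ δ Φ) : Measurable (gainRate β m Φ) := by
  have := measurable_truncKernel hβ hm h0 h1 hδ hΦ
  unfold gainRate
  fun_prop

lemma measurable_exchangeRate (hβ : 0 < β) (hm : 0 < m) (h0 : 0 < θ) (h1 : θ < 1) (hδ : 0 < δ)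
    (hΦ : IsCutoff θ δ Φ) : Measurable (exchangeRate β m Φ) := by
  have := measurable_truncKernel hβ hm h0 h1 hδ hΦ
  unfold exchangeRate
  fun_prop

/-- Height `K / k'` times length `k' / θ` of the section of the cone: the rate of leaving `k'` is
bounded uniformly in `k'`. -/
lemma lintegral_gainRate_le (hβ : 0 < β) (hm : 0 < m) (h0 : 0 < θ) (h1 : θ < 1) (hδ : 0 < δ)
    (hΦ : IsCutoff θ δ Φ) (k' : ℝ≥0) :
    ∫⁻ k, ENNReal.ofReal (gainRate β m Φ (k, k')) ∂lebesgueHalfLine ≤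
      ENNReal.ofReal (kernelConst β m / θ) := by
  have hK := kernelConst_pos hβ m
  rcases eq_or_ne k' 0 with h | h
  · have : ∀ k : ℝ≥0, gainRate β m Φ (k, k') = 0 := fun k => by
      rw [gainRate, truncKernel_eq_zero (Or.inr (Or.inl h)), zero_mul]
    simp [this]
  have hk' : (0 : ℝ) < k' := by exact_mod_cast pos_iff_ne_zero.2 h
  have hmeas : MeasurableSet {x : ℝ≥0 | θ * x ≤ k'} :=
    measurableSet_le (by fun_prop) (by fun_prop)
  calc ∫⁻ k, ENNReal.ofReal (gainRate β m Φ (k, k')) ∂lebesgueHalfLine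
      ≤ ∫⁻ k, {x : ℝ≥0 | θ * x ≤ k'}.indicator
          (fun _ => ENNReal.ofReal (kernelConst β m / k')) k ∂lebesgueHalfLine := by
        refine lintegral_mono fun k => ?_
        refine (ENNReal.ofReal_le_ofReal (gainRate_le hβ hm h0 h1 hδ hΦ k k')).trans_eq ?_
        by_cases hk : k ∈ {x : ℝ≥0 | θ * x ≤ k'}
        · rw [indicator_of_mem hk, indicator_of_mem hk]
        · rw [indicator_of_notMem hk, indicator_of_notMem hk, ENNReal.ofReal_zero]
    _ = ENNReal.ofReal (kernelConst β m / k') * lebesgueHalfLine {x : ℝ≥0 | θ * x ≤ k'} :=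
        lintegral_indicator_const hmeas _
    _ ≤ ENNReal.ofReal (kernelConst β m / k') * ENNReal.ofReal (k' / θ) := by
        gcongr
        exact lebesgueHalfLine_cone h0 k'
    _ = _ := by
        rw [← ENNReal.ofReal_mul (by positivity)]
        congr 1
        field_simp

lemma integrable_gainRate (hβ : 0 < β) (hm : 0 < m) (h0 : 0 < θ) (h1 : θ < 1) (hδ : 0 < δ)
    (hΦ : IsCutoff θ δ Φ) (k' : ℝ≥0) :
    Integrable (fun k => gainRate β m Φ (k, k')) lebesgueHalfLine := by
  refine ⟨((measurable_gainRate hβ hm h0 h1 hδ hΦ).comp (by fun_prop)).aestronglyMeasurable, ?_⟩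
  rw [hasFiniteIntegral_iff_ofReal (Filter.Eventually.of_forall fun k => gainRate_nonneg hΦ _)]
  exact (lintegral_gainRate_le hβ hm h0 h1 hδ hΦ k').trans_lt ENNReal.ofReal_lt_top

lemma integral_gainRate_le (hβ : 0 < β) (hm : 0 < m) (h0 : 0 < θ) (h1 : θ < 1) (hδ : 0 < δ)
    (hΦ : IsCutoff θ δ Φ) (k' : ℝ≥0) :
    ∫ k, gainRate β m Φ (k, k') ∂lebesgueHalfLine ≤ kernelConst β m / θ := by
  have hK := kernelConst_pos hβ m
  rw [integral_eq_lintegral_of_nonneg_ae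
    (Filter.Eventually.of_forall fun k => gainRate_nonneg hΦ _)
    (integrable_gainRate hβ hm h0 h1 hδ hΦ k').1]
  exact ENNReal.toReal_le_of_le_ofReal (by positivity)
    (lintegral_gainRate_le hβ hm h0 h1 hδ hΦ k')

lemma abs_integral_gainRate_mul_le (hβ : 0 < β) (hm : 0 < m) (h0 : 0 < θ) (h1 : θ < 1)
    (hδ : 0 < δ) (hΦ : IsCutoff θ δ Φ) {k' : ℝ≥0} {ψ : ℝ≥0 → ℝ} {c : ℝ} (hc : 0 ≤ c)
    (hψ : ∀ k : ℝ≥0, θ * k ≤ k' → θ * k' ≤ k → |ψ k| ≤ c) :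
    |∫ k, gainRate β m Φ (k, k') * ψ k ∂lebesgueHalfLine| ≤ c * (kernelConst β m / θ) := by
  calc |∫ k, gainRate β m Φ (k, k') * ψ k ∂lebesgueHalfLine|
      ≤ ∫ k, c * gainRate β m Φ (k, k') ∂lebesgueHalfLine := by
        rw [← Real.norm_eq_abs]
        refine norm_integral_le_of_norm_le ((integrable_gainRate hβ hm h0 h1 hδ hΦ k').const_mul c)
          (Filter.Eventually.of_forall fun k => ?_)
        rw [Real.norm_eq_abs, abs_mul, abs_of_nonneg (gainRate_nonneg hΦ _), mul_comm c]
        by_cases hT : truncKernel β m Φ (k, k') = 0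
        · simp [gainRate, hT]
        · obtain ⟨-, -, e1, e2, -⟩ := cone_of_truncKernel_ne_zero h0 h1 hδ hΦ hT
          exact mul_le_mul_of_nonneg_left (hψ k e1 e2) (gainRate_nonneg hΦ _)
    _ ≤ _ := by
        rw [integral_const_mul]
        exact mul_le_mul_of_nonneg_left (integral_gainRate_le hβ hm h0 h1 hδ hΦ k') hc

/-- One factor `|k - k'|` comes from the rate and one from `φ`; their product is at most `kk'(k +
k') / (θδ)` on the region. Allowing any local slope `w` gives boundedness from a Lipschitz constant
and smallness near the origin from a small slope. -/
lemma abs_quadraticIntegrand_le (hβ : 0 < β) (hm : 0 < m) (h0 : 0 < θ) (h1 : θ < 1) (hδ : 0 < δ)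
    (hΦ : IsCutoff θ δ Φ) {p : ℝ≥0 × ℝ≥0} {w : ℝ} (hw0 : 0 ≤ w)
    (hw : exchangeRate β m Φ p ≠ 0 → |φ p.1 - φ p.2| ≤ w * |(p.1 : ℝ) - p.2|) :
    |quadraticIntegrand β m Φ φ p| ≤ kernelConst β m * β / (θ * δ) * w := by
  have hK := kernelConst_pos hβ m
  rw [quadraticIntegrand_eq]
  by_cases hE : exchangeRate β m Φ p = 0
  · rw [hE, zero_mul, abs_zero]
    positivity
  have hT : truncKernel β m Φ p ≠ 0 := fun h => hE (by rw [exchangeRate, h, zero_mul])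
  obtain ⟨hk, hk', -, -, hs⟩ := cone_of_truncKernel_ne_zero h0 h1 hδ hΦ hT
  rw [abs_mul]
  calc _ ≤ kernelConst β m * β * |(p.1 : ℝ) - p.2| / ((p.1 : ℝ) * p.2 * ((p.1 : ℝ) + p.2)) *
        (w * |(p.1 : ℝ) - p.2|) := by
        gcongr
        · exact abs_exchangeRate_le hβ hm h0 h1 hδ hΦ p
        · exact hw hE
    _ = kernelConst β m * β * w * (((p.1 : ℝ) - p.2) ^ 2 /
          ((p.1 : ℝ) * p.2 * ((p.1 : ℝ) + p.2))) := by
        rw [← sq_abs]; ring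
    _ ≤ kernelConst β m * β * w * (1 / (θ * δ)) := by
        refine mul_le_mul_of_nonneg_left ?_ (by positivity)
        rwa [div_le_iff₀ (by positivity)]
    _ = _ := by ring

/-- Only the origin is delicate, and it matters because limit measures may charge it. There the
condition `φ'(0) = 0` makes the slope, and with it the integrand, tend to `0`. -/
lemma continuous_quadraticIntegrand (hβ : 0 < β) (hm : 0 < m) (h0 : 0 < θ) (h1 : θ < 1)
    (hδ : 0 < δ) (hΦ : IsCutoff θ δ Φ) (hφ : IsTestFunction φ) :
    Continuous (quadraticIntegrand β m Φ φ) := by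
  have hK := kernelConst_pos hβ m
  have hφc := hφ.continuous_coe
  have hφ1 : Continuous fun p : ℝ≥0 × ℝ≥0 => φ p.1 := hφc.comp continuous_fst
  have hφ2 : Continuous fun p : ℝ≥0 × ℝ≥0 => φ p.2 := hφc.comp continuous_snd
  rw [continuous_iff_continuousAt]
  intro p
  by_cases hp : p = (0, 0)
  · subst hp
    have hz : quadraticIntegrand β m Φ φ (0, 0) = 0 := by simp [quadraticIntegrand]
    rw [ContinuousAt, hz, Metric.tendsto_nhds]
    intro ε hε
    set c := kernelConst β m * β / (θ * δ) with hc
    have hcpos : 0 < c := by positivity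
    obtain ⟨r, hr, hw⟩ := hφ.exists_small_slope (ε := ε / (2 * c)) (by positivity)
    have e1 : ∀ᶠ p : ℝ≥0 × ℝ≥0 in nhds (0, 0), (p.1 : ℝ) < r :=
      (NNReal.continuous_coe.comp continuous_fst).continuousAt.eventually_lt_const hr
    have e2 : ∀ᶠ p : ℝ≥0 × ℝ≥0 in nhds (0, 0), (p.2 : ℝ) < r :=
      (NNReal.continuous_coe.comp continuous_snd).continuousAt.eventually_lt_const hr
    filter_upwards [e1, e2] with p h1p h2p
    rw [Real.dist_0_eq_abs]
    refine (abs_quadraticIntegrand_le hβ hm h0 h1 hδ hΦ (by positivity)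
      (fun _ => hw p.1 p.2 h1p.le h2p.le)).trans_lt ?_
    rw [← hc]
    calc c * (ε / (2 * c)) = ε / 2 := by field_simp
      _ < ε := by linarith
  · have hT := (continuousOn_truncKernel hβ hm h0 h1 hδ hΦ).continuousAt
      (isOpen_compl_singleton.mem_nhds hp)
    unfold quadraticIntegrand
    refine (hT.mul (by fun_prop)).mul (hφ1.sub hφ2).continuousAt

/-- The part of the weak collision operator that is linear in `v`, as a function of `k'`. -/
noncomputable def gainPotential (β m : ℝ) (Φ : ℝ≥0 × ℝ≥0 → ℝ) (φ : ℝ → ℝ) (k' : ℝ≥0) : ℝ :=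
  ∫ k, gainIntegrand β m Φ φ (k, k') ∂lebesgueHalfLine

lemma abs_sub_le_div (h0 : 0 < θ) (h1 : θ < 1) {k k' : ℝ≥0} (h : θ * k ≤ k') :
    |(k : ℝ) - k'| ≤ k' / θ := by
  have hk : (0 : ℝ) ≤ k := k.2
  have hk' : (0 : ℝ) ≤ k' := k'.2
  have e1 : (k : ℝ) ≤ k' / θ := by rwa [le_div_iff₀ h0, mul_comm]
  have e2 : (k' : ℝ) ≤ k' / θ := by
    rw [le_div_iff₀ h0]
    exact mul_le_of_le_one_right hk' h1.le
  rw [abs_le]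
  constructor <;> linarith

/-- Jumps from `k'` have length at most `k' / θ` and bounded total rate, so the potential is `O(k')`
at `0`; elsewhere dominated convergence applies. -/
lemma continuous_gainPotential (hβ : 0 < β) (hm : 0 < m) (h0 : 0 < θ) (h1 : θ < 1)
    (hδ : 0 < δ) (hΦ : IsCutoff θ δ Φ) (hφ : IsTestFunction φ) :
    Continuous (gainPotential β m Φ φ) := by
  have hK := kernelConst_pos hβ m
  have hφc := hφ.continuous_coe
  obtain ⟨L, hL0, hL⟩ := hφ.exists_lipschitz
  obtain ⟨M, hM0, hM⟩ := hφ.exists_bound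
  rw [continuous_iff_continuousAt]
  intro a
  rcases eq_or_ne a 0 with ha | ha
  · subst ha
    have hz : gainPotential β m Φ φ 0 = 0 := by
      have : ∀ k : ℝ≥0, gainIntegrand β m Φ φ (k, 0) = 0 := fun k => by
        rw [gainIntegrand, truncKernel_eq_zero (Or.inr (Or.inl rfl)), zero_mul, zero_mul]
      simp [gainPotential, this]
    rw [ContinuousAt, hz]
    refine squeeze_zero_norm (a := fun k' : ℝ≥0 => L * (k' / θ) * (kernelConst β m / θ)) ?_ ?_
    · intro k'
      refine abs_integral_gainRate_mul_le hβ hm h0 h1 hδ hΦ (ψ := fun k => φ k - φ k')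
        (by positivity) fun k hk _ => (hL k k').trans ?_
      exact mul_le_mul_of_nonneg_left (abs_sub_le_div h0 h1 hk) hL0
    · have : Continuous fun k' : ℝ≥0 => L * ((k' : ℝ) / θ) * (kernelConst β m / θ) := by fun_prop
      simpa using this.tendsto 0
  · have ha' : (0 : ℝ) < a := by exact_mod_cast pos_iff_ne_zero.2 ha
    -- For `a/2 < k' < 2a` the rate is at most `K / (a/2)` and lives on `θk ≤ 2a`, a set of finite
    -- measure.
    refine continuousAt_of_dominated (bound := fun k => {x : ℝ≥0 | θ * x ≤ (2 * a : ℝ≥0)}.indicator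
      (fun _ => kernelConst β m / (a / 2) * (2 * M)) k) ?_ ?_ ?_ ?_
    · refine Filter.Eventually.of_forall fun k' => Measurable.aestronglyMeasurable ?_
      have := (measurable_gainRate hβ hm h0 h1 hδ hΦ).comp
        (measurable_prodMk_right (y := k') (α := ℝ≥0))
      exact this.mul (hφc.measurable.sub_const (φ k'))
    · have e1 : ∀ᶠ k' : ℝ≥0 in nhds a, (a : ℝ) / 2 < k' :=
        NNReal.continuous_coe.continuousAt.eventually_const_lt (by linarith)
      have e2 : ∀ᶠ k' : ℝ≥0 in nhds a, (k' : ℝ) < 2 * a :=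
        NNReal.continuous_coe.continuousAt.eventually_lt_const (by linarith)
      filter_upwards [e1, e2] with k' h1k h2k
      refine Filter.Eventually.of_forall fun k => ?_
      have h3 := gainRate_le hβ hm h0 h1 hδ hΦ k k'
      have h4 : |φ k - φ k'| ≤ 2 * M := by
        calc |φ k - φ k'| ≤ |φ k| + |φ k'| := abs_sub _ _
          _ ≤ _ := by linarith [hM k, hM k']
      rw [gainIntegrand_eq, Real.norm_eq_abs, abs_mul, abs_of_nonneg (gainRate_nonneg hΦ _)]
      refine (mul_le_mul h3 h4 (abs_nonneg _) ((gainRate_nonneg hΦ _).trans h3)).trans ?_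
      by_cases hk : k ∈ {x : ℝ≥0 | θ * x ≤ k'}
      · rw [indicator_of_mem hk, indicator_of_mem]
        · gcongr
        · have : θ * k ≤ k' := hk
          show θ * k ≤ (2 * a : ℝ≥0)
          push_cast
          linarith
      · rw [indicator_of_notMem hk, zero_mul]
        exact indicator_nonneg (fun _ _ => by positivity) _
    · rw [integrable_indicator_iff (measurableSet_le (by fun_prop) (by fun_prop))]
      refine integrableOn_const ?_
      exact ((lebesgueHalfLine_cone h0 (2 * a)).trans_lt ENNReal.ofReal_lt_top).ne
    · refine Filter.Eventually.of_forall fun k => ?_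
      have hne : (k, a) ≠ (0, 0) := fun h => ha (Prod.ext_iff.1 h).2
      have hT := (continuousOn_truncKernel hβ hm h0 h1 hδ hΦ).continuousAt
        (isOpen_compl_singleton.mem_nhds hne)
      have hT' : ContinuousAt (fun k' : ℝ≥0 => truncKernel β m Φ (k, k')) a :=
        ContinuousAt.comp (f := fun k' : ℝ≥0 => (k, k')) hT (by fun_prop)
      exact (hT'.mul continuousAt_const).mul (continuousAt_const.sub hφc.continuousAt)

lemma exists_bound_gainPotential (hβ : 0 < β) (hm : 0 < m) (h0 : 0 < θ) (h1 : θ < 1)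
    (hδ : 0 < δ) (hΦ : IsCutoff θ δ Φ) (hφ : IsTestFunction φ) :
    ∃ c, 0 ≤ c ∧ ∀ k', |gainPotential β m Φ φ k'| ≤ c := by
  have hK := kernelConst_pos hβ m
  obtain ⟨M, hM0, hM⟩ := hφ.exists_bound
  refine ⟨2 * M * (kernelConst β m / θ), by positivity, fun k' => ?_⟩
  refine abs_integral_gainRate_mul_le hβ hm h0 h1 hδ hΦ (ψ := fun k => φ k - φ k')
    (by positivity) fun k _ _ => ?_
  calc |φ k - φ k'| ≤ |φ k| + |φ k'| := abs_sub _ _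
    _ ≤ _ := by linarith [hM k, hM k']

lemma exists_bound_quadraticIntegrand (hβ : 0 < β) (hm : 0 < m) (h0 : 0 < θ) (h1 : θ < 1)
    (hδ : 0 < δ) (hΦ : IsCutoff θ δ Φ) (hφ : IsTestFunction φ) :
    ∃ c, 0 ≤ c ∧ ∀ p, |quadraticIntegrand β m Φ φ p| ≤ c := by
  have hK := kernelConst_pos hβ m
  obtain ⟨L, hL0, hL⟩ := hφ.exists_lipschitz
  exact ⟨_, by positivity, fun p =>
    abs_quadraticIntegrand_le hβ hm h0 h1 hδ hΦ hL0 fun _ => hL p.1 p.2⟩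

lemma integrable_gainIntegrand (hβ : 0 < β) (hm : 0 < m) (h0 : 0 < θ) (h1 : θ < 1)
    (hδ : 0 < δ) (hΦ : IsCutoff θ δ Φ) (hφ : IsTestFunction φ) (v : Measure ℝ≥0)
    [IsFiniteMeasure v] : Integrable (gainIntegrand β m Φ φ) (lebesgueHalfLine.prod v) := by
  have hK := kernelConst_pos hβ m
  have hφc := hφ.continuous_coe
  obtain ⟨M, hM0, hM⟩ := hφ.exists_bound
  have hg := measurable_gainRate hβ hm h0 h1 hδ hΦ
  have hmeas : Measurable (gainIntegrand β m Φ φ) :=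
    hg.mul ((hφc.measurable.comp measurable_fst).sub (hφc.measurable.comp measurable_snd))
  refine ⟨hmeas.aestronglyMeasurable, ?_⟩
  rw [hasFiniteIntegral_iff_enorm, lintegral_prod_symm _ hmeas.enorm.aemeasurable]
  calc ∫⁻ k', ∫⁻ k, ‖gainIntegrand β m Φ φ (k, k')‖ₑ ∂lebesgueHalfLine ∂v
      ≤ ∫⁻ k', ENNReal.ofReal (2 * M) * ENNReal.ofReal (kernelConst β m / θ) ∂v := by
        refine lintegral_mono fun k' => ?_
        calc ∫⁻ k, ‖gainIntegrand β m Φ φ (k, k')‖ₑ ∂lebesgueHalfLine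
            ≤ ∫⁻ k, ENNReal.ofReal (2 * M) * ENNReal.ofReal (gainRate β m Φ (k, k'))
                ∂lebesgueHalfLine := by
              refine lintegral_mono fun k => ?_
              rw [gainIntegrand_eq, Real.enorm_eq_ofReal_abs, ← ENNReal.ofReal_mul (by positivity),
                abs_mul, abs_of_nonneg (gainRate_nonneg hΦ _), mul_comm]
              refine ENNReal.ofReal_le_ofReal (mul_le_mul_of_nonneg_right ?_ (gainRate_nonneg hΦ _))
              calc |φ k - φ k'| ≤ |φ k| + |φ k'| := abs_sub _ _
                _ ≤ _ := by linarith [hM k, hM k']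
          _ ≤ _ := by
              have hgk : Measurable fun k : ℝ≥0 => gainRate β m Φ (k, k') := hg.comp measurable_prodMk_right
              rw [lintegral_const_mul _ hgk.ennreal_ofReal]
              gcongr
              exact lintegral_gainRate_le hβ hm h0 h1 hδ hΦ k'
    _ < ⊤ := by
        rw [lintegral_const]
        exact ENNReal.mul_lt_top (ENNReal.mul_lt_top ENNReal.ofReal_lt_top ENNReal.ofReal_lt_top)
          (measure_lt_top _ _)

lemma integrable_quadraticIntegrand (hβ : 0 < β) (hm : 0 < m) (h0 : 0 < θ) (h1 : θ < 1)
    (hδ : 0 < δ) (hΦ : IsCutoff θ δ Φ) (hφ : IsTestFunction φ) (v : Measure ℝ≥0)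
    [IsFiniteMeasure v] : Integrable (quadraticIntegrand β m Φ φ) (v.prod v) := by
  obtain ⟨c, -, hc⟩ := exists_bound_quadraticIntegrand hβ hm h0 h1 hδ hΦ hφ
  exact Integrable.of_bound
    (continuous_quadraticIntegrand hβ hm h0 h1 hδ hΦ hφ).aestronglyMeasurable c
    (Filter.Eventually.of_forall hc)

lemma lossIntegrand_eq_comp_swap (hΦ : IsCutoff θ δ Φ) (φ : ℝ → ℝ) :
    lossIntegrand β m Φ φ = fun p => -gainIntegrand β m Φ φ p.swap := by
  ext p
  rw [← lossIntegrand_swap hΦ, Prod.swap_swap]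

lemma collisionIntegrable (hβ : 0 < β) (hm : 0 < m) (h0 : 0 < θ) (h1 : θ < 1)
    (hδ : 0 < δ) (hΦ : IsCutoff θ δ Φ) (hφ : IsTestFunction φ) (v : Measure ℝ≥0)
    [IsFiniteMeasure v] : CollisionIntegrable β m Φ φ v := by
  refine ⟨integrable_quadraticIntegrand hβ hm h0 h1 hδ hΦ hφ v,
    integrable_gainIntegrand hβ hm h0 h1 hδ hΦ hφ v, ?_⟩
  rw [lossIntegrand_eq_comp_swap hΦ]
  exact (integrable_gainIntegrand hβ hm h0 h1 hδ hΦ hφ v).swap.neg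

/-- Gain minus loss is twice the gain, which cancels the prefactor `1/2` in the linear part. -/
lemma weakCollision_eq (hβ : 0 < β) (hm : 0 < m) (h0 : 0 < θ) (h1 : θ < 1)
    (hδ : 0 < δ) (hΦ : IsCutoff θ δ Φ) (hφ : IsTestFunction φ) (v : Measure ℝ≥0)
    [IsFiniteMeasure v] : weakCollision β m Φ φ v =
      1 / 2 * (∫ p, quadraticIntegrand β m Φ φ p ∂(v.prod v)) + ∫ k', gainPotential β m Φ φ k' ∂v := by
  have e1 : ∫ p, lossIntegrand β m Φ φ p ∂(v.prod lebesgueHalfLine) =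
      -∫ p, gainIntegrand β m Φ φ p ∂(lebesgueHalfLine.prod v) := by
    rw [lossIntegrand_eq_comp_swap hΦ, integral_neg, integral_prod_swap]
  have e2 : ∫ p, gainIntegrand β m Φ φ p ∂(lebesgueHalfLine.prod v) =
      ∫ k', gainPotential β m Φ φ k' ∂v :=
    integral_prod_symm _ (integrable_gainIntegrand hβ hm h0 h1 hδ hΦ hφ v)
  rw [weakCollision, e1, e2]
  ring

end

/-! ### Positivity-preserving Euler steps -/

section EulerStep

variable {X : Type*} [MeasurableSpace X]

/-- The weak form of a mean-field jump process: `A` is the antisymmetric interaction rate, `g` the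
rate of the linear jumps with respect to `ν`. -/
noncomputable def jumpOperator (M : ℝ) (A g : X × X → ℝ) (ν : Measure X) (φ : X → ℝ)
    (p : Measure X) : ℝ :=
  M / 2 * ∫ z, A z * (φ z.1 - φ z.2) ∂(p.prod p) + ∫ z, g z * (φ z.1 - φ z.2) ∂(ν.prod p)

lemma integrable_of_lintegral_section_le {ν p : Measure X} [SFinite ν] [IsProbabilityMeasure p]
    {g : X × X → ℝ} (hg : Measurable g) (hg0 : ∀ z, 0 ≤ g z) {l : ℝ}
    (hl : ∀ y, ∫⁻ x, ENNReal.ofReal (g (x, y)) ∂ν ≤ ENNReal.ofReal l) :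
    Integrable g (ν.prod p) := by
  refine ⟨hg.aestronglyMeasurable, ?_⟩
  rw [hasFiniteIntegral_iff_ofReal (Filter.Eventually.of_forall hg0),
    lintegral_prod_symm _ hg.ennreal_ofReal.aemeasurable]
  calc _ ≤ ∫⁻ _, ENNReal.ofReal l ∂p := lintegral_mono hl
    _ < ⊤ := by simp

lemma integrable_mul_of_bounded {μ : Measure (X × X)} {g φ : X × X → ℝ} (hg : Integrable g μ)
    (hφ : Measurable φ) {c : ℝ} (hc : ∀ x, |φ x| ≤ c) : Integrable (fun z => g z * φ z) μ :=
  hg.mul_bdd (c := c) hφ.aestronglyMeasurable (Filter.Eventually.of_forall hc)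

/-- The marginal of a density on a product space. -/
lemma integral_map_fst_withDensity {μ : Measure (X × X)} {f : X × X → ℝ} (hf : Measurable f)
    (hf0 : ∀ z, 0 ≤ f z) {φ : X → ℝ} (hφ : Measurable φ) :
    ∫ x, φ x ∂((μ.withDensity fun z => ENNReal.ofReal (f z)).map Prod.fst) =
      ∫ z, f z * φ z.1 ∂μ := by
  rw [integral_map measurable_fst.aemeasurable hφ.aestronglyMeasurable,
    integral_withDensity_eq_integral_toReal_smul hf.ennreal_ofReal
      (Filter.Eventually.of_forall fun _ => ENNReal.ofReal_lt_top)]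
  refine integral_congr_ae (Filter.Eventually.of_forall fun z => ?_)
  simp only [ENNReal.toReal_ofReal (hf0 z), smul_eq_mul]

lemma isFiniteMeasure_withDensity_of_integrable {μ : Measure (X × X)} {f : X × X → ℝ}
    (hf : Integrable f μ) : IsFiniteMeasure (μ.withDensity fun z => ENNReal.ofReal (f z)) :=
  isFiniteMeasure_withDensity_ofReal hf.2

/-- An explicit Euler step of length `h` preserves probability measures. -/
theorem exists_euler_step {ν : Measure X} [SFinite ν] {A g : X × X → ℝ} (hA : Measurable A)
    (hAs : ∀ x y, A (y, x) = -A (x, y)) {a : ℝ} (hAa : ∀ z, |A z| ≤ a) (hg : Measurable g)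
    (hg0 : ∀ z, 0 ≤ g z) {l : ℝ} (hl0 : 0 ≤ l)
    (hl : ∀ y, ∫⁻ x, ENNReal.ofReal (g (x, y)) ∂ν ≤ ENNReal.ofReal l)
    {M h : ℝ} (hM : 0 ≤ M) (hh : 0 ≤ h) (hsmall : h * (M * a + l) ≤ 1)
    (P : Measure X) [IsProbabilityMeasure P] :
    ∃ Q : Measure X, IsProbabilityMeasure Q ∧
      ∀ φ : X → ℝ, Measurable φ → (∃ c, ∀ x, |φ x| ≤ c) →
        ∫ x, φ x ∂Q = ∫ x, φ x ∂P + h * jumpOperator M A g ν φ P := by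
  set lam : X → ℝ := fun y => ∫ x, g (x, y) ∂ν with hlam
  have hlamm : Measurable lam := (hg.stronglyMeasurable.integral_prod_left').measurable
  have hlam0 : ∀ y, 0 ≤ lam y := fun y => integral_nonneg fun x => hg0 _
  have hlaml : ∀ y, lam y ≤ l := fun y => by
    have hgy : Measurable fun x => g (x, y) := hg.comp measurable_prodMk_right
    rw [hlam]
    simp only
    rw [integral_eq_lintegral_of_nonneg_ae (Filter.Eventually.of_forall fun x => hg0 _)
      hgy.aestronglyMeasurable]
    exact ENNReal.toReal_le_of_le_ofReal hl0 (hl y)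
  -- By antisymmetry `M/2 ∬ A (φ(x) - φ(y)) = M ∬ A φ(x)`, so the interaction acts as a density on
  -- `P ⊗ P`; `lam` is the rate of leaving `x`. The new measure is the first marginal of this
  -- density plus that of the arrivals `h g` on `ν ⊗ P`.
  set f : X × X → ℝ := fun z => 1 + h * (M * A z - lam z.1) with hf
  have hfm : Measurable f := by fun_prop
  -- The density is at least `1 - h (M a + l)`, which `hsmall` makes nonnegative.
  have hf0 : ∀ z, 0 ≤ f z := fun z => by
    have h1 : -(M * a) ≤ M * A z := by nlinarith [(abs_le.1 (hAa z)).1]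
    have h2 := hlaml z.1
    have h3 : h * -(M * a + l) ≤ h * (M * A z - lam z.1) :=
      mul_le_mul_of_nonneg_left (by linarith) hh
    simp only [hf]
    linarith
  have hAi : Integrable A (P.prod P) :=
    Integrable.of_bound hA.aestronglyMeasurable a (Filter.Eventually.of_forall hAa)
  have hlami : Integrable (fun z : X × X => lam z.1) (P.prod P) := by
    refine Integrable.of_bound (hlamm.comp measurable_fst).aestronglyMeasurable l (Filter.Eventually.of_forall fun z => ?_)
    rw [Real.norm_of_nonneg (hlam0 _)]
    exact hlaml _
  have hfi : Integrable f (P.prod P) :=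
    (integrable_const 1).add (((hAi.const_mul M).sub hlami).const_mul h)
  have hgi : Integrable g (ν.prod P) := integrable_of_lintegral_section_le hg hg0 hl
  have hhg : Measurable fun z => h * g z := hg.const_mul h
  have := isFiniteMeasure_withDensity_of_integrable hfi
  have := isFiniteMeasure_withDensity_of_integrable (hgi.const_mul h)
  set q1 := ((P.prod P).withDensity fun z => ENNReal.ofReal (f z)).map Prod.fst with hq1
  set q2 := ((ν.prod P).withDensity fun z => ENNReal.ofReal (h * g z)).map Prod.fst with hq2
  have key : ∀ φ : X → ℝ, Measurable φ → (∃ c, ∀ x, |φ x| ≤ c) →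
      ∫ x, φ x ∂(q1 + q2) = ∫ x, φ x ∂P + h * jumpOperator M A g ν φ P := by
    rintro φ hφ ⟨c, hc⟩
    have hφi : ∀ μ : Measure X, IsFiniteMeasure μ → Integrable φ μ := fun μ _ =>
      Integrable.of_bound hφ.aestronglyMeasurable c (Filter.Eventually.of_forall hc)
    have hφ1 : Measurable fun z : X × X => φ z.1 := hφ.comp measurable_fst
    have hφ2 : Measurable fun z : X × X => φ z.2 := hφ.comp measurable_snd
    rw [integral_add_measure (hφi _ inferInstance) (hφi _ inferInstance),
      integral_map_fst_withDensity hfm hf0 hφ,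
      integral_map_fst_withDensity hhg (fun z => mul_nonneg hh (hg0 z)) hφ]
    have iA1 := integrable_mul_of_bounded hAi hφ1 fun z => hc z.1
    have iA2 := integrable_mul_of_bounded hAi hφ2 fun z => hc z.2
    have ig1 := integrable_mul_of_bounded hgi hφ1 fun z => hc z.1
    have ig2 := integrable_mul_of_bounded hgi hφ2 fun z => hc z.2
    have il := integrable_mul_of_bounded hlami hφ1 fun z => hc z.1
    have iφ : Integrable (fun z : X × X => φ z.1) (P.prod P) :=
      Integrable.of_bound hφ1.aestronglyMeasurable c (Filter.Eventually.of_forall fun z => hc z.1)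
    have e1 : ∫ z, f z * φ z.1 ∂(P.prod P) = ∫ x, φ x ∂P +
        h * (M * ∫ z, A z * φ z.1 ∂(P.prod P) - ∫ x, lam x * φ x ∂P) := by
      have e0 : ∀ z : X × X, f z * φ z.1 = φ z.1 + h * (M * (A z * φ z.1) - lam z.1 * φ z.1) :=
        fun z => by simp only [hf]; ring
      simp_rw [e0]
      have i1 : Integrable (fun z => M * (A z * φ z.1)) (P.prod P) := iA1.const_mul M
      have i2 : Integrable (fun z => h * (M * (A z * φ z.1) - lam z.1 * φ z.1)) (P.prod P) :=
        (i1.sub il).const_mul h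
      rw [integral_add iφ i2, integral_const_mul, integral_sub i1 il, integral_const_mul, integral_fun_fst φ,
        integral_fun_fst fun x => lam x * φ x]
      simp
    have e2 : ∫ z, A z * φ z.2 ∂(P.prod P) = -∫ z, A z * φ z.1 ∂(P.prod P) := by
      rw [← integral_prod_swap, ← integral_neg]
      refine integral_congr_ae (Filter.Eventually.of_forall fun z => ?_)
      simp only [Prod.swap, hAs z.1 z.2]
      ring
    have e3 : ∫ z, g z * φ z.2 ∂(ν.prod P) = ∫ x, lam x * φ x ∂P := by
      rw [integral_prod_symm _ ig2]
      refine integral_congr_ae (Filter.Eventually.of_forall fun y => ?_)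
      simp only [hlam, integral_mul_const]
    have e4 : ∫ z, h * g z * φ z.1 ∂(ν.prod P) = h * ∫ z, g z * φ z.1 ∂(ν.prod P) := by
      simp_rw [mul_assoc]
      rw [integral_const_mul]
    rw [jumpOperator]
    simp_rw [mul_sub]
    rw [integral_sub iA1 iA2, integral_sub ig1 ig2, e1, e2, e3, e4]
    ring
  -- The operator annihilates constants, so testing with `1` gives total mass one.
  have hone : IsProbabilityMeasure (q1 + q2) := by
    have h1 := key (fun _ => 1) measurable_const ⟨1, fun _ => by simp⟩
    simp only [jumpOperator, sub_self, mul_zero, integral_zero, integral_const, smul_eq_mul,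
      mul_one, add_zero, probReal_univ] at h1
    exact ⟨by
      rw [← ENNReal.toReal_eq_one_iff]
      exact h1⟩
  exact ⟨q1 + q2, hone, key⟩

end EulerStep

/-! ### Compactness for curves of probability measures -/

section Compactness

open Filter Topology BoundedContinuousFunction

lemma ProbabilityMeasure.continuous_integral_bcf {X : Type*} [TopologicalSpace X]
    [MeasurableSpace X] [OpensMeasurableSpace X] (φ : X →ᵇ ℝ) :
    Continuous fun μ : ProbabilityMeasure X => ∫ x, φ x ∂(μ : Measure X) :=
  continuous_iff_continuousAt.2 fun _ =>
    (ProbabilityMeasure.tendsto_iff_forall_integral_tendsto.1 tendsto_id) φ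

/-- On a compact set of probability measures a separating family of test functions determines the
topology. -/
lemma tendsto_of_forall_test {X : Type*} [TopologicalSpace X] [MeasurableSpace X]
    [OpensMeasurableSpace X] {T : Set (X →ᵇ ℝ)}
    (hT : ∀ μ ν : ProbabilityMeasure X,
      (∀ φ ∈ T, ∫ x, φ x ∂(μ : Measure X) = ∫ x, φ x ∂(ν : Measure X)) → μ = ν)
    {ι : Type*} {l : Filter ι} {f : ι → ProbabilityMeasure X} {Y : Set (ProbabilityMeasure X)}
    (hY : IsCompact Y) (hf : ∀ᶠ i in l, f i ∈ Y) {μ : ProbabilityMeasure X}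
    (h : ∀ φ ∈ T, Tendsto (fun i => ∫ x, φ x ∂(f i : Measure X)) l (𝓝 (∫ x, φ x ∂(μ : Measure X)))) :
    Tendsto f l (𝓝 μ) := by
  -- Every cluster point agrees with `μ` on `T`, hence equals `μ`; in a compact set this forces
  -- convergence.
  refine hY.tendsto_nhds_of_unique_mapClusterPt hf fun ν _ hν => hT ν μ fun φ hφ => ?_
  obtain ⟨U, hU, hUν⟩ := mapClusterPt_iff_ultrafilter.1 hν
  exact tendsto_nhds_unique (((ProbabilityMeasure.continuous_integral_bcf φ).tendsto ν).comp hUν)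
    ((h φ hφ).mono_left hU)

variable {X : Type*} [TopologicalSpace X] [TopologicalSpace.MetrizableSpace X]
  [TopologicalSpace.SeparableSpace X] [MeasurableSpace X] [BorelSpace X]

/-- An Arzelà–Ascoli theorem for curves of probability measures that are equicontinuous, up to an
error `h n → 0`, when tested with a separating family of functions. -/
theorem exists_subseq_tendsto_curve {T : Set (X →ᵇ ℝ)}
    (hT : ∀ μ ν : ProbabilityMeasure X,
      (∀ φ ∈ T, ∫ x, φ x ∂(μ : Measure X) = ∫ x, φ x ∂(ν : Measure X)) → μ = ν)
    {p : ℕ → ℝ → ProbabilityMeasure X} {h : ℕ → ℝ} (hh : Tendsto h atTop (𝓝 0))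
    (hcomp : ∀ t₀ : ℝ, ∃ Y : Set (ProbabilityMeasure X), IsCompact Y ∧ ∀ n, ∀ t ≤ t₀, p n t ∈ Y)
    (heq : ∀ φ ∈ T, ∃ C : ℝ, ∀ n s t,
      |∫ x, φ x ∂(p n t : Measure X) - ∫ x, φ x ∂(p n s : Measure X)| ≤ C * (|t - s| + h n)) :
    ∃ (u : ℕ → ℕ) (q : ℝ → ProbabilityMeasure X), StrictMono u ∧ Continuous q ∧
      ∀ t, Tendsto (fun n => p (u n) t) atTop (𝓝 (q t)) := by
  choose Y hYc hY using hcomp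
  -- Compactness of the countable product over rational times replaces a diagonal extraction.
  obtain ⟨c, -, u, hu, hc⟩ := (isCompact_univ_pi fun r : ℚ => hYc r).tendsto_subseq
    (x := fun n (r : ℚ) => p n r) fun n => mem_univ_pi.2 fun r => hY r n r le_rfl
  have hcr : ∀ r : ℚ, Tendsto (fun n => p (u n) r) atTop (𝓝 (c r)) := fun r =>
    (tendsto_pi_nhds.1 hc) r
  have hhu : Tendsto (fun n => h (u n)) atTop (𝓝 0) := hh.comp hu.tendsto_atTop
  have hlim : ∀ t, ∃ μ, Tendsto (fun n => p (u n) t) atTop (𝓝 μ) := by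
    intro t
    obtain ⟨μ, -, w, hw, hμ⟩ := (hYc t).tendsto_subseq fun n => hY t (u n) t le_rfl
    -- At a time `t` each cluster point is within `C |t - r|` of the limit at rational `r`, as `h n
    -- → 0`. Letting `r` approach `t` shows that all cluster points coincide on `T`.
    have hclose : ∀ φ ∈ T, ∃ C : ℝ, ∀ ν, MapClusterPt ν atTop (fun n => p (u n) t) → ∀ r : ℚ,
        |∫ x, φ x ∂(ν : Measure X) - ∫ x, φ x ∂(c r : Measure X)| ≤ C * |t - r| := by
      intro φ hφ
      obtain ⟨C, hC⟩ := heq φ hφ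
      refine ⟨C, fun ν hν r => ?_⟩
      obtain ⟨U, hU, hUν⟩ := mapClusterPt_iff_ultrafilter.1 hν
      have hφc := ProbabilityMeasure.continuous_integral_bcf φ
      have l1 := ((hφc.tendsto ν).comp hUν).sub ((hφc.tendsto (c r)).comp ((hcr r).mono_left hU))
      have l2 : Tendsto (fun n => C * (|t - r| + h (u n))) U (𝓝 (C * (|t - r| + 0))) :=
        ((tendsto_const_nhds.add hhu).const_mul C).mono_left hU
      rw [add_zero] at l2
      exact le_of_tendsto_of_tendsto l1.abs l2 (Eventually.of_forall fun n => hC (u n) r t)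
    refine ⟨μ, (hYc t).tendsto_nhds_of_unique_mapClusterPt
      (Eventually.of_forall fun n => hY t (u n) t le_rfl) fun ν _ hν => hT ν μ fun φ hφ => ?_⟩
    have hμ' : MapClusterPt μ atTop (fun n => p (u n) t) :=
      MapClusterPt.of_comp hw.tendsto_atTop hμ.mapClusterPt
    obtain ⟨C, hC⟩ := hclose φ hφ
    rw [← sub_eq_zero, ← abs_eq_zero]
    refine le_antisymm (le_of_forall_pos_lt_add fun ε hε => ?_) (abs_nonneg _)
    obtain ⟨r, hr1, hr2⟩ := exists_rat_btwn (show t < t + ε / (2 * (|C| + 1)) by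
      have : 0 < ε / (2 * (|C| + 1)) := by positivity
      linarith)
    have b1 := hC ν hν r
    have b2 := hC μ hμ' r
    have b3 : C * |t - r| ≤ |C| * (ε / (2 * (|C| + 1))) := by
      calc C * |t - r| ≤ |C| * |t - r| := by gcongr; exact le_abs_self C
        _ ≤ _ := by
          gcongr
          rw [abs_le]
          constructor <;> linarith
    have b4 : |C| * (ε / (2 * (|C| + 1))) < ε / 2 := by
      rw [mul_div_assoc', div_lt_div_iff₀ (by positivity) (by positivity)]
      nlinarith [abs_nonneg C]
    have b5 := abs_sub_le (∫ x, φ x ∂(ν : Measure X)) (∫ x, φ x ∂(c r : Measure X))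
      (∫ x, φ x ∂(μ : Measure X))
    rw [abs_sub_comm (∫ x, φ x ∂(c r : Measure X))] at b5
    linarith
  choose q hq using hlim
  refine ⟨u, q, hu, continuous_iff_continuousAt.2 fun t => ?_, hq⟩
  have hqY : ∀ᶠ s in 𝓝 t, q s ∈ Y (t + 1) := by
    filter_upwards [eventually_lt_nhds (show t < t + 1 by linarith)] with s hs
    exact (hYc (t + 1)).isClosed.mem_of_tendsto (hq s)
      (Eventually.of_forall fun n => hY (t + 1) (u n) s hs.le)
  refine tendsto_of_forall_test hT (hYc (t + 1)) hqY fun φ hφ => ?_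
  obtain ⟨C, hC⟩ := heq φ hφ
  have hφc := ProbabilityMeasure.continuous_integral_bcf φ
  have hlip : ∀ s, |∫ x, φ x ∂(q s : Measure X) - ∫ x, φ x ∂(q t : Measure X)| ≤ C * |s - t| := by
    intro s
    have l1 := ((hφc.tendsto (q s)).comp (hq s)).sub ((hφc.tendsto (q t)).comp (hq t))
    have l2 : Tendsto (fun n => C * (|s - t| + h (u n))) atTop (𝓝 (C * (|s - t| + 0))) :=
      (tendsto_const_nhds.add hhu).const_mul C
    rw [add_zero] at l2
    exact le_of_tendsto_of_tendsto' l1.abs l2 fun n => hC (u n) t s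
  rw [tendsto_iff_dist_tendsto_zero]
  refine squeeze_zero (fun _ => dist_nonneg) (fun s => hlip s) ?_
  have : Continuous fun s : ℝ => C * |s - t| := by fun_prop
  simpa using this.tendsto t

end Compactness

/-! ### Piecewise constant interpolation in time -/

section DiscreteTime

open Filter Topology

variable {f w : ℕ → ℝ} {h c : ℝ}

lemma abs_sub_le_of_step (hf : ∀ j, f (j + 1) = f j + h * w j) (hw : ∀ j, |w j| ≤ c)
    (hh : 0 ≤ h) {i j : ℕ} (hij : i ≤ j) : |f j - f i| ≤ c * h * ((j : ℝ) - i) := by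
  induction j, hij using Nat.le_induction with
  | base => simp
  | succ j hij ih =>
    have h1 : |h * w j| ≤ c * h := by
      rw [abs_mul, abs_of_nonneg hh, mul_comm]
      exact mul_le_mul_of_nonneg_right (hw j) hh
    calc |f (j + 1) - f i| = |(f j - f i) + h * w j| := by rw [hf]; ring_nf
      _ ≤ |f j - f i| + |h * w j| := abs_add_le _ _
      _ ≤ c * h * ((j : ℝ) - i) + c * h := add_le_add ih h1
      _ = _ := by push_cast; ring

/-- For `s ≤ t` the number of steps in between is at most `(t - s) / h + 1`; the extra step is the
term `h`. Natural floors vanish on nonpositive reals, so negative times are allowed. -/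
lemma abs_floor_sub_floor_le (hf : ∀ j, f (j + 1) = f j + h * w j) (hw : ∀ j, |w j| ≤ c)
    (hh : 0 < h) (s t : ℝ) : |f ⌊t / h⌋₊ - f ⌊s / h⌋₊| ≤ c * (|t - s| + h) := by
  have hc : 0 ≤ c := (abs_nonneg _).trans (hw 0)
  have key : ∀ s t : ℝ, s ≤ t → |f ⌊t / h⌋₊ - f ⌊s / h⌋₊| ≤ c * (|t - s| + h) := by
    intro s t hst
    have hle : ⌊s / h⌋₊ ≤ ⌊t / h⌋₊ := Nat.floor_mono (by gcongr)
    refine (abs_sub_le_of_step hf hw hh.le hle).trans ?_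
    rw [mul_assoc]
    refine mul_le_mul_of_nonneg_left ?_ hc
    rw [abs_of_nonneg (by linarith)]
    rcases le_total 0 (t / h) with ht | ht
    · have h1 := Nat.floor_le ht
      have h2 := Nat.lt_floor_add_one (s / h)
      calc h * ((⌊t / h⌋₊ : ℝ) - ⌊s / h⌋₊) ≤ h * (t / h - s / h + 1) := by
            gcongr
            linarith
        _ = _ := by field_simp
    · rw [Nat.floor_of_nonpos ht]
      have h2 : h * (((0 : ℕ) : ℝ) - ⌊s / h⌋₊) ≤ 0 :=
        mul_nonpos_of_nonneg_of_nonpos hh.le (by simp)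
      linarith
  rcases le_total s t with hst | hst
  · exact key s t hst
  · rw [abs_sub_comm, abs_sub_comm t]
    exact key t s hst

lemma intervalIntegrable_floor (hw : ∀ j, |w j| ≤ c) (a b : ℝ) :
    IntervalIntegrable (fun s => w ⌊s / h⌋₊) volume a b := by
  have hm : Measurable fun s : ℝ => w ⌊s / h⌋₊ :=
    (measurable_of_countable w).comp (Nat.measurable_floor.comp (measurable_id.div_const h))
  refine (intervalIntegrable_const (c := c)).mono_fun' hm.aestronglyMeasurable
    (Eventually.of_forall fun s => hw _)

lemma integral_floor_mul (hf : ∀ j, f (j + 1) = f j + h * w j) (hw : ∀ j, |w j| ≤ c)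
    (hh : 0 < h) (j : ℕ) : ∫ s in (0 : ℝ)..(j * h), w ⌊s / h⌋₊ = f j - f 0 := by
  induction j with
  | zero => simp
  | succ j ih =>
    have h1 : ∫ s in (j * h)..((j + 1 : ℕ) * h), w ⌊s / h⌋₊ = h * w j := by
      have hle : j * h ≤ (j + 1 : ℕ) * h := by gcongr; simp
      rw [intervalIntegral.integral_of_le hle, integral_Ioc_eq_integral_Ioo,
        setIntegral_congr_fun (g := fun _ => w j) measurableSet_Ioo]
      · simp only [integral_const, MeasurableSet.univ, measureReal_restrict_apply, univ_inter,
          Real.volume_real_Ioo_of_le hle, smul_eq_mul]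
        push_cast
        ring
      · intro s hs
        have : ⌊s / h⌋₊ = j := by
          rw [Nat.floor_eq_iff (div_nonneg (le_trans (by positivity) hs.1.le) hh.le),
            le_div_iff₀ hh, div_lt_iff₀ hh]
          exact ⟨hs.1.le, by simpa using hs.2⟩
        simp only [this]
    rw [← intervalIntegral.integral_add_adjacent_intervals (b := j * h)
      (intervalIntegrable_floor hw _ _) (intervalIntegrable_floor hw _ _), ih, h1, hf]
    ring

/-- Up to the last grid point the integral telescopes exactly; what remains is an interval shorter
than `h`. -/
lemma abs_sub_integral_floor_le (hf : ∀ j, f (j + 1) = f j + h * w j) (hw : ∀ j, |w j| ≤ c)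
    (hh : 0 < h) {t : ℝ} (ht : 0 ≤ t) :
    |f ⌊t / h⌋₊ - f 0 - ∫ s in (0 : ℝ)..t, w ⌊s / h⌋₊| ≤ c * h := by
  have hc : 0 ≤ c := (abs_nonneg _).trans (hw 0)
  rw [← integral_floor_mul hf hw hh, abs_sub_comm,
    intervalIntegral.integral_interval_sub_left (intervalIntegrable_floor hw _ _)
      (intervalIntegrable_floor hw _ _)]
  refine (intervalIntegral.norm_integral_le_of_norm_le_const (C := c)
    fun s _ => (Real.norm_eq_abs _).trans_le (hw _)).trans ?_
  refine mul_le_mul_of_nonneg_left ?_ hc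
  have h1 : (⌊t / h⌋₊ : ℝ) * h ≤ t := by
    rw [← le_div_iff₀ hh]
    exact Nat.floor_le (by positivity)
  have h2 : t < (⌊t / h⌋₊ + 1 : ℝ) * h := by
    rw [← div_lt_iff₀ hh]
    exact Nat.lt_floor_add_one _
  rw [abs_of_nonneg (by linarith)]
  linarith

/-- Discrete Grönwall inequality, by `1 + hC ≤ e^{hC}`. -/
lemma floor_le_exp_mul {C : ℝ} (hC : 0 ≤ C) (hh : 0 < h) (hf0 : 0 ≤ f 0)
    (hf : ∀ j, f (j + 1) ≤ (1 + h * C) * f j) {t : ℝ} (ht : 0 ≤ t) :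
    f ⌊t / h⌋₊ ≤ Real.exp (C * t) * f 0 := by
  have h1 : ∀ j : ℕ, f j ≤ Real.exp (C * (j * h)) * f 0 := by
    intro j
    induction j with
    | zero => simp
    | succ j ih =>
      calc f (j + 1) ≤ (1 + h * C) * f j := hf j
        _ ≤ (1 + h * C) * (Real.exp (C * (j * h)) * f 0) := by gcongr
        _ ≤ Real.exp (h * C) * (Real.exp (C * (j * h)) * f 0) := by
            have := Real.add_one_le_exp (h * C)
            gcongr
            linarith
        _ = _ := by
            rw [← mul_assoc, ← Real.exp_add]
            push_cast
            ring_nf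
  refine (h1 _).trans ?_
  gcongr
  rw [← le_div_iff₀ hh]
  exact Nat.floor_le (by positivity)

end DiscreteTime

/-! ### Test functions separate probability measures -/

section Separation

open Filter Topology

/-- A smooth approximation of the indicator function of `[0, a]`, as a function of `k²`. -/
noncomputable def smoothIndicator (a : ℝ) (n : ℕ) (k : ℝ) : ℝ :=
  Real.smoothTransition (1 - n * (k ^ 2 - a ^ 2))

lemma contDiff_smoothIndicator (a : ℝ) (n : ℕ) : ContDiff ℝ 1 (smoothIndicator a n) := by
  have h : ContDiff ℝ 1 Real.smoothTransition := Real.smoothTransition.contDiff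
  exact h.comp (by fun_prop)

lemma abs_smoothIndicator_le (a : ℝ) (n : ℕ) (k : ℝ) : |smoothIndicator a n k| ≤ 1 := by
  rw [smoothIndicator, abs_of_nonneg (Real.smoothTransition.nonneg _)]
  exact Real.smoothTransition.le_one _

lemma hasCompactSupport_smoothIndicator (a : ℝ) (n : ℕ) :
    HasCompactSupport (smoothIndicator a (n + 1)) := by
  refine HasCompactSupport.of_support_subset_isCompact
    (isCompact_Icc (a := -(|a| + 1)) (b := |a| + 1)) fun k hk => ?_
  by_contra hmem
  refine hk (Real.smoothTransition.zero_of_nonpos ?_)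
  have h1 : |a| + 1 < |k| := by
    by_contra! hle
    exact hmem (abs_le.1 hle)
  have h2 : a ^ 2 + 1 ≤ k ^ 2 := by
    rw [← sq_abs a, ← sq_abs k]
    nlinarith [abs_nonneg a]
  have h3 : (1 : ℝ) ≤ (n + 1 : ℕ) := by simp
  nlinarith

/-- Dependence on `k²` makes the derivative vanish at `0`. The index `n + 1` excludes `0`, for which
the function would be constant without compact support. -/
lemma isTestFunction_smoothIndicator (a : ℝ) (n : ℕ) :
    IsTestFunction (smoothIndicator a (n + 1)) := by
  have hd := contDiff_smoothIndicator a (n + 1)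
  have hder : ∀ x ∈ Ici (0 : ℝ), derivWithin (smoothIndicator a (n + 1)) (Ici 0) x =
      deriv (smoothIndicator a (n + 1)) x := fun x hx =>
    (hd.differentiable (by norm_num) x).derivWithin (uniqueDiffOn_Ici 0 x hx)
  refine ⟨hd.contDiffOn, ⟨1, fun k _ => abs_smoothIndicator_le _ _ _⟩, ?_, ?_⟩
  · obtain ⟨M, hM⟩ := (hasCompactSupport_smoothIndicator a n).deriv.exists_bound_of_continuous
      (hd.continuous_deriv (by norm_num))
    exact ⟨M, fun k hk => by rw [hder k hk]; exact hM k⟩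
  · rw [hder 0 self_mem_Ici]
    have h1 : HasDerivAt (fun k : ℝ => 1 - ((n + 1 : ℕ) : ℝ) * (k ^ 2 - a ^ 2)) 0 0 := by
      have := (((hasDerivAt_id (0 : ℝ)).pow 2).sub_const (a ^ 2)).const_mul ((n + 1 : ℕ) : ℝ)
      simpa using this.const_sub 1
    have h2 : DifferentiableAt ℝ Real.smoothTransition
        (1 - ((n + 1 : ℕ) : ℝ) * ((0 : ℝ) ^ 2 - a ^ 2)) :=
      (Real.smoothTransition.contDiff (n := 1)).differentiable (by norm_num) _
    have h3 := HasDerivAt.comp (0 : ℝ) h2.hasDerivAt h1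
    rw [mul_zero] at h3
    exact h3.deriv

lemma tendsto_smoothIndicator {a : ℝ} (ha : 0 ≤ a) {k : ℝ} (hk : 0 ≤ k) :
    Tendsto (fun n : ℕ => smoothIndicator a (n + 1) k) atTop
      (𝓝 ((Iic a).indicator (fun _ => 1) k)) := by
  by_cases hka : k ≤ a
  · rw [indicator_of_mem (by exact hka)]
    refine tendsto_const_nhds.congr fun n => (Real.smoothTransition.one_of_one_le ?_).symm
    have : k ^ 2 ≤ a ^ 2 := by gcongr
    have : (0 : ℝ) ≤ (n + 1 : ℕ) * (a ^ 2 - k ^ 2) :=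
      mul_nonneg (Nat.cast_nonneg _) (by linarith)
    linarith
  · rw [indicator_of_notMem (by exact hka)]
    push Not at hka
    have hpos : 0 < k ^ 2 - a ^ 2 := by nlinarith
    obtain ⟨N, hN⟩ := exists_nat_gt (1 / (k ^ 2 - a ^ 2))
    refine tendsto_const_nhds.congr' ?_
    filter_upwards [eventually_ge_atTop N] with n hn
    refine (Real.smoothTransition.zero_of_nonpos ?_).symm
    rw [div_lt_iff₀ hpos] at hN
    have : (N : ℝ) ≤ (n + 1 : ℕ) := by exact_mod_cast hn.trans (Nat.le_succ n)
    nlinarith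

/-- Test functions, as bounded continuous functions on `[0, ∞)`. -/
def testFunctions : Set (BoundedContinuousFunction ℝ≥0 ℝ) :=
  {f | ∃ φ : ℝ → ℝ, IsTestFunction φ ∧ ∀ k : ℝ≥0, f k = φ k}

lemma IsTestFunction.exists_mem_testFunctions {φ : ℝ → ℝ} (hφ : IsTestFunction φ) :
    ∃ f ∈ testFunctions, ∀ k : ℝ≥0, f k = φ k := by
  obtain ⟨M, -, hM⟩ := hφ.exists_bound
  exact ⟨BoundedContinuousFunction.ofNormedAddCommGroup (fun k : ℝ≥0 => φ k) hφ.continuous_coe M hM,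
    ⟨φ, hφ, fun _ => rfl⟩, fun _ => rfl⟩

/-- Smooth indicators converge boundedly to that of `[0, a]`, so test functions determine
distribution functions in spite of the constraint at `0`. -/
lemma testFunctions_separate (μ ν : ProbabilityMeasure ℝ≥0)
    (h : ∀ f ∈ testFunctions, ∫ k, f k ∂(μ : Measure ℝ≥0) = ∫ k, f k ∂(ν : Measure ℝ≥0)) :
    μ = ν := by
  have hlim : ∀ (ρ : ProbabilityMeasure ℝ≥0) (a : ℝ≥0),
      Tendsto (fun n : ℕ => ∫ k : ℝ≥0, smoothIndicator a (n + 1) k ∂(ρ : Measure ℝ≥0)) atTop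
        (𝓝 ((ρ : Measure ℝ≥0).real (Iic a))) := by
    intro ρ a
    have h1 : (ρ : Measure ℝ≥0).real (Iic a) =
        ∫ k : ℝ≥0, (Iic (a : ℝ)).indicator (fun _ => (1 : ℝ)) k ∂(ρ : Measure ℝ≥0) := by
      rw [← integral_indicator_one measurableSet_Iic]
      refine integral_congr_ae (Eventually.of_forall fun k => ?_)
      simp [indicator_apply]
    rw [h1]
    refine tendsto_integral_of_dominated_convergence (fun _ => 1) (fun n => ?_)
      (integrable_const 1) (fun n => Eventually.of_forall fun k => abs_smoothIndicator_le _ _ _)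
      (Eventually.of_forall fun k => tendsto_smoothIndicator a.2 k.2)
    exact (isTestFunction_smoothIndicator a n).continuous_coe.aestronglyMeasurable
  have hμν : (μ : Measure ℝ≥0) = ν := Measure.ext_of_Iic _ _ fun a => ?_
  · exact Subtype.ext hμν
  have h2 : (μ : Measure ℝ≥0).real (Iic a) = (ν : Measure ℝ≥0).real (Iic a) := by
    refine tendsto_nhds_unique (hlim μ a) ((hlim ν a).congr fun n => ?_)
    obtain ⟨f, hf, hfe⟩ := (isTestFunction_smoothIndicator a n).exists_mem_testFunctions
    simp_rw [← hfe]
    exact (h f hf).symm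
  exact (measureReal_eq_measureReal_iff).1 h2

end Separation

/-! ### The restricted dynamics: moments, consistency, uniform bounds -/

section CutRates

open Filter Topology

variable {β m θ δ : ℝ} {Φ : ℝ≥0 × ℝ≥0 → ℝ} {φ : ℝ → ℝ}

/-- Restriction of a rate to the momenta that are at least `r`. -/
noncomputable def cutRate (r : ℝ≥0) (A : ℝ≥0 × ℝ≥0 → ℝ) : ℝ≥0 × ℝ≥0 → ℝ :=
  (Ici r ×ˢ Ici r).indicator A

lemma measurable_cutRate (r : ℝ≥0) {A : ℝ≥0 × ℝ≥0 → ℝ} (hA : Measurable A) :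
    Measurable (cutRate r A) :=
  hA.indicator (measurableSet_Ici.prod measurableSet_Ici)

lemma cutRate_mul (r : ℝ≥0) (A f : ℝ≥0 × ℝ≥0 → ℝ) (z : ℝ≥0 × ℝ≥0) :
    cutRate r A z * f z = cutRate r (fun z => A z * f z) z :=
  (indicator_mul_left _ A f).symm

lemma cutRate_nonneg (r : ℝ≥0) {A : ℝ≥0 × ℝ≥0 → ℝ} (hA : ∀ z, 0 ≤ A z) (z : ℝ≥0 × ℝ≥0) :
    0 ≤ cutRate r A z :=
  indicator_nonneg (fun z _ => hA z) z

lemma cutRate_swap (r : ℝ≥0) {A : ℝ≥0 × ℝ≥0 → ℝ} (hA : ∀ x y, A (y, x) = -A (x, y))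
    (x y : ℝ≥0) : cutRate r A (y, x) = -cutRate r A (x, y) := by
  by_cases h : (x, y) ∈ Ici r ×ˢ Ici r
  · rw [cutRate, indicator_of_mem h, indicator_of_mem (mk_mem_prod h.2 h.1), hA]
  · have h' : (y, x) ∉ Ici r ×ˢ Ici r := fun h' => h (mk_mem_prod h'.2 h'.1)
    rw [cutRate, indicator_of_notMem h, indicator_of_notMem h', neg_zero]

/-- The bound `|k - k'| ≤ k + k'` leaves `1 / (kk')`. This constant blows up as `r → 0`, but it only
limits the time step. -/
lemma abs_cutRate_exchangeRate_le (hβ : 0 < β) (hm : 0 < m) (h0 : 0 < θ) (h1 : θ < 1)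
    (hδ : 0 < δ) (hΦ : IsCutoff θ δ Φ) {r : ℝ≥0} (hr : 0 < r) (z : ℝ≥0 × ℝ≥0) :
    |cutRate r (exchangeRate β m Φ) z| ≤ kernelConst β m * β / (r : ℝ) ^ 2 := by
  have hK := kernelConst_pos hβ m
  have hr' : (0 : ℝ) < r := by exact_mod_cast hr
  by_cases hz : z ∈ Ici r ×ˢ Ici r
  · have z1 : (r : ℝ) ≤ z.1 := by exact_mod_cast hz.1
    have z2 : (r : ℝ) ≤ z.2 := by exact_mod_cast hz.2
    have hz1 : (0 : ℝ) < z.1 := by linarith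
    have hz2 : (0 : ℝ) < z.2 := by linarith
    rw [cutRate, indicator_of_mem hz]
    refine (abs_exchangeRate_le hβ hm h0 h1 hδ hΦ z).trans ?_
    have hs : |(z.1 : ℝ) - z.2| ≤ z.1 + z.2 := by
      rw [abs_le]
      constructor <;> linarith
    calc _ ≤ kernelConst β m * β * (z.1 + z.2) / ((z.1 : ℝ) * z.2 * ((z.1 : ℝ) + z.2)) := by
          gcongr
      _ = kernelConst β m * β / ((z.1 : ℝ) * z.2) := by field_simp
      _ ≤ _ := by
          rw [sq]
          gcongr
  · rw [cutRate, indicator_of_notMem hz, abs_zero]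
    positivity

lemma lintegral_cutRate_gainRate_le (hβ : 0 < β) (hm : 0 < m) (h0 : 0 < θ) (h1 : θ < 1)
    (hδ : 0 < δ) (hΦ : IsCutoff θ δ Φ) (r k' : ℝ≥0) :
    ∫⁻ k, ENNReal.ofReal (cutRate r (gainRate β m Φ) (k, k')) ∂lebesgueHalfLine ≤
      ENNReal.ofReal (kernelConst β m / θ) := by
  refine le_trans (lintegral_mono fun k => ENNReal.ofReal_le_ofReal ?_)
    (lintegral_gainRate_le hβ hm h0 h1 hδ hΦ k')
  exact indicator_le_self' (fun z _ => gainRate_nonneg hΦ z) _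

/-- The functions `e^{η min(k, N)}`, to which the moment estimates are applied. -/
noncomputable def truncExp (η N : ℝ) (k : ℝ≥0) : ℝ := Real.exp (η * min (k : ℝ) N)

lemma continuous_truncExp (η N : ℝ) : Continuous (truncExp η N) := by
  unfold truncExp
  fun_prop

lemma abs_truncExp_le {η : ℝ} (hη : 0 ≤ η) (N : ℝ) (k : ℝ≥0) :
    |truncExp η N k| ≤ Real.exp (η * N) := by
  rw [truncExp, abs_of_nonneg (Real.exp_nonneg _), Real.exp_le_exp]
  exact mul_le_mul_of_nonneg_left (min_le_right _ _) hη

lemma truncExp_mono {η : ℝ} (hη : 0 ≤ η) (N : ℝ) : Monotone (truncExp η N) := by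
  intro k k' h
  have : (k : ℝ) ≤ k' := by exact_mod_cast h
  unfold truncExp
  gcongr

/-- Combines `φ(k) ≤ φ(k') e^{η(k - k')}`, which survives truncation at `N`, with `e^x - 1 ≤ x e^x`.
-/
lemma truncExp_sub_le {η : ℝ} (hη : 0 ≤ η) (N : ℝ) {k k' : ℝ≥0} (h : k' ≤ k) :
    truncExp η N k - truncExp η N k' ≤
      truncExp η N k' * (η * ((k : ℝ) - k') * Real.exp (η * ((k : ℝ) - k'))) := by
  have hkk : (k' : ℝ) ≤ k := by exact_mod_cast h
  have hx : 0 ≤ η * ((k : ℝ) - k') := mul_nonneg hη (by linarith)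
  have h1 : truncExp η N k ≤ truncExp η N k' * Real.exp (η * ((k : ℝ) - k')) := by
    rw [truncExp, truncExp, ← Real.exp_add, Real.exp_le_exp, ← mul_add]
    refine mul_le_mul_of_nonneg_left ?_ hη
    rcases le_total (k' : ℝ) N with h | h
    · rw [min_eq_left h]
      linarith [min_le_left (k : ℝ) N]
    · rw [min_eq_right h]
      linarith [min_le_right (k : ℝ) N]
  have h2 : Real.exp (η * ((k : ℝ) - k')) - 1 ≤
      η * ((k : ℝ) - k') * Real.exp (η * ((k : ℝ) - k')) := by
    have h3 := Real.add_one_le_exp (-(η * ((k : ℝ) - k')))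
    have h4 := mul_le_mul_of_nonneg_right h3 (Real.exp_nonneg (η * ((k : ℝ) - k')))
    rw [← Real.exp_add, neg_add_cancel, Real.exp_zero] at h4
    linarith
  have hpos : 0 < truncExp η N k' := Real.exp_pos _
  nlinarith

/-- From `e^x ≥ 1 + x + x²/2 ≥ 2x`. -/
lemma mul_exp_neg_le {ε s : ℝ} (hε : 0 < ε) (hs : 0 ≤ s) :
    s * Real.exp (-(ε * s)) ≤ 1 / (2 * ε) := by
  have h1 := Real.quadratic_le_exp_of_nonneg (mul_nonneg hε.le hs)
  rw [Real.exp_neg, ← div_eq_mul_inv, div_le_div_iff₀ (Real.exp_pos _) (by positivity)]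
  nlinarith [sq_nonneg (ε * s - 1)]

/-- Upward jumps increase an exponential moment at most at the rate `expRate`. -/
lemma integral_cutRate_truncExp_le (hβ : 0 < β) (hm : 0 < m) (h0 : 0 < θ) (h1 : θ < 1)
    (hδ : 0 < δ) (hΦ : IsCutoff θ δ Φ) {C : ℝ} (hC : 0 < C)
    (hB : ∀ k k' : ℝ, 0 < k' → k' ≤ k →
      comptonKernel β m k k' * Real.exp (-β * k) ≤ C * Real.exp (-((k - k') / 2)) / (k + k'))
    {η : ℝ} (hη : 0 < η) (hη2 : η < 1 / 2) (N : ℝ) (r k' : ℝ≥0) :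
    ∫ k, cutRate r (gainRate β m Φ) (k, k') * (truncExp η N k - truncExp η N k')
      ∂lebesgueHalfLine ≤ expRate C θ η * truncExp η N k' := by
  have hφpos : 0 < truncExp η N k' := Real.exp_pos _
  have hε : 0 < 1 / 2 - η := by linarith
  have hθ1 : 0 < 1 - θ := by linarith
  rcases eq_or_ne k' 0 with hk0 | hk0
  · have : ∀ k : ℝ≥0, cutRate r (gainRate β m Φ) (k, k') = 0 := fun k => by
      rw [cutRate, indicator_apply_eq_zero]
      intro _
      rw [gainRate, truncKernel_eq_zero (Or.inr (Or.inl hk0)), zero_mul]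
    simp only [this, zero_mul, integral_zero, expRate]
    positivity
  have hk' : (0 : ℝ) < k' := by exact_mod_cast pos_iff_ne_zero.2 hk0
  -- With `s = k - k'`: the rate is at most `C e^{-s/2} / ((1 + θ) k')` since `(1 + θ) k ≤ k + k'`,
  -- the increment at most `φ(k') η s e^{ηs}`, and `s e^{-(1/2 - η)s} ≤ 1 / (2(1/2 - η))`.
  set c : ℝ := C * truncExp η N k' * η / ((1 + θ) * k') * (1 / (2 * (1 / 2 - η))) with hc
  have hcpos : 0 < c := by positivity
  set b : ℝ≥0 := k' / θ.toNNReal with hb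
  have hbv : (b : ℝ) = k' / θ := by rw [hb, NNReal.coe_div, Real.coe_toNNReal θ h0.le]
  -- Downward jumps contribute nonpositively, and the cone confines upward ones to `(k', k'/θ]`.
  have hpt : ∀ k : ℝ≥0, cutRate r (gainRate β m Φ) (k, k') *
      (truncExp η N k - truncExp η N k') ≤ (Ioc k' b).indicator (fun _ => c) k := by
    intro k
    have hcut0 := cutRate_nonneg r (gainRate_nonneg (β := β) (m := m) hΦ) (k, k')
    rcases le_or_gt k k' with hkk | hkk
    · refine (mul_nonpos_of_nonneg_of_nonpos hcut0
        (sub_nonpos.2 (truncExp_mono hη.le N hkk))).trans ?_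
      exact indicator_nonneg (fun _ _ => hcpos.le) _
    have hkk' : (k' : ℝ) < k := by exact_mod_cast hkk
    have hcutle : cutRate r (gainRate β m Φ) (k, k') ≤ gainRate β m Φ (k, k') :=
      indicator_le_self' (fun z _ => gainRate_nonneg hΦ z) _
    have hdiff : 0 ≤ truncExp η N k - truncExp η N k' :=
      sub_nonneg.2 (truncExp_mono hη.le N hkk.le)
    refine (mul_le_mul_of_nonneg_right hcutle hdiff).trans ?_
    by_cases hT : truncKernel β m Φ (k, k') = 0
    · rw [gainRate, hT, zero_mul, zero_mul]
      exact indicator_nonneg (fun _ _ => hcpos.le) _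
    obtain ⟨hk, -, hcone, -, -⟩ := cone_of_truncKernel_ne_zero h0 h1 hδ hΦ hT
    simp only at hk hcone
    have hmem : k ∈ Ioc k' b := by
      refine ⟨hkk, ?_⟩
      rw [← NNReal.coe_le_coe, hbv, le_div_iff₀ h0, mul_comm]
      exact hcone
    rw [indicator_of_mem hmem]
    have hs : 0 ≤ (k : ℝ) - k' := by linarith
    have hg : gainRate β m Φ (k, k') ≤
        C * Real.exp (-(((k : ℝ) - k') / 2)) / ((1 + θ) * k') := by
      rw [gainRate_eq]
      have e2 : 0 ≤ comptonKernel β m k k' * Real.exp (-β * k) :=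
        mul_nonneg (comptonKernel_nonneg _ _ _ _) (Real.exp_nonneg _)
      calc _ ≤ 1 * (C * Real.exp (-(((k : ℝ) - k') / 2)) / (k + k')) * k / k' := by
            gcongr
            · exact hΦ.le_one _
            · exact hB k k' hk' hkk'.le
        _ = C * Real.exp (-(((k : ℝ) - k') / 2)) / k' * (k / (k + k')) := by ring
        _ ≤ C * Real.exp (-(((k : ℝ) - k') / 2)) / k' * (1 / (1 + θ)) := by
            refine mul_le_mul_of_nonneg_left ?_ (by positivity)
            rw [div_le_div_iff₀ (by positivity) (by positivity)]
            linarith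
        _ = _ := by field_simp
    calc gainRate β m Φ (k, k') * (truncExp η N k - truncExp η N k')
        ≤ C * Real.exp (-(((k : ℝ) - k') / 2)) / ((1 + θ) * k') *
          (truncExp η N k' * (η * ((k : ℝ) - k') * Real.exp (η * ((k : ℝ) - k')))) :=
          mul_le_mul hg (truncExp_sub_le hη.le N hkk.le) hdiff (by positivity)
      _ = C * truncExp η N k' * η / ((1 + θ) * k') *
          (((k : ℝ) - k') * Real.exp (-((1 / 2 - η) * ((k : ℝ) - k')))) := by
          have : Real.exp (-((1 / 2 - η) * ((k : ℝ) - k'))) =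
              Real.exp (-(((k : ℝ) - k') / 2)) * Real.exp (η * ((k : ℝ) - k')) := by
            rw [← Real.exp_add]
            ring_nf
          rw [this]
          ring
      _ ≤ c := by
          rw [hc]
          exact mul_le_mul_of_nonneg_left (mul_exp_neg_le hε hs) (by positivity)
  have hint : Integrable (fun k => cutRate r (gainRate β m Φ) (k, k') *
      (truncExp η N k - truncExp η N k')) lebesgueHalfLine := by
    have hg := measurable_cutRate r (measurable_gainRate hβ hm h0 h1 hδ hΦ)
    have hgk : Measurable fun k : ℝ≥0 => cutRate r (gainRate β m Φ) (k, k') :=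
      hg.comp measurable_prodMk_right
    have hi : Integrable (fun k => cutRate r (gainRate β m Φ) (k, k')) lebesgueHalfLine := by
      refine ⟨hgk.aestronglyMeasurable, ?_⟩
      rw [hasFiniteIntegral_iff_ofReal
        (Eventually.of_forall fun k => cutRate_nonneg r (gainRate_nonneg hΦ) _)]
      exact (lintegral_cutRate_gainRate_le hβ hm h0 h1 hδ hΦ r k').trans_lt ENNReal.ofReal_lt_top
    refine hi.mul_bdd (c := Real.exp (η * N) + Real.exp (η * N))
      ((continuous_truncExp η N).measurable.sub_const _).aestronglyMeasurable
      (Eventually.of_forall fun k => (norm_sub_le _ _).trans ?_)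
    exact add_le_add (abs_truncExp_le hη.le N k) (abs_truncExp_le hη.le N k')
  have hfin : lebesgueHalfLine (Ioc k' b) ≠ ⊤ := by
    rw [lebesgueHalfLine_Ioc]
    exact ENNReal.ofReal_ne_top
  calc _ ≤ ∫ k, (Ioc k' b).indicator (fun _ => c) k ∂lebesgueHalfLine := by
        refine integral_mono hint ?_ hpt
        rw [integrable_indicator_iff measurableSet_Ioc]
        exact integrableOn_const hfin
    _ = ((k' : ℝ) / θ - k') * c := by
        rw [integral_indicator_const _ measurableSet_Ioc, measureReal_def, lebesgueHalfLine_Ioc,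
          ENNReal.toReal_ofReal, hbv, smul_eq_mul]
        rw [hbv, sub_nonneg, le_div_iff₀ h0]
        exact mul_le_of_le_one_right hk'.le h1.le
    _ = C / (2 * θ) * ((1 - θ) / (1 + θ)) * (η / (1 / 2 - η)) * truncExp η N k' := by
        rw [hc]
        generalize hE : (1 / 2 - η) = E at *
        field_simp
    -- The argument yields `1 / θ`, which is weaker than the `1 / θ²` allowed in `expRate`.
    _ ≤ _ := by
        rw [expRate]
        gcongr
        nlinarith

lemma integrable_cutRate_gainRate (hβ : 0 < β) (hm : 0 < m) (h0 : 0 < θ) (h1 : θ < 1)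
    (hδ : 0 < δ) (hΦ : IsCutoff θ δ Φ) (r : ℝ≥0) (p : Measure ℝ≥0) [IsProbabilityMeasure p] :
    Integrable (cutRate r (gainRate β m Φ)) (lebesgueHalfLine.prod p) :=
  integrable_of_lintegral_section_le
    (measurable_cutRate r (measurable_gainRate hβ hm h0 h1 hδ hΦ))
    (cutRate_nonneg r (gainRate_nonneg hΦ)) (lintegral_cutRate_gainRate_le hβ hm h0 h1 hδ hΦ r)

/-- The generator of the truncated dynamics. -/
noncomputable def cutOperator (β m : ℝ) (Φ : ℝ≥0 × ℝ≥0 → ℝ) (M : ℝ) (r : ℝ≥0) (φ : ℝ≥0 → ℝ)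
    (p : Measure ℝ≥0) : ℝ :=
  jumpOperator M (cutRate r (exchangeRate β m Φ)) (cutRate r (gainRate β m Φ))
    lebesgueHalfLine φ p

/-- The factors `e^{-βk} - e^{-βk'}` and `φ(k) - φ(k')` have opposite signs for increasing `φ`, so
the interaction lowers the moment whatever `M` is; only the linear jumps remain. -/
lemma cutOperator_truncExp_le (hβ : 0 < β) (hm : 0 < m) (h0 : 0 < θ) (h1 : θ < 1)
    (hδ : 0 < δ) (hΦ : IsCutoff θ δ Φ) {C : ℝ} (hC : 0 < C)
    (hB : ∀ k k' : ℝ, 0 < k' → k' ≤ k →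
      comptonKernel β m k k' * Real.exp (-β * k) ≤ C * Real.exp (-((k - k') / 2)) / (k + k'))
    {η : ℝ} (hη : 0 < η) (hη2 : η < 1 / 2) (N : ℝ) (r : ℝ≥0) {M : ℝ} (hM : 0 ≤ M)
    (p : Measure ℝ≥0) [IsProbabilityMeasure p] :
    cutOperator β m Φ M r (truncExp η N) p ≤ expRate C θ η * ∫ k, truncExp η N k ∂p := by
  have hφm := (continuous_truncExp η N).measurable
  have hbd : ∀ z : ℝ≥0 × ℝ≥0, |truncExp η N z.1 - truncExp η N z.2| ≤
      Real.exp (η * N) + Real.exp (η * N) := fun z =>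
    (norm_sub_le (truncExp η N z.1) (truncExp η N z.2)).trans
      (add_le_add (abs_truncExp_le hη.le N _) (abs_truncExp_le hη.le N _))
  have hint : Integrable (fun z => cutRate r (gainRate β m Φ) z *
      (truncExp η N z.1 - truncExp η N z.2)) (lebesgueHalfLine.prod p) := integrable_mul_of_bounded
    (integrable_cutRate_gainRate (β := β) hβ hm h0 h1 hδ hΦ r p)
    ((hφm.comp measurable_fst).sub (hφm.comp measurable_snd)) hbd
  have q1 : ∫ z, cutRate r (exchangeRate β m Φ) z * (truncExp η N z.1 - truncExp η N z.2)
      ∂(p.prod p) ≤ 0 := by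
    refine integral_nonpos fun z => ?_
    rw [cutRate_mul r (exchangeRate β m Φ) fun z => truncExp η N z.1 - truncExp η N z.2]
    refine indicator_nonpos (fun z _ => ?_) z
    rw [exchangeRate, mul_assoc]
    refine mul_nonpos_of_nonneg_of_nonpos (truncKernel_nonneg hΦ z) ?_
    rcases le_total z.1 z.2 with h | h
    · have h' : (z.1 : ℝ) ≤ z.2 := by exact_mod_cast h
      refine mul_nonpos_of_nonneg_of_nonpos ?_ (sub_nonpos.2 (truncExp_mono hη.le N h))
      exact sub_nonneg.2 (Real.exp_le_exp.2 (by nlinarith))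
    · have h' : (z.2 : ℝ) ≤ z.1 := by exact_mod_cast h
      refine mul_nonpos_of_nonpos_of_nonneg ?_ (sub_nonneg.2 (truncExp_mono hη.le N h))
      exact sub_nonpos.2 (Real.exp_le_exp.2 (by nlinarith))
  have q2 : ∫ z, cutRate r (gainRate β m Φ) z * (truncExp η N z.1 - truncExp η N z.2)
      ∂(lebesgueHalfLine.prod p) ≤ expRate C θ η * ∫ k, truncExp η N k ∂p := by
    rw [integral_prod_symm _ hint, ← integral_const_mul]
    refine integral_mono hint.integral_prod_right ?_ fun k' => ?_
    · exact (Integrable.of_bound hφm.aestronglyMeasurable _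
        (Eventually.of_forall (abs_truncExp_le hη.le N))).const_mul _
    · exact integral_cutRate_truncExp_le hβ hm h0 h1 hδ hΦ hC hB hη hη2 N r k'
  rw [cutOperator, jumpOperator]
  nlinarith [mul_nonneg hM (neg_nonneg.2 q1)]

/-- The weak collision operator for a measure of mass `M` with profile `p`, divided by `M`. -/
noncomputable def profileOperator (β m : ℝ) (Φ : ℝ≥0 × ℝ≥0 → ℝ) (M : ℝ) (φ : ℝ → ℝ)
    (p : Measure ℝ≥0) : ℝ :=
  M / 2 * ∫ z, quadraticIntegrand β m Φ φ z ∂(p.prod p) + ∫ k', gainPotential β m Φ φ k' ∂p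

/-- The points of the cone that are removed have one coordinate below `r`, hence both at most `r /
θ`. There the slope of `φ` is small, which handles the quadratic part, and jumps are short, which
handles the linear part; neither bound depends on `p`. -/
lemma exists_abs_cutOperator_sub_le (hβ : 0 < β) (hm : 0 < m) (h0 : 0 < θ) (h1 : θ < 1)
    (hδ : 0 < δ) (hΦ : IsCutoff θ δ Φ) (hφ : IsTestFunction φ) {M : ℝ} (hM : 0 ≤ M)
    {ε : ℝ} (hε : 0 < ε) : ∃ r₀ : ℝ, 0 < r₀ ∧ ∀ r : ℝ≥0, (r : ℝ) ≤ r₀ →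
      ∀ (p : Measure ℝ≥0) [IsProbabilityMeasure p],
        |cutOperator β m Φ M r (fun k => φ k) p - profileOperator β m Φ M φ p| ≤ ε := by
  have hK := kernelConst_pos hβ m
  set c := kernelConst β m * β / (θ * δ) with hc
  have hcpos : 0 < c := by positivity
  obtain ⟨L, hL0, hL⟩ := hφ.exists_lipschitz
  -- This slope makes the quadratic error at most `ε/2` after multiplication by `M/2`.
  obtain ⟨s, hs, hslope⟩ := hφ.exists_small_slope (ε := ε / (c * (M + 1))) (by positivity)
  -- The linear error is at most `r d`: slope `L`, jump length `r / θ²`, total rate `K / θ`.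
  set d := L / θ ^ 2 * (kernelConst β m / θ) with hd
  have hd0 : 0 ≤ d := by positivity
  refine ⟨min (θ * s) (ε / (2 * (d + 1))), by positivity, fun r hr p _ => ?_⟩
  have hr1 : (r : ℝ) ≤ θ * s := hr.trans (min_le_left _ _)
  have hr2 : (r : ℝ) ≤ ε / (2 * (d + 1)) := hr.trans (min_le_right _ _)
  have hmul : ∀ (A : ℝ≥0 × ℝ≥0 → ℝ) (z : ℝ≥0 × ℝ≥0), cutRate r A z * (φ z.1 - φ z.2) =
      cutRate r (fun z => A z * (φ z.1 - φ z.2)) z := fun A z =>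
    cutRate_mul r A (fun z => φ z.1 - φ z.2) z
  have hIm : MeasurableSet (Ici r ×ˢ Ici r) := measurableSet_Ici.prod measurableSet_Ici
  have hsmall : ∀ k k' : ℝ≥0, (k, k') ∉ Ici r ×ˢ Ici r → θ * k ≤ k' → θ * k' ≤ k →
      (k : ℝ) ≤ r / θ ∧ (k' : ℝ) ≤ r / θ := by
    intro k k' hz e1 e2
    have hk : (0 : ℝ) ≤ k := k.2
    have hk' : (0 : ℝ) ≤ k' := k'.2
    rw [le_div_iff₀ h0, le_div_iff₀ h0]
    rw [mem_prod, mem_Ici, mem_Ici, not_and_or, not_le, not_le] at hz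
    rcases hz with h | h
    · have h : (k : ℝ) < r := by exact_mod_cast h
      constructor <;> nlinarith
    · have h : (k' : ℝ) < r := by exact_mod_cast h
      constructor <;> nlinarith
  have hq := integrable_quadraticIntegrand hβ hm h0 h1 hδ hΦ hφ p
  have hg := integrable_gainIntegrand hβ hm h0 h1 hδ hΦ hφ p
  have q1 : |∫ z, cutRate r (exchangeRate β m Φ) z * (φ z.1 - φ z.2) ∂(p.prod p) -
      ∫ z, quadraticIntegrand β m Φ φ z ∂(p.prod p)| ≤ c * (ε / (c * (M + 1))) := by
    have hqc : Integrable (cutRate r (quadraticIntegrand β m Φ φ)) (p.prod p) := hq.indicator hIm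
    have e1 : ∫ z, cutRate r (exchangeRate β m Φ) z * (φ z.1 - φ z.2) ∂(p.prod p) =
        ∫ z, cutRate r (quadraticIntegrand β m Φ φ) z ∂(p.prod p) :=
      integral_congr_ae (Eventually.of_forall fun z => hmul _ z)
    rw [e1, ← integral_sub hqc hq, ← Real.norm_eq_abs]
    refine (norm_integral_le_of_norm_le_const (C := c * (ε / (c * (M + 1))))
      (Eventually.of_forall fun z => ?_)).trans_eq (by simp)
    rw [Real.norm_eq_abs]
    by_cases hz : z ∈ Ici r ×ˢ Ici r
    · rw [cutRate, indicator_of_mem hz, sub_self, abs_zero]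
      positivity
    · rw [cutRate, indicator_of_notMem hz, zero_sub, abs_neg]
      refine abs_quadraticIntegrand_le hβ hm h0 h1 hδ hΦ (by positivity) fun hE => ?_
      have hT : truncKernel β m Φ z ≠ 0 := fun h => hE (by rw [exchangeRate, h, zero_mul])
      obtain ⟨-, -, e1, e2, -⟩ := cone_of_truncKernel_ne_zero h0 h1 hδ hΦ hT
      have hrs : (r : ℝ) / θ ≤ s := by rwa [div_le_iff₀ h0, mul_comm]
      obtain ⟨b1, b2⟩ := hsmall z.1 z.2 hz e1 e2
      exact hslope _ _ (b1.trans hrs) (b2.trans hrs)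
  have q2 : |∫ z, cutRate r (gainRate β m Φ) z * (φ z.1 - φ z.2) ∂(lebesgueHalfLine.prod p) -
      ∫ k', gainPotential β m Φ φ k' ∂p| ≤ r * d := by
    have hgc : Integrable (cutRate r (gainIntegrand β m Φ φ)) (lebesgueHalfLine.prod p) :=
      hg.indicator hIm
    have e1 : ∫ z, cutRate r (gainRate β m Φ) z * (φ z.1 - φ z.2) ∂(lebesgueHalfLine.prod p) =
        ∫ k', ∫ k, cutRate r (gainIntegrand β m Φ φ) (k, k') ∂lebesgueHalfLine ∂p := by
      rw [← integral_prod_symm _ hgc]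
      exact integral_congr_ae (Eventually.of_forall fun z => hmul _ z)
    have e2 : Integrable (gainPotential β m Φ φ) p := hg.integral_prod_right
    rw [e1, ← integral_sub hgc.integral_prod_right e2, ← Real.norm_eq_abs]
    have hsec := hg.prod_left_ae
    refine (norm_integral_le_of_norm_le_const (C := r * d) ?_).trans_eq (by simp)
    filter_upwards [hsec] with k' hk'i
    have hmk : Measurable fun k : ℝ≥0 => (k, k') := measurable_prodMk_right
    have hcuti : Integrable (fun k => cutRate r (gainIntegrand β m Φ φ) (k, k'))
        lebesgueHalfLine := hk'i.indicator (hmk hIm)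
    rw [Real.norm_eq_abs, gainPotential, ← integral_sub hcuti hk'i]
    have e3 : ∀ k : ℝ≥0, cutRate r (gainIntegrand β m Φ φ) (k, k') -
        gainIntegrand β m Φ φ (k, k') = gainRate β m Φ (k, k') *
          ((Ici r ×ˢ Ici r).indicator (fun z : ℝ≥0 × ℝ≥0 => φ z.1 - φ z.2) (k, k') -
            (φ k - φ k')) := by
      intro k
      by_cases hz : (k, k') ∈ Ici r ×ˢ Ici r
      · rw [cutRate, indicator_of_mem hz, indicator_of_mem hz]
        ring
      · rw [cutRate, indicator_of_notMem hz, indicator_of_notMem hz, gainIntegrand_eq]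
        ring
    simp_rw [e3]
    have hcc : (0 : ℝ) ≤ L * (r / θ / θ) := by positivity
    refine (abs_integral_gainRate_mul_le hβ hm h0 h1 hδ hΦ hcc fun k a1 a2 => ?_).trans_eq
      (by rw [hd]; field_simp)
    by_cases hz : (k, k') ∈ Ici r ×ˢ Ici r
    · rw [indicator_of_mem hz, sub_self, abs_zero]
      exact hcc
    · rw [indicator_of_notMem hz, zero_sub, abs_neg]
      refine (hL k k').trans (mul_le_mul_of_nonneg_left ?_ hL0)
      refine (abs_sub_le_div h0 h1 a1).trans ?_
      have := (hsmall k k' hz a1 a2).2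
      gcongr
  rw [cutOperator, jumpOperator, profileOperator]
  have t1 : c * (ε / (c * (M + 1))) = ε / (M + 1) := by field_simp
  have t2 : M / 2 * (ε / (M + 1)) ≤ ε / 2 := by
    rw [div_mul_div_comm, div_le_div_iff₀ (by positivity) (by positivity)]
    nlinarith
  have t3 : r * d ≤ ε / 2 := by
    calc r * d ≤ ε / (2 * (d + 1)) * (d + 1) := by gcongr; linarith
      _ = ε / 2 := by field_simp
  rw [t1] at q1
  calc _ = |M / 2 * (∫ z, cutRate r (exchangeRate β m Φ) z * (φ z.1 - φ z.2) ∂(p.prod p) -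
        ∫ z, quadraticIntegrand β m Φ φ z ∂(p.prod p)) +
        (∫ z, cutRate r (gainRate β m Φ) z * (φ z.1 - φ z.2) ∂(lebesgueHalfLine.prod p) -
        ∫ k', gainPotential β m Φ φ k' ∂p)| := by ring_nf
    _ ≤ M / 2 * (ε / (M + 1)) + r * d := by
        refine (abs_add_le _ _).trans (add_le_add ?_ q2)
        rw [abs_mul, abs_of_nonneg (by positivity : 0 ≤ M / 2)]
        gcongr
    _ ≤ ε := by linarith

/-- What is bounded is `A (φ(k) - φ(k'))`, not `A`, so the constant does not depend on `r`. It
serves as the Lipschitz constant in time of the scheme. -/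
lemma exists_bound_cutOperator (hβ : 0 < β) (hm : 0 < m) (h0 : 0 < θ) (h1 : θ < 1)
    (hδ : 0 < δ) (hΦ : IsCutoff θ δ Φ) (hφ : IsTestFunction φ) {M : ℝ} (hM : 0 ≤ M) :
    ∃ c : ℝ, ∀ (r : ℝ≥0) (p : Measure ℝ≥0) [IsProbabilityMeasure p],
      |cutOperator β m Φ M r (fun k => φ k) p| ≤ c := by
  have hK := kernelConst_pos hβ m
  obtain ⟨c, hc0, hc⟩ := exists_bound_quadraticIntegrand hβ hm h0 h1 hδ hΦ hφ
  obtain ⟨B, hB0, hB⟩ := hφ.exists_bound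
  refine ⟨M / 2 * c + 2 * B * (kernelConst β m / θ), fun r p _ => ?_⟩
  have hmul : ∀ (A : ℝ≥0 × ℝ≥0 → ℝ) (z : ℝ≥0 × ℝ≥0), cutRate r A z * (φ z.1 - φ z.2) =
      cutRate r (fun z => A z * (φ z.1 - φ z.2)) z := fun A z =>
    cutRate_mul r A (fun z => φ z.1 - φ z.2) z
  have q1 : |∫ z, cutRate r (exchangeRate β m Φ) z * (φ z.1 - φ z.2) ∂(p.prod p)| ≤ c := by
    rw [← Real.norm_eq_abs]
    refine (norm_integral_le_of_norm_le_const (C := c)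
      (Eventually.of_forall fun z => ?_)).trans_eq (by simp)
    rw [hmul, Real.norm_eq_abs, cutRate]
    by_cases hz : z ∈ Ici r ×ˢ Ici r
    · rw [indicator_of_mem hz]
      exact hc z
    · rwa [indicator_of_notMem hz, abs_zero]
  have q2 : |∫ z, cutRate r (gainRate β m Φ) z * (φ z.1 - φ z.2) ∂(lebesgueHalfLine.prod p)| ≤
      2 * B * (kernelConst β m / θ) := by
    have hgc : Integrable (cutRate r (gainIntegrand β m Φ φ)) (lebesgueHalfLine.prod p) :=
      (integrable_gainIntegrand hβ hm h0 h1 hδ hΦ hφ p).indicator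
        (measurableSet_Ici.prod measurableSet_Ici)
    have e1 : ∫ z, cutRate r (gainRate β m Φ) z * (φ z.1 - φ z.2) ∂(lebesgueHalfLine.prod p) =
        ∫ k', ∫ k, cutRate r (gainIntegrand β m Φ φ) (k, k') ∂lebesgueHalfLine ∂p := by
      rw [← integral_prod_symm _ hgc]
      exact integral_congr_ae (Eventually.of_forall fun z => hmul _ z)
    rw [e1, ← Real.norm_eq_abs]
    refine (norm_integral_le_of_norm_le_const (C := 2 * B * (kernelConst β m / θ))
      (Eventually.of_forall fun k' => ?_)).trans_eq (by simp)
    have e3 : ∀ k : ℝ≥0, cutRate r (gainIntegrand β m Φ φ) (k, k') = gainRate β m Φ (k, k') *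
        (Ici r ×ˢ Ici r).indicator (fun z : ℝ≥0 × ℝ≥0 => φ z.1 - φ z.2) (k, k') := fun k =>
      indicator_mul_right (Ici r ×ˢ Ici r) (gainRate β m Φ) fun z : ℝ≥0 × ℝ≥0 => φ z.1 - φ z.2
    simp_rw [e3]
    refine abs_integral_gainRate_mul_le hβ hm h0 h1 hδ hΦ (by positivity) fun k _ _ => ?_
    by_cases hz : (k, k') ∈ Ici r ×ˢ Ici r
    · rw [indicator_of_mem hz]
      calc |φ k - φ k'| ≤ |φ k| + |φ k'| := abs_sub _ _
        _ ≤ _ := by linarith [hB k, hB k']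
    · rw [indicator_of_notMem hz, abs_zero]
      positivity
  rw [cutOperator, jumpOperator]
  refine (abs_add_le _ _).trans (add_le_add ?_ q2)
  rw [abs_mul, abs_of_nonneg (by positivity : 0 ≤ M / 2)]
  gcongr

lemma continuous_profileOperator (hβ : 0 < β) (hm : 0 < m) (h0 : 0 < θ) (h1 : θ < 1)
    (hδ : 0 < δ) (hΦ : IsCutoff θ δ Φ) (hφ : IsTestFunction φ) (M : ℝ) :
    Continuous fun p : ProbabilityMeasure ℝ≥0 => profileOperator β m Φ M φ p := by
  obtain ⟨c, -, hc⟩ := exists_bound_quadraticIntegrand hβ hm h0 h1 hδ hΦ hφ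
  obtain ⟨d, -, hd⟩ := exists_bound_gainPotential hβ hm h0 h1 hδ hΦ hφ
  have hK := ProbabilityMeasure.continuous_integral_bcf
    (BoundedContinuousFunction.ofNormedAddCommGroup (quadraticIntegrand β m Φ φ)
      (continuous_quadraticIntegrand hβ hm h0 h1 hδ hΦ hφ) c hc)
  have hL := ProbabilityMeasure.continuous_integral_bcf
    (BoundedContinuousFunction.ofNormedAddCommGroup (gainPotential β m Φ φ)
      (continuous_gainPotential hβ hm h0 h1 hδ hΦ hφ) d hd)
  have hprod : Continuous fun p : ProbabilityMeasure ℝ≥0 => p.prod p :=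
    ProbabilityMeasure.continuous_prod.comp (continuous_id.prodMk continuous_id)
  exact ((hK.comp hprod).const_mul (M / 2)).add hL

end CutRates

/-! ### Passage to the limit in the scheme -/

section Existence

open Filter Topology

variable {β m θ δ : ℝ} {Φ : ℝ≥0 × ℝ≥0 → ℝ} {φ : ℝ → ℝ}

lemma exists_scheme (hβ : 0 < β) (hm : 0 < m) (h0 : 0 < θ) (h1 : θ < 1) (hδ : 0 < δ)
    (hΦ : IsCutoff θ δ Φ) {M : ℝ} (hM : 0 ≤ M) {r : ℝ≥0} (hr : 0 < r) {τ : ℝ} (hτ : 0 < τ)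
    (p₀ : ProbabilityMeasure ℝ≥0) :
    ∃ h : ℝ, 0 < h ∧ h ≤ τ ∧ ∃ P : ℕ → ProbabilityMeasure ℝ≥0, P 0 = p₀ ∧
      ∀ (j : ℕ) (f : ℝ≥0 → ℝ), Measurable f → (∃ c, ∀ k, |f k| ≤ c) →
        ∫ k, f k ∂(P (j + 1) : Measure ℝ≥0) =
          ∫ k, f k ∂(P j : Measure ℝ≥0) + h * cutOperator β m Φ M r f (P j) := by
  have hK := kernelConst_pos hβ m
  set a := kernelConst β m * β / (r : ℝ) ^ 2 with ha
  set l := kernelConst β m / θ with hl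
  have ha0 : 0 ≤ a := by positivity
  have hl0 : 0 ≤ l := by positivity
  have hpos : 0 < M * a + l + 1 := by positivity
  -- The `+ 1` keeps the denominator positive; `τ` forces the step to `0` along the scheme.
  set h := min τ (1 / (M * a + l + 1)) with hh
  have hhpos : 0 < h := lt_min hτ (by positivity)
  have hsmall : h * (M * a + l) ≤ 1 := by
    calc h * (M * a + l) ≤ 1 / (M * a + l + 1) * (M * a + l + 1) :=
          mul_le_mul (min_le_right _ _) (by linarith) (by positivity) (by positivity)
      _ = 1 := by field_simp
  have hstep : ∀ p : ProbabilityMeasure ℝ≥0, ∃ q : ProbabilityMeasure ℝ≥0,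
      ∀ f : ℝ≥0 → ℝ, Measurable f → (∃ c, ∀ k, |f k| ≤ c) →
        ∫ k, f k ∂(q : Measure ℝ≥0) =
          ∫ k, f k ∂(p : Measure ℝ≥0) + h * cutOperator β m Φ M r f p := by
    intro p
    obtain ⟨Q, hQ, hQe⟩ := exists_euler_step (ν := lebesgueHalfLine)
      (measurable_cutRate r (measurable_exchangeRate (m := m) hβ hm h0 h1 hδ hΦ))
      (cutRate_swap r (exchangeRate_swap hΦ))
      (abs_cutRate_exchangeRate_le hβ hm h0 h1 hδ hΦ hr)
      (measurable_cutRate r (measurable_gainRate (m := m) hβ hm h0 h1 hδ hΦ))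
      (cutRate_nonneg r (gainRate_nonneg hΦ)) hl0
      (lintegral_cutRate_gainRate_le hβ hm h0 h1 hδ hΦ r) hM hhpos.le hsmall p
    exact ⟨⟨Q, hQ⟩, hQe⟩
  choose S hS using hstep
  exact ⟨h, hhpos, min_le_left _ _, fun j => S^[j] p₀, rfl, fun j f hf hb => by
    simp only [Function.iterate_succ_apply']
    exact hS _ f hf hb⟩

lemma integrable_truncExp {η : ℝ} (hη : 0 ≤ η) (N : ℝ) (p : Measure ℝ≥0) [IsFiniteMeasure p] :
    Integrable (truncExp η N) p :=
  Integrable.of_bound (continuous_truncExp η N).aestronglyMeasurable _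
    (Eventually.of_forall (abs_truncExp_le hη N))

/-- Prokhorov's criterion, with tails outside `[0, N]` that vanish uniformly. -/
lemma isCompact_setOf_tail_le {η : ℝ} (hη : 0 < η) (D : ℝ) :
    IsCompact {μ : ProbabilityMeasure ℝ≥0 |
      ∀ N : ℕ, μ (Icc 0 (N : ℝ≥0))ᶜ ≤ (D * Real.exp (-(η * N))).toNNReal} := by
  refine isCompact_setOfPred_probabilityMeasure_mass_eq_compl_isCompact_le ?_
    (fun N => isCompact_Icc) (Or.inl inferInstance)
  have h1 : Tendsto (fun N : ℕ => Real.exp (-(η * N))) atTop (𝓝 0) :=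
    Real.tendsto_exp_neg_atTop_nhds_zero.comp
      (tendsto_natCast_atTop_atTop.const_mul_atTop hη)
  have h2 := (continuous_real_toNNReal.tendsto _).comp (h1.const_mul D)
  rwa [mul_zero, Real.toNNReal_zero] at h2

/-- Markov's inequality: `truncExp η N` equals `e^{ηN}` beyond `N`. -/
lemma measure_compl_Icc_le {η : ℝ} (hη : 0 ≤ η) {D : ℝ} {μ : ProbabilityMeasure ℝ≥0} {N : ℕ}
    (h : ∫ k, truncExp η N k ∂(μ : Measure ℝ≥0) ≤ D) :
    μ (Icc 0 (N : ℝ≥0))ᶜ ≤ (D * Real.exp (-(η * N))).toNNReal := by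
  have hmeas : MeasurableSet (Icc 0 (N : ℝ≥0))ᶜ := measurableSet_Icc.compl
  have h1 : ∫ k, (Icc 0 (N : ℝ≥0))ᶜ.indicator (fun _ => Real.exp (η * N)) k ∂(μ : Measure ℝ≥0) ≤
      ∫ k, truncExp η N k ∂(μ : Measure ℝ≥0) := by
    refine integral_mono ?_ (integrable_truncExp hη N _) fun k => ?_
    · exact (integrable_const _).indicator hmeas
    · by_cases hk : k ∈ (Icc 0 (N : ℝ≥0))ᶜ
      · rw [indicator_of_mem hk, truncExp, min_eq_right]
        have : ¬ k ≤ (N : ℝ≥0) := fun h => hk ⟨zero_le, h⟩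
        exact_mod_cast (not_le.1 this).le
      · rw [indicator_of_notMem hk]
        exact Real.exp_nonneg _
  rw [integral_indicator_const _ hmeas, smul_eq_mul] at h1
  have h2 : (μ : Measure ℝ≥0).real (Icc 0 (N : ℝ≥0))ᶜ ≤ D * Real.exp (-(η * N)) := by
    rw [Real.exp_neg, ← div_eq_mul_inv, le_div_iff₀ (Real.exp_pos _)]
    exact h1.trans h
  exact NNReal.le_toNNReal_of_coe_le h2

lemma expRate_nonneg {C η : ℝ} (hC : 0 ≤ C) (h0 : 0 < θ) (h1 : θ < 1) (hη : 0 ≤ η)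
    (hη2 : η < 1 / 2) : 0 ≤ expRate C θ η := by
  have : 0 ≤ 1 - θ := by linarith
  have : 0 ≤ 1 / 2 - η := by linarith
  unfold expRate
  positivity

lemma integral_truncExp_le_toReal {η : ℝ} {p : Measure ℝ≥0}
    (hX : ∫⁻ k : ℝ≥0, ENNReal.ofReal (Real.exp (η * k)) ∂p < ⊤) (hη : 0 ≤ η) (N : ℝ) :
    ∫ k, truncExp η N k ∂p ≤ (∫⁻ k : ℝ≥0, ENNReal.ofReal (Real.exp (η * k)) ∂p).toReal := by
  have hpos : ∀ k, 0 ≤ truncExp η N k := fun k => Real.exp_nonneg _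
  rw [integral_eq_lintegral_of_nonneg_ae (Eventually.of_forall hpos)
    (continuous_truncExp η N).aestronglyMeasurable]
  refine ENNReal.toReal_mono hX.ne (lintegral_mono fun k => ENNReal.ofReal_le_ofReal ?_)
  exact Real.exp_le_exp.2 (mul_le_mul_of_nonneg_left (min_le_left _ _) hη)

/-- Monotone convergence as `N → ∞`. -/
lemma lintegral_exp_le_of_truncExp_le {η : ℝ} (hη : 0 ≤ η) {p : Measure ℝ≥0} [IsFiniteMeasure p]
    {D : ℝ} (h : ∀ N : ℕ, ∫ k, truncExp η N k ∂p ≤ D) :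
    ∫⁻ k : ℝ≥0, ENNReal.ofReal (Real.exp (η * k)) ∂p ≤ ENNReal.ofReal D := by
  have hlim : Tendsto (fun N : ℕ => ∫⁻ k, ENNReal.ofReal (truncExp η N k) ∂p) atTop
      (𝓝 (∫⁻ k : ℝ≥0, ENNReal.ofReal (Real.exp (η * k)) ∂p)) := by
    refine lintegral_tendsto_of_tendsto_of_monotone
      (fun N => (continuous_truncExp η N).measurable.ennreal_ofReal.aemeasurable)
      (Eventually.of_forall fun k N N' hN => ENNReal.ofReal_le_ofReal ?_)
      (Eventually.of_forall fun k => ?_)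
    · have : (N : ℝ) ≤ N' := by exact_mod_cast hN
      unfold truncExp
      gcongr
    · refine tendsto_const_nhds.congr' ?_
      obtain ⟨N₀, hN₀⟩ := exists_nat_ge (k : ℝ)
      filter_upwards [eventually_ge_atTop N₀] with N hN
      have : (N₀ : ℝ) ≤ N := by exact_mod_cast hN
      rw [truncExp, min_eq_left (hN₀.trans this)]
  refine le_of_tendsto' hlim fun N => ?_
  rw [← ofReal_integral_eq_lintegral_ofReal (integrable_truncExp hη N p)
    (Eventually.of_forall fun k => Real.exp_nonneg _)]
  exact ENNReal.ofReal_le_ofReal (h N)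

theorem exists_profile (hβ : 0 < β) (hm : 0 < m) (h0 : 0 < θ) (h1 : θ < 1) (hδ : 0 < δ)
    (hΦ : IsCutoff θ δ Φ) {C : ℝ} (hC : 0 < C)
    (hB : ∀ k k' : ℝ, 0 < k' → k' ≤ k →
      comptonKernel β m k k' * Real.exp (-β * k) ≤ C * Real.exp (-((k - k') / 2)) / (k + k'))
    {η : ℝ} (hη : 0 < η) (hη2 : η < 1 / 2) {M : ℝ} (hM : 0 ≤ M) (p₀ : ProbabilityMeasure ℝ≥0)
    (hX : ∫⁻ k : ℝ≥0, ENNReal.ofReal (Real.exp (η * k)) ∂(p₀ : Measure ℝ≥0) < ⊤) :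
    ∃ q : ℝ → ProbabilityMeasure ℝ≥0, Continuous q ∧ q 0 = p₀ ∧
      (∀ φ : ℝ → ℝ, IsTestFunction φ → ∀ t : ℝ, 0 ≤ t →
        ∫ k : ℝ≥0, φ k ∂(q t : Measure ℝ≥0) = ∫ k : ℝ≥0, φ k ∂(p₀ : Measure ℝ≥0) +
          ∫ s in (0 : ℝ)..t, profileOperator β m Φ M φ (q s)) ∧
      ∀ t : ℝ, 0 ≤ t → ∫⁻ k : ℝ≥0, ENNReal.ofReal (Real.exp (η * k)) ∂(q t : Measure ℝ≥0) ≤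
        ENNReal.ofReal (Real.exp (expRate C θ η * t)) *
          ∫⁻ k : ℝ≥0, ENNReal.ofReal (Real.exp (η * k)) ∂(p₀ : Measure ℝ≥0) := by
  set X := ∫⁻ k : ℝ≥0, ENNReal.ofReal (Real.exp (η * k)) ∂(p₀ : Measure ℝ≥0) with hXdef
  set R := expRate C θ η with hR
  have hR0 : 0 ≤ R := expRate_nonneg hC.le h0 h1 hη.le hη2
  -- The cut-off radius also bounds the time step, so both tend to `0` together.
  let r : ℕ → ℝ≥0 := fun n => 1 / ((n : ℝ≥0) + 1)
  have hrpos : ∀ n, 0 < r n := fun n => by positivity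
  have hrlim : Tendsto (fun n => (r n : ℝ)) atTop (𝓝 0) := by
    have := tendsto_one_div_add_atTop_nhds_zero_nat (𝕜 := ℝ)
    simpa [r] using this
  choose h hpos hle P hP0 hP using fun n : ℕ =>
    exists_scheme (β := β) (m := m) hβ hm h0 h1 hδ hΦ hM (hrpos n) (NNReal.coe_pos.2 (hrpos n)) p₀
  have hhlim : Tendsto h atTop (𝓝 0) :=
    squeeze_zero (fun n => (hpos n).le) hle hrlim
  -- For `t ≤ 0` the natural floor is `0` and the curve stays at `p₀`, so that it is defined on all
  -- of `ℝ`.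
  let p : ℕ → ℝ → ProbabilityMeasure ℝ≥0 := fun n t => P n ⌊t / h n⌋₊
  have hp0 : ∀ n, ∀ t ≤ 0, p n t = p₀ := fun n t ht => by
    show P n ⌊t / h n⌋₊ = p₀
    rw [Nat.floor_of_nonpos (div_nonpos_of_nonpos_of_nonneg ht (hpos n).le), hP0]
  have hmom : ∀ n (N : ℝ) t, 0 ≤ t → ∫ k, truncExp η N k ∂(p n t : Measure ℝ≥0) ≤
      Real.exp (R * t) * X.toReal := by
    intro n N t ht
    have hst : ∀ j : ℕ, ∫ k, truncExp η N k ∂(P n (j + 1) : Measure ℝ≥0) ≤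
        (1 + h n * R) * ∫ k, truncExp η N k ∂(P n j : Measure ℝ≥0) := fun j => by
      rw [hP n j _ (continuous_truncExp η N).measurable ⟨_, abs_truncExp_le hη.le N⟩]
      have := cutOperator_truncExp_le hβ hm h0 h1 hδ hΦ hC hB hη hη2 N (r n) hM (P n j)
      nlinarith [mul_le_mul_of_nonneg_left this (hpos n).le]
    refine (floor_le_exp_mul hR0 (hpos n) (f := fun j => ∫ k, truncExp η N k ∂(P n j : Measure ℝ≥0))
      (integral_nonneg fun k => Real.exp_nonneg _) hst ht).trans ?_
    refine mul_le_mul_of_nonneg_left ?_ (Real.exp_nonneg _)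
    rw [hP0]
    exact integral_truncExp_le_toReal hX hη.le N
  have hcomp : ∀ t₀ : ℝ, ∃ Y : Set (ProbabilityMeasure ℝ≥0), IsCompact Y ∧
      ∀ n, ∀ t ≤ t₀, p n t ∈ Y := by
    intro t₀
    refine ⟨_, isCompact_setOf_tail_le hη (Real.exp (R * max t₀ 0) * X.toReal),
      fun n t ht N => measure_compl_Icc_le hη.le ?_⟩
    rcases le_total 0 t with htn | htn
    · refine (hmom n N t htn).trans ?_
      gcongr
      exact ht.trans (le_max_left _ _)
    · have e : p n t = p n 0 := by rw [hp0 n t htn, hp0 n 0 le_rfl]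
      rw [e]
      refine (hmom n N 0 le_rfl).trans ?_
      gcongr
      exact le_max_right _ _
  have hstep : ∀ φ : ℝ → ℝ, IsTestFunction φ → ∀ n j,
      ∫ k : ℝ≥0, φ k ∂(P n (j + 1) : Measure ℝ≥0) = ∫ k : ℝ≥0, φ k ∂(P n j : Measure ℝ≥0) +
        h n * cutOperator β m Φ M (r n) (fun k => φ k) (P n j) := by
    intro φ hφ n j
    obtain ⟨B, -, hB⟩ := hφ.exists_bound
    exact hP n j _ hφ.continuous_coe.measurable ⟨B, hB⟩
  have heq : ∀ f ∈ testFunctions, ∃ c : ℝ, ∀ n s t,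
      |∫ k, f k ∂(p n t : Measure ℝ≥0) - ∫ k, f k ∂(p n s : Measure ℝ≥0)| ≤
        c * (|t - s| + h n) := by
    rintro f ⟨φ, hφ, hfφ⟩
    obtain ⟨c, hc⟩ := exists_bound_cutOperator hβ hm h0 h1 hδ hΦ hφ hM
    refine ⟨c, fun n s t => ?_⟩
    simp_rw [hfφ]
    exact abs_floor_sub_floor_le (f := fun j => ∫ k : ℝ≥0, φ k ∂(P n j : Measure ℝ≥0)) (hstep φ hφ n) (fun j => hc (r n) (P n j)) (hpos n) s t
  obtain ⟨u, q, hu, hqc, hq⟩ := exists_subseq_tendsto_curve testFunctions_separate hhlim hcomp heq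
  refine ⟨q, hqc, ?_, ?_, ?_⟩
  · refine tendsto_nhds_unique (hq 0) (tendsto_const_nhds.congr fun n => (hp0 (u n) 0 le_rfl).symm)
  · intro φ hφ t ht
    obtain ⟨c, hc⟩ := exists_bound_cutOperator hβ hm h0 h1 hδ hΦ hφ hM
    obtain ⟨f, -, hfφ⟩ := hφ.exists_mem_testFunctions
    let w : ℕ → ℕ → ℝ := fun n j => cutOperator β m Φ M (r n) (fun k => φ k) (P n j)
    have hwc : ∀ n j, |w n j| ≤ c := fun n j => hc (r n) (P n j)
    have l1 : Tendsto (fun n => ∫ k : ℝ≥0, φ k ∂(p (u n) t : Measure ℝ≥0)) atTop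
        (𝓝 (∫ k : ℝ≥0, φ k ∂(q t : Measure ℝ≥0))) := by
      simp_rw [← hfφ]
      exact ((ProbabilityMeasure.continuous_integral_bcf f).tendsto _).comp (hq t)
    have l2 : Tendsto (fun n => ∫ s in (0 : ℝ)..t, w (u n) ⌊s / h (u n)⌋₊) atTop
        (𝓝 (∫ s in (0 : ℝ)..t, profileOperator β m Φ M φ (q s))) := by
      refine intervalIntegral.tendsto_integral_filter_of_dominated_convergence (fun _ => c)
        (Eventually.of_forall fun n => ?_)
        (Eventually.of_forall fun n => Eventually.of_forall fun s _ => hwc _ _)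
        intervalIntegrable_const (Eventually.of_forall fun s _ => ?_)
      · exact (intervalIntegrable_floor (hwc (u n)) 0 t).aestronglyMeasurable_restrict_uIoc
      · have l3 : Tendsto (fun n => profileOperator β m Φ M φ (p (u n) s)) atTop
            (𝓝 (profileOperator β m Φ M φ (q s))) :=
          ((continuous_profileOperator hβ hm h0 h1 hδ hΦ hφ M).tendsto _).comp (hq s)
        -- Uniformity of the restriction error in the measure is needed here, since the measure
        -- changes with `n`.
        have l4 : Tendsto (fun n => w (u n) ⌊s / h (u n)⌋₊ -
            profileOperator β m Φ M φ (p (u n) s)) atTop (𝓝 0) := by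
          rw [Metric.tendsto_nhds]
          intro ε hε
          obtain ⟨r₀, hr₀, hclose⟩ :=
            exists_abs_cutOperator_sub_le hβ hm h0 h1 hδ hΦ hφ hM (half_pos hε)
          filter_upwards [(hrlim.comp hu.tendsto_atTop).eventually_le_const hr₀] with n hn
          rw [Real.dist_0_eq_abs]
          exact (hclose (r (u n)) hn (p (u n) s)).trans_lt (half_lt_self hε)
        simpa using l4.add l3
    have l5 := (l1.sub_const (∫ k : ℝ≥0, φ k ∂(p₀ : Measure ℝ≥0))).sub l2
    have l6 : Tendsto (fun n => c * h (u n)) atTop (𝓝 0) := by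
      simpa using (hhlim.comp hu.tendsto_atTop).const_mul c
    have l7 : |∫ k : ℝ≥0, φ k ∂(q t : Measure ℝ≥0) - ∫ k : ℝ≥0, φ k ∂(p₀ : Measure ℝ≥0) -
        ∫ s in (0 : ℝ)..t, profileOperator β m Φ M φ (q s)| ≤ 0 := by
      refine le_of_tendsto_of_tendsto' l5.abs l6 fun n => ?_
      have := abs_sub_integral_floor_le
        (f := fun j => ∫ k : ℝ≥0, φ k ∂(P (u n) j : Measure ℝ≥0)) (hstep φ hφ (u n)) (hwc (u n)) (hpos (u n)) ht
      rwa [hP0] at this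
    have l8 := abs_eq_zero.1 (le_antisymm l7 (abs_nonneg _))
    linarith
  · intro t ht
    have l1 : ∀ N : ℕ, ∫ k, truncExp η N k ∂(q t : Measure ℝ≥0) ≤ Real.exp (R * t) * X.toReal := by
      intro N
      have hcont := ProbabilityMeasure.continuous_integral_bcf
        (BoundedContinuousFunction.ofNormedAddCommGroup (truncExp η N) (continuous_truncExp η N) _
          (abs_truncExp_le hη.le N))
      exact le_of_tendsto' ((hcont.tendsto _).comp (hq t)) fun n => hmom (u n) N t ht
    refine (lintegral_exp_le_of_truncExp_le hη.le l1).trans_eq ?_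
    rw [ENNReal.ofReal_mul (Real.exp_nonneg _), ENNReal.ofReal_toReal hX.ne]

end Existence

/-! ### From the profile back to the measure of mass `M` -/

section Conclusion

open Filter Topology

/-- Integration by parts: `ψ` vanishes at `0` and for large times, so no boundary term survives. -/
lemma memW1InftyLoc_of_hasDerivAt {f F : ℝ → ℝ} (hf : Continuous f) (hF : Continuous F)
    (hd : ∀ t, 0 < t → HasDerivAt f (F t) t) : MemW1InftyLoc f := by
  have hbd : ∀ g : ℝ → ℝ, Continuous g → ∀ T : ℝ, MemLp g ⊤ (volume.restrict (Ioo 0 T)) := by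
    intro g hg T
    obtain ⟨c, hc⟩ := isCompact_Icc.exists_bound_of_continuousOn (s := Icc 0 T) hg.continuousOn
    refine memLp_top_of_bound hg.aestronglyMeasurable c ?_
    filter_upwards [ae_restrict_mem measurableSet_Ioo] with t ht
    exact hc t (Ioo_subset_Icc_self ht)
  refine ⟨F, fun T _ => ⟨hbd f hf T, hbd F hF T⟩, fun ψ hψ hψc hψs => ?_⟩
  have hψ1 : ContDiff ℝ 1 ψ := hψ.of_le (by exact_mod_cast le_top)
  have hψd : Continuous (deriv ψ) := hψ1.continuous_deriv le_rfl
  have i1 : Integrable (fun t => F t * ψ t) :=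
    (hF.mul hψ.continuous).integrable_of_hasCompactSupport hψc.mul_left
  have i2 : Integrable (fun t => f t * deriv ψ t) :=
    (hf.mul hψd).integrable_of_hasCompactSupport hψc.deriv.mul_left
  have hz : ψ 0 = 0 := image_eq_zero_of_notMem_tsupport fun h =>
    lt_irrefl (0 : ℝ) (hψs h)
  have hlim : Tendsto (fun t => f t * ψ t) atTop (𝓝 0) := by
    have hc : HasCompactSupport fun t => f t * ψ t := hψc.mul_left
    rw [hasCompactSupport_iff_eventuallyEq, coclosedCompact_eq_cocompact] at hc
    exact tendsto_const_nhds.congr' (hc.filter_mono atTop_le_cocompact).symm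
  have key := integral_Ioi_of_hasDerivAt_of_tendsto (a := (0 : ℝ)) (f := fun t => f t * ψ t)
    (f' := fun t => F t * ψ t + f t * deriv ψ t)
    (hf.mul hψ.continuous).continuousWithinAt
    (fun t ht => (hd t ht).mul (hψ1.differentiable one_ne_zero t).hasDerivAt)
    (i1.add i2).integrableOn hlim
  rw [integral_add i1.integrableOn i2.integrableOn, hz] at key
  linarith

lemma FiniteMeasure.integral_smul_toFiniteMeasure (M : ℝ≥0) (p : ProbabilityMeasure ℝ≥0)
    (f : ℝ≥0 → ℝ) : ∫ k, f k ∂((M • p.toFiniteMeasure : FiniteMeasure ℝ≥0) : Measure ℝ≥0) =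
      M * ∫ k, f k ∂(p : Measure ℝ≥0) := by
  rw [FiniteMeasure.toMeasure_smul, integral_smul_nnreal_measure]
  rfl

lemma expMoment_smul (η : ℝ) (M : ℝ≥0) (p : ProbabilityMeasure ℝ≥0) :
    expMoment η (M • p.toFiniteMeasure) =
      M * ∫⁻ k : ℝ≥0, ENNReal.ofReal (Real.exp (η * k)) ∂(p : Measure ℝ≥0) := by
  rw [expMoment, FiniteMeasure.toMeasure_smul]
  exact lintegral_smul_measure _ _

lemma exists_eq_smul_of_expMoment_lt_top {η : ℝ} (v : FiniteMeasure ℝ≥0)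
    (hv : expMoment η v < ⊤) : ∃ p : ProbabilityMeasure ℝ≥0, v = v.mass • p.toFiniteMeasure ∧
      ∫⁻ k : ℝ≥0, ENNReal.ofReal (Real.exp (η * k)) ∂(p : Measure ℝ≥0) < ⊤ := by
  by_cases h : v.mass = 0
  -- The zero measure has no normalization; any profile with finite moment will do.
  · refine ⟨⟨Measure.dirac 0, inferInstance⟩, ?_, ?_⟩
    · rw [h, zero_smul]
      exact v.mass_zero_iff.1 h
    · show ∫⁻ k : ℝ≥0, ENNReal.ofReal (Real.exp (η * k)) ∂(Measure.dirac 0) < ⊤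
      rw [lintegral_dirac]
      exact ENNReal.ofReal_lt_top
  · refine ⟨v.normalize, v.self_eq_mass_smul_normalize, ?_⟩
    rw [v.self_eq_mass_smul_normalize, expMoment_smul] at hv
    by_contra hne
    rw [not_lt, top_le_iff] at hne
    rw [hne, ENNReal.mul_top (by exact_mod_cast h)] at hv
    exact lt_irrefl _ hv

/-- The quadratic part scales like `M²` and the linear part like `M`, whence the factor `M` before
the interaction in `profileOperator`. -/
lemma weakCollision_smul {β m θ δ : ℝ} {Φ : ℝ≥0 × ℝ≥0 → ℝ} {φ : ℝ → ℝ} (hβ : 0 < β) (hm : 0 < m)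
    (h0 : 0 < θ) (h1 : θ < 1) (hδ : 0 < δ) (hΦ : IsCutoff θ δ Φ) (hφ : IsTestFunction φ)
    (M : ℝ≥0) (p : ProbabilityMeasure ℝ≥0) :
    weakCollision β m Φ φ ((M • p.toFiniteMeasure : FiniteMeasure ℝ≥0) : Measure ℝ≥0) =
      M * profileOperator β m Φ M φ p := by
  rw [weakCollision_eq hβ hm h0 h1 hδ hΦ hφ, FiniteMeasure.integral_smul_toFiniteMeasure,
    FiniteMeasure.toMeasure_smul]
  have e : ((M • (p.toFiniteMeasure : Measure ℝ≥0)).prod (M • (p.toFiniteMeasure : Measure ℝ≥0))) =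
      M • M • ((p : Measure ℝ≥0).prod (p : Measure ℝ≥0)) := by
    show (((M : ℝ≥0∞) • (p : Measure ℝ≥0)).prod ((M : ℝ≥0∞) • (p : Measure ℝ≥0))) =
      (M : ℝ≥0∞) • (M : ℝ≥0∞) • ((p : Measure ℝ≥0).prod (p : Measure ℝ≥0))
    rw [Measure.prod_smul_left, Measure.prod_smul_right]
  rw [e, integral_smul_nnreal_measure, integral_smul_nnreal_measure, profileOperator]
  simp only [NNReal.smul_def, smul_eq_mul]
  ring

end Conclusion

theorem theorem1p1 (β m : ℝ) (hβ : 0 < β) (hm : 0 < m) :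
    ∃ Cstar : ℝ, 0 < Cstar ∧ Cstar ∈ kernelBounds β m ∧
      (β = 1 → IsLeast (kernelBounds β m) Cstar) ∧
      ∀ (θ δ : ℝ), 0 < θ → θ < 1 → 0 < δ →
      ∀ Φ : ℝ≥0 × ℝ≥0 → ℝ, IsCutoff θ δ Φ →
      ∀ η : ℝ, η ∈ Ioo ((1 - θ) / 2) (1 / 2) →
      ∀ v₀ : FiniteMeasure ℝ≥0, expMoment η v₀ < ⊤ →
      ∃ v : ℝ → FiniteMeasure ℝ≥0,
        ContinuousOn v (Ici 0) ∧
        IsWeakSolution β m Φ v₀ v ∧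
        ∀ t : ℝ, 0 ≤ t →
          (v t).mass = v₀.mass ∧
          expMoment η (v t) ≤
            ENNReal.ofReal (Real.exp (expRate Cstar θ η * t)) * expMoment η v₀ := by
  obtain ⟨C, hC, hCk, hCl, hB⟩ := exists_kernel_constant hβ hm
  refine ⟨C, hC, hCk, hCl, fun θ δ h0 h1 hδ Φ hΦ η hη v₀ hv₀ => ?_⟩
  have hη0 : 0 < η := by linarith [hη.1]
  obtain ⟨p₀, hp₀, hX⟩ := exists_eq_smul_of_expMoment_lt_top v₀ hv₀
  set M : ℝ≥0 := v₀.mass with hM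
  obtain ⟨q, hqc, hq0, hqe, hqm⟩ :=
    exists_profile hβ hm h0 h1 hδ hΦ hC hB hη0 hη.2 M.2 p₀ hX
  have hvc : Continuous fun t : ℝ => M • (q t).toFiniteMeasure :=
    (ProbabilityMeasure.toFiniteMeasure_continuous.comp hqc).const_smul M
  have hcont : ∀ f : BoundedContinuousFunction ℝ≥0 ℝ, Continuous fun t : ℝ =>
      ∫ k, f k ∂((M • (q t).toFiniteMeasure : FiniteMeasure ℝ≥0) : Measure ℝ≥0) := by
    intro f
    simp_rw [FiniteMeasure.integral_smul_toFiniteMeasure]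
    exact ((ProbabilityMeasure.continuous_integral_bcf f).comp hqc).const_mul _
  have hF : ∀ φ : ℝ → ℝ, IsTestFunction φ → Continuous fun t : ℝ =>
      weakCollision β m Φ φ ((M • (q t).toFiniteMeasure : FiniteMeasure ℝ≥0) : Measure ℝ≥0) := by
    intro φ hφ
    simp_rw [weakCollision_smul hβ hm h0 h1 hδ hΦ hφ]
    exact ((continuous_profileOperator hβ hm h0 h1 hδ hΦ hφ M).comp hqc).const_mul _
  have hder : ∀ φ : ℝ → ℝ, IsTestFunction φ → ∀ t : ℝ, 0 < t → HasDerivAt (fun s : ℝ =>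
      ∫ k : ℝ≥0, φ k ∂((M • (q s).toFiniteMeasure : FiniteMeasure ℝ≥0) : Measure ℝ≥0))
      (weakCollision β m Φ φ ((M • (q t).toFiniteMeasure : FiniteMeasure ℝ≥0) : Measure ℝ≥0)) t := by
    intro φ hφ t ht
    have hc := (continuous_profileOperator hβ hm h0 h1 hδ hΦ hφ M).comp hqc
    -- The integrand is continuous in time, so the integrated equation can be differentiated at
    -- every `t > 0`. It holds only for nonnegative times, hence the restriction to a neighbourhood
    -- of `t` below.
    have d1 := (((hc.integral_hasStrictDerivAt 0 t).hasDerivAt.const_add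
      (∫ k : ℝ≥0, φ k ∂(p₀ : Measure ℝ≥0))).const_mul (M : ℝ))
    rw [weakCollision_smul hβ hm h0 h1 hδ hΦ hφ]
    refine d1.congr_of_eventuallyEq ?_
    filter_upwards [lt_mem_nhds ht] with s hs
    rw [FiniteMeasure.integral_smul_toFiniteMeasure M (q s) fun k => φ k, hqe φ hφ s hs.le]
    rfl
  refine ⟨fun t => M • (q t).toFiniteMeasure, hvc.continuousOn,
    ⟨fun f => (hcont f).continuousOn, fun f => ?_, fun φ hφ => ?_, fun φ hφ => ?_⟩,
    fun t ht => ⟨?_, ?_⟩⟩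
  · rw [hq0, ← hp₀]
  · obtain ⟨f, -, hfφ⟩ := hφ.exists_mem_testFunctions
    refine memW1InftyLoc_of_hasDerivAt ?_ (hF φ hφ) (hder φ hφ)
    simp_rw [← hfφ]
    exact hcont f
  · filter_upwards [ae_restrict_mem measurableSet_Ioi] with t ht
    exact ⟨collisionIntegrable hβ hm h0 h1 hδ hΦ hφ _, hder φ hφ t ht⟩
  · rw [← ENNReal.coe_inj, FiniteMeasure.ennreal_mass, FiniteMeasure.toMeasure_smul]
    show (M : ℝ≥0∞) * (q t : Measure ℝ≥0) univ = M
    rw [measure_univ, mul_one]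
  · rw [expMoment_smul, hp₀, expMoment_smul, mul_left_comm]
    gcongr
    exact hqm t ht
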